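/- **Setting.** Let $M>0$ and consider the Schwarzschild exterior $r>2M$ with metric $ds^2=\frac{\Delta}{r^2}dt^2-\frac{r^2}{\Delta}dr^2-r^2(d\theta^2+\sin^2\theta\,d\phi^2)$, $\Delta=r(r-2M)$, and the Carter frame $l^a=\frac{1}{\sqrt2 r}\big(\frac{r^2}{\sqrt\Delta}\partial_t+\sqrt\Delta\,\partial_r\big)$, $n^a=\frac{1}{\sqrt2 r}\big(\frac{r^2}{\sqrt\Delta}\partial_t-\sqrt\Delta\,\partial_r\big)$, $m^a=\frac{1}{\sqrt2 r}\big(\partial_\theta+\frac{i}{\sin\theta}\partial_\phi\big)$. Write $D=l^a\nabla_a$, $D'=n^a\nabla_a$, $D_t=D+D'$, $D_r=D-D'$, and let þ, þ$'$, $\eth,\eth'$ be the Geroch–Held–Penrose (GHP) derivatives in this frame, whose non-zero spin coefficients are $\rho=-\rho'=-\frac{\sqrt\Delta}{\sqrt2 r^2}$, $\beta=\beta'=\frac{\cot\theta}{2\sqrt2 r}$, $\epsilon=-\epsilon'=\frac{M}{2\sqrt{2\Delta}\,r}$. The orientation is the Newman–Penrose one, $\varepsilon_{abcd}l^an^bm^c\bar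 m^d=-i$. Let $\Sigma=\{t=0\}$, with lapse $N=\sqrt\Delta/r$, unit normal $u^a$, negative definite induced metric $h_{ab}$ with derivative $D_a$, and its volume element. A *Hertz potential* is a smooth scalar $\varphi$ of GHP weight $(-2,0)$ on the exterior (smooth across the axis as a spin-weighted quantity) solving the spin-$(-1)$ Teukolsky equation $[(\text{þ}'-\bar\rho')(\text{þ}+\rho)-\eth'\eth]\varphi=0$. Put $\chi=(\text{þ}+\rho)\varphi$, $\mathscr A_a=-l_a\eth\varphi+m_a\chi$, $\mathscr F_{ab}=2\nabla_{[a}\mathscr A_{b]}$. With $E_a=u^b\mathscr F_{ba}$ and $F_{ab}$ the projection of $\mathscr F_{ab}$ to $\Sigma$, the canonical energy is $$\mathscr E_{EM}[\mathscr A]=\tfrac1{4\pi}\int_\Sigma N\big[-\bar E_aE^a+\tfrac12\bar F_{ab}F^{ab}\big].$$ **(1)** For every Hertz potential $\varphi$, $\mathscr F_{ab}$ solves the source-free Maxwell equation and is self-dual, $(*\mathscr F)_{ab}=i\mathscr F_{ab}$. If either of the two integrals below (with their non-negative integrands) is finite, so is the other. If they are finite, $$\mathscr E_{EM}[\mathscr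 A]=\tfrac1{4\pi}\int_\Sigma N\Big[\tfrac12|D_t\chi|^2+\tfrac12|(D_r-2\rho)\chi|^2+|\eth\chi|^2+|\eth'\chi|^2+\tfrac1{r^2}|\chi|^2\Big].$$ **(2)** Let $\hat{\mathscr A}_a$ be a smooth real solution of the source-free Maxwell equation on the exterior, $\hat\varphi_2=\hat{\mathscr F}_{ab}\bar m^an^b$, and $\varphi=r^2\hat\varphi_2$. Then $\varphi$ is a Hertz potential. Pasqualotto's covector $\underline\Phi_a=\frac{\sqrt2r^3}{\sqrt\Delta}D\big[\sqrt{2\Delta}\,(m_a\hat\varphi_2+\bar m_a\bar{\hat\varphi}_2)\big]$ equals $2r(m_a\Phi_P+\bar m_a\bar\Phi_P)$ with $\Phi_P=(\text{þ}+\rho)\varphi=\chi$. With Pasqualotto's Fackerell–Ipser energy ($\mathscr D_a$ the derivative on the spheres of constant $r$) $$\mathscr E_P[\hat{\mathscr A}]=\tfrac18\int_\Sigma Nr^{-2}\Big[-\tfrac12(D_t\underline\Phi_a)^2-\tfrac12(D_r\underline\Phi_a)^2+(\mathscr D_b\underline\Phi_a)^2-\tfrac1{r^2}(\underline\Phi_a)^2\Big],$$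 $\mathscr E_{EM}[\mathscr A]$ is finite if and only if $\mathscr E_P[\hat{\mathscr A}]$ is, and then $$\mathscr E_P[\hat{\mathscr A}]=\int_\Sigma N\Big[\tfrac12|D_t\Phi_P|^2+\tfrac12|(D_r-2\rho)\Phi_P|^2+|\eth\Phi_P|^2+|\eth'\Phi_P|^2+\tfrac1{r^2}|\Phi_P|^2\Big],\qquad \mathscr E_{EM}[\mathscr A]=\tfrac1{4\pi}\mathscr E_P[\hat{\mathscr A}].$$ **(3)** Let $\Psi=i\sqrt2\,r\sin\theta\,\chi$ (Ernst potential), $\phi^a=\partial_\phi$, $\Phi=-\phi_a\phi^a=r^2\sin^2\theta$ and $Z_a=-\frac12\Phi^{-1}D_a\Phi$. For every Hertz potential, $\phi^a\mathscr A_a=-\frac12\Psi$. If $\varphi$ is axisymmetric and $\mathscr E_{EM}[\mathscr A]$ is finite, then the following integrals converge absolutely and $$\mathscr E_{EM}[\mathscr A]=\tfrac1{8\pi}\int_\Sigma N^{-1}\Phi^{-1}|\dot\Psi|^2-N\Phi^{-1}h^{ab}D_a\Psi D_b\bar\Psi$$ $$\phantom{\mathscr E_{EM}[\mathscr A]}=\tfrac1{8\pi}\int_\Sigma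 N^{-1}\Phi^{-1}|\dot\Psi|^2-N\Phi^{-1}h^{ab}\big[(D_a\Psi+Z_a\Psi)(D_b\bar\Psi+Z_b\bar\Psi)+Z_aZ_b|\Psi|^2\big].$$ -/

import Mathlib

open Set MeasureTheory
open scoped ContDiff

noncomputable section

namespace SchwarzschildEM

/-- Coordinate space of the Schwarzschild chart: `x 0 = t`, `x 1 = r`, `x 2 = θ`, `x 3 = ϕ`. -/
abbrev Pt := Fin 4 → ℝ

/-- The exterior region of the black hole of mass `M`, in the chart `(t, r, θ, ϕ)`. -/
def exterior (M : ℝ) : Set Pt := {x | 2 * M < x 1 ∧ 0 < x 2 ∧ x 2 < Real.pi}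

/-- The coordinate partial derivative `∂_μ f`. -/
def pd {E : Type*} [NormedAddCommGroup E] [NormedSpace ℝ E] (μ : Fin 4) (f : Pt → E) : Pt → E :=
  fun x => fderiv ℝ f x (Pi.single μ 1)

/-- `Δ = r (r - 2 M)`. -/
def Delta (M : ℝ) (x : Pt) : ℝ := x 1 * (x 1 - 2 * M)

/-- The Schwarzschild metric `g_{μν}`, signature `(+,-,-,-)`. -/
def metric (M : ℝ) (x : Pt) : Matrix (Fin 4) (Fin 4) ℝ :=
  Matrix.diagonal ![Delta M x / x 1 ^ 2, -(x 1 ^ 2 / Delta M x), -x 1 ^ 2,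
    -(x 1 ^ 2 * Real.sin (x 2) ^ 2)]

/-- The inverse metric `g^{μν}`. -/
def metricInv (M : ℝ) (x : Pt) : Matrix (Fin 4) (Fin 4) ℝ :=
  Matrix.diagonal ![x 1 ^ 2 / Delta M x, -(Delta M x / x 1 ^ 2), -(x 1 ^ 2)⁻¹,
    -(x 1 ^ 2 * Real.sin (x 2) ^ 2)⁻¹]

theorem metric_mul_metricInv {M : ℝ} (hM : 0 < M) {x : Pt} (hx : x ∈ exterior M) :
    metric M x * metricInv M x = 1 := by
  obtain ⟨h1, h2, h3⟩ := hx
  have hr : x 1 ≠ 0 := by linarith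
  have hs : Real.sin (x 2) ≠ 0 := (Real.sin_pos_of_pos_of_lt_pi h2 h3).ne'
  have hd : Delta M x ≠ 0 := mul_ne_zero hr (by linarith)
  rw [metric, metricInv, Matrix.diagonal_mul_diagonal, ← Matrix.diagonal_one]
  congr 1
  funext μ
  fin_cases μ <;> simp <;> field_simp

/-- `√|det g| = r² sin θ`. -/
def sqrtDetMetric (x : Pt) : ℝ := x 1 ^ 2 * Real.sin (x 2)

/-! ### The Carter frame -/

/-- The real null vector `l^μ`. -/
def lUp (M : ℝ) (x : Pt) : Fin 4 → ℝ :=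
  ![x 1 ^ 2 / √(Delta M x) / (√2 * x 1), √(Delta M x) / (√2 * x 1), 0, 0]

/-- The real null vector `n^μ`. -/
def nUp (M : ℝ) (x : Pt) : Fin 4 → ℝ :=
  ![x 1 ^ 2 / √(Delta M x) / (√2 * x 1), -(√(Delta M x) / (√2 * x 1)), 0, 0]

/-- The complex null vector `m^μ`. -/
def mUp (x : Pt) : Fin 4 → ℂ :=
  ![0, 0, 1 / (√2 * x 1 : ℝ), Complex.I / (√2 * x 1 * Real.sin (x 2) : ℝ)]

/-- The covector `l_μ = g_{μν} l^ν`. -/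
def lDown (M : ℝ) (x : Pt) (μ : Fin 4) : ℝ := ∑ ν, metric M x μ ν * lUp M x ν

/-- The covector `m_μ = g_{μν} m^ν`. -/
def mDown (M : ℝ) (x : Pt) (μ : Fin 4) : ℂ := ∑ ν, (metric M x μ ν : ℂ) * mUp x ν

/-- The Newman-Penrose derivative `D = l^μ ∂_μ` on scalars. -/
def npD (M : ℝ) (ξ : Pt → ℂ) (x : Pt) : ℂ := ∑ μ, (lUp M x μ : ℂ) * pd μ ξ x

/-- The Newman-Penrose derivative `D' = n^μ ∂_μ` on scalars. -/
def npD' (M : ℝ) (ξ : Pt → ℂ) (x : Pt) : ℂ := ∑ μ, (nUp M x μ : ℂ) * pd μ ξ x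

/-- The Newman-Penrose derivative `δ = m^μ ∂_μ` on scalars. -/
def npDelta (ξ : Pt → ℂ) (x : Pt) : ℂ := ∑ μ, mUp x μ * pd μ ξ x

/-- The Newman-Penrose derivative `δ' = m̄^μ ∂_μ` on scalars. -/
def npDelta' (ξ : Pt → ℂ) (x : Pt) : ℂ := ∑ μ, star (mUp x μ) * pd μ ξ x

/-! The spin coefficients of the Carter frame: they are real, `ρ' = -ρ`, `β' = β`, `ε' = -ε`,
and `τ`, `κ`, `σ` and their primed versions vanish. -/

/-- The spin coefficient `ρ`. -/
def rho (M : ℝ) (x : Pt) : ℝ := -(√(Delta M x) / (√2 * x 1 ^ 2))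

/-- The spin coefficient `ρ'`. -/
def rho' (M : ℝ) (x : Pt) : ℝ := -rho M x

/-- The spin coefficient `β = β'`. -/
def beta (x : Pt) : ℝ := Real.cos (x 2) / Real.sin (x 2) / (2 * √2 * x 1)

/-- The spin coefficient `ε`. -/
def eps (M : ℝ) (x : Pt) : ℝ := M / (2 * √(2 * Delta M x) * x 1)

/-- The spin coefficient `ε'`. -/
def eps' (M : ℝ) (x : Pt) : ℝ := -eps M x

/-! The Geroch-Held-Penrose derivatives of a scalar `ξ` of weight `(p, q)`, in the Carter frame. -/

/-- `þ ξ = (D - p ε - q ε̄) ξ`, of weight `(p + 1, q + 1)`. -/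
def thorn (M : ℝ) (p q : ℤ) (ξ : Pt → ℂ) (x : Pt) : ℂ :=
  npD M ξ x - (p : ℂ) * (eps M x : ℂ) * ξ x - (q : ℂ) * (eps M x : ℂ) * ξ x

/-- `þ' ξ = (D' + p ε' + q ε̄') ξ`, of weight `(p - 1, q - 1)`. -/
def thorn' (M : ℝ) (p q : ℤ) (ξ : Pt → ℂ) (x : Pt) : ℂ :=
  npD' M ξ x + (p : ℂ) * (eps' M x : ℂ) * ξ x + (q : ℂ) * (eps' M x : ℂ) * ξ x

/-- `ð ξ = (δ - p β + q β̄') ξ`, of weight `(p + 1, q - 1)`. -/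
def eth (p q : ℤ) (ξ : Pt → ℂ) (x : Pt) : ℂ :=
  npDelta ξ x - (p : ℂ) * (beta x : ℂ) * ξ x + (q : ℂ) * (beta x : ℂ) * ξ x

/-- `ð' ξ = (δ' + p β' - q β̄) ξ`, of weight `(p - 1, q + 1)`. -/
def eth' (p q : ℤ) (ξ : Pt → ℂ) (x : Pt) : ℂ :=
  npDelta' ξ x + (p : ℂ) * (beta x : ℂ) * ξ x - (q : ℂ) * (beta x : ℂ) * ξ x

/-! ### Smooth fields on the exterior `ℝ × (2M, ∞) × S²`, including the axis -/

/-- The Cartesian-type coordinates `(t, r n̂)` as functions of `(t, r, θ, ϕ)`. -/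
def cart (x : Pt) : Fin 4 → ℝ :=
  ![x 0, x 1 * Real.sin (x 2) * Real.cos (x 3), x 1 * Real.sin (x 2) * Real.sin (x 3),
    x 1 * Real.cos (x 2)]

/-- `W` (components in the chart `(t, r, θ, ϕ)`) is a smooth complex one-form on the exterior:
it is the pull-back of a one-form `w_ν dy^ν` with smooth components on
`{(t, y) ∈ ℝ × ℝ³ : 2 M < |y|}`, so that it is smooth across the axis as well. -/
def IsSmoothOneForm (M : ℝ) (W : Fin 4 → Pt → ℂ) : Prop :=
  ∃ w : Fin 4 → (Fin 4 → ℝ) → ℂ,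
    (∀ ν, ContDiffOn ℝ ∞ (w ν) {y | 2 * M < √(y 1 ^ 2 + y 2 ^ 2 + y 3 ^ 2)}) ∧
    ∀ x ∈ exterior M, ∀ μ, W μ x = ∑ ν, w ν (cart x) * (pd μ (fun y => cart y ν) x : ℂ)

/-- `φ` is the Carter-frame expression of a smooth scalar of spin weight `-1` on the exterior:
`φ = W_a m̄^a` for a smooth complex one-form `W`. -/
def IsSmoothSpinNegOne (M : ℝ) (φ : Pt → ℂ) : Prop :=
  ∃ W : Fin 4 → Pt → ℂ, IsSmoothOneForm M W ∧
    ∀ x ∈ exterior M, φ x = ∑ μ, W μ x * star (mUp x μ)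

/-! ### Maxwell fields and Hertz potentials -/

/-- The field strength `F_{μν} = 2 ∇_{[μ} A_{ν]} = ∂_μ A_ν - ∂_ν A_μ`. -/
def fieldStrength (A : Fin 4 → Pt → ℂ) (μ ν : Fin 4) (x : Pt) : ℂ :=
  pd μ (A ν) x - pd ν (A μ) x

/-- Raising both indices: `F^{μν} = g^{μα} g^{νβ} F_{αβ}`. -/
def raise₂ (M : ℝ) (F : Fin 4 → Fin 4 → Pt → ℂ) (μ ν : Fin 4) (x : Pt) : ℂ :=
  ∑ α, ∑ β, (metricInv M x μ α : ℂ) * (metricInv M x ν β : ℂ) * F α β x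

/-- The source-free Maxwell equation `∇_ν F^{νμ} = |g|^{-1/2} ∂_ν (|g|^{1/2} F^{νμ}) = 0` on the
exterior. -/
def IsMaxwell (M : ℝ) (F : Fin 4 → Fin 4 → Pt → ℂ) : Prop :=
  ∀ x ∈ exterior M, ∀ μ,
    (sqrtDetMetric x : ℂ)⁻¹ *
      ∑ ν, pd ν (fun y => (sqrtDetMetric y : ℂ) * raise₂ M F ν μ y) x = 0

/-- The volume form `ε_{μναβ}`, with the orientation of the Newman-Penrose formalism,
`ε_{abcd} l^a n^b m^c m̄^d = -i`; in the chart `(t, r, θ, ϕ)` this is `ε_{trθϕ} = -r² sin θ`. -/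
def volForm (x : Pt) (μ ν α β : Fin 4) : ℝ :=
  -sqrtDetMetric x *
    Matrix.det (Matrix.of fun i j : Fin 4 => if ![μ, ν, α, β] i = j then (1 : ℝ) else 0)

/-- The Hodge dual `(*F)_{μν} = ½ ε_{μν}{}^{αβ} F_{αβ}`. -/
def hodge (M : ℝ) (F : Fin 4 → Fin 4 → Pt → ℂ) (μ ν : Fin 4) (x : Pt) : ℂ :=
  (1 / 2) * ∑ α, ∑ β, (volForm x μ ν α β : ℂ) * raise₂ M F α β x

/-- Self-duality `*F = i F` on the exterior. -/
def IsSelfDual (M : ℝ) (F : Fin 4 → Fin 4 → Pt → ℂ) : Prop :=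
  ∀ x ∈ exterior M, ∀ μ ν, hodge M F μ ν x = Complex.I * F μ ν x

/-- `χ = (þ + ρ) φ`, of weight `(-1, 1)`, for `φ` of weight `(-2, 0)`. -/
def chi (M : ℝ) (φ : Pt → ℂ) (x : Pt) : ℂ := thorn M (-2) 0 φ x + (rho M x : ℂ) * φ x

/-- The spin-(-1) Teukolsky operator
`𝒪† φ = [(þ' - ρ̄')(þ + ρ) - ð' ð] φ` for `φ` of weight `(-2, 0)` (here `τ = 0`). -/
def teukolsky (M : ℝ) (φ : Pt → ℂ) (x : Pt) : ℂ :=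
  thorn' M (-1) 1 (chi M φ) x - (rho' M x : ℂ) * chi M φ x - eth' (-1) (-1) (eth (-2) 0 φ) x

/-- A smooth spin-(-1) Hertz potential on the exterior. -/
def IsHertzPotential (M : ℝ) (φ : Pt → ℂ) : Prop :=
  IsSmoothSpinNegOne M φ ∧ ∀ x ∈ exterior M, teukolsky M φ x = 0

/-- The complex vector potential `A_a = -l_a ð φ + m_a (þ + ρ) φ` generated by `φ`. -/
def hertzA (M : ℝ) (φ : Pt → ℂ) (μ : Fin 4) (x : Pt) : ℂ :=
  -(lDown M x μ : ℂ) * eth (-2) 0 φ x + mDown M x μ * chi M φ x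

/-! ### Integration over the Cauchy surface `Σ = {t = 0}` -/

/-- The lapse `N = √Δ / r`. -/
def lapse (M : ℝ) (x : Pt) : ℝ := √(Delta M x) / x 1

/-- The ranges of `(r, θ, ϕ)` on `Σ`. -/
def sigmaRegion (M : ℝ) : Set (ℝ × ℝ × ℝ) :=
  Ioi (2 * M) ×ˢ Ioo 0 Real.pi ×ˢ Ioo 0 (2 * Real.pi)

/-- The point of `Σ` with coordinates `(r, θ, ϕ)`. -/
def sigmaPt (p : ℝ × ℝ × ℝ) : Pt := ![0, p.1, p.2.1, p.2.2]

/-- The density `r² sin θ / N` of the volume element of the induced metric on `Σ`. -/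
def sigmaVol (M : ℝ) (x : Pt) : ℝ := x 1 ^ 2 * Real.sin (x 2) / lapse M x

/-- `∫_Σ f`, with respect to the volume element of the induced metric. -/
def sigmaIntegral (M : ℝ) (f : Pt → ℝ) : ℝ :=
  ∫ p in sigmaRegion M, f (sigmaPt p) * sigmaVol M (sigmaPt p)

/-- `f` is integrable over `Σ`. -/
def SigmaIntegrable (M : ℝ) (f : Pt → ℝ) : Prop :=
  IntegrableOn (fun p => f (sigmaPt p) * sigmaVol M (sigmaPt p)) (sigmaRegion M)

/-! ### The canonical energy

The induced metric `h_{ij}` on `Σ` is negative definite; `h^{ij}` is the spatial block of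
`g^{μν}`. Spatial indices are `i.succ` for `i : Fin 3`. -/

/-- The unit normal `u = (l + n) / √2` of the slices of constant `t`. -/
def uUp (M : ℝ) (x : Pt) (μ : Fin 4) : ℝ := (lUp M x μ + nUp M x μ) / √2

/-- The electric field `E_a = u^b F_{ba}`. -/
def electric (M : ℝ) (F : Fin 4 → Fin 4 → Pt → ℂ) (μ : Fin 4) (x : Pt) : ℂ :=
  ∑ ν, (uUp M x ν : ℂ) * F ν μ x

/-- `-Ē_a E^a`. -/
def electricDensity (M : ℝ) (F : Fin 4 → Fin 4 → Pt → ℂ) (x : Pt) : ℝ :=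
  -(∑ i : Fin 3, ∑ j : Fin 3, (metricInv M x i.succ j.succ : ℂ) *
      star (electric M F i.succ x) * electric M F j.succ x).re

/-- `½ F̄_{ab} F^{ab}`, for the spatial (magnetic) part of `F`. -/
def magneticDensity (M : ℝ) (F : Fin 4 → Fin 4 → Pt → ℂ) (x : Pt) : ℝ :=
  (1 / 2) * (∑ i : Fin 3, ∑ j : Fin 3, ∑ k : Fin 3, ∑ l : Fin 3,
    (metricInv M x i.succ k.succ : ℂ) * (metricInv M x j.succ l.succ : ℂ) *
      star (F i.succ j.succ x) * F k.succ l.succ x).re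

/-- The integrand `N [-Ē_a E^a + ½ F̄_{ab} F^{ab}]`. -/
def canonicalDensity (M : ℝ) (A : Fin 4 → Pt → ℂ) (x : Pt) : ℝ :=
  lapse M x * (electricDensity M (fieldStrength A) x + magneticDensity M (fieldStrength A) x)

/-- The canonical energy `𝓔_EM[A] = (1/4π) ∫_Σ N [-Ē_a E^a + ½ F̄_{ab} F^{ab}]`. -/
def canonicalEnergy (M : ℝ) (A : Fin 4 → Pt → ℂ) : ℝ :=
  1 / (4 * Real.pi) * sigmaIntegral M (canonicalDensity M A)

/-! ### Pasqualotto's energy -/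

/-- The integrand
`N [½ |D_t Φ|² + ½ |(D_r - 2ρ) Φ|² + |ð Φ|² + |ð' Φ|² + r⁻² |Φ|²]` for `Φ` of weight `(-1, 1)`,
where `D_t = D + D'`, `D_r = D - D'`. -/
def pasqScalarDensity (M : ℝ) (Φ : Pt → ℂ) (x : Pt) : ℝ :=
  lapse M x * (1 / 2 * ‖npD M Φ x + npD' M Φ x‖ ^ 2
    + 1 / 2 * ‖npD M Φ x - npD' M Φ x - 2 * (rho M x : ℂ) * Φ x‖ ^ 2
    + ‖eth (-1) 1 Φ x‖ ^ 2 + ‖eth' (-1) 1 Φ x‖ ^ 2 + 1 / x 1 ^ 2 * ‖Φ x‖ ^ 2)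

/-- The Christoffel symbols `Γ^l_{μν}` of the Schwarzschild metric. -/
def christoffel (M : ℝ) (l μ ν : Fin 4) (x : Pt) : ℝ :=
  1 / 2 * ∑ s, metricInv M x l s * (pd μ (fun y => metric M y ν s) x
    + pd ν (fun y => metric M y μ s) x - pd s (fun y => metric M y μ ν) x)

/-- The covariant derivative `∇_μ X_ν` of a real covector field. -/
def covDeriv (M : ℝ) (X : Fin 4 → Pt → ℝ) (μ ν : Fin 4) (x : Pt) : ℝ :=
  pd μ (X ν) x - ∑ l, christoffel M l μ ν x * X l x

/-- The component `φ₂ = F_{ab} m̄^a n^b` of the field strength of a real vector potential. -/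
def maxwellPhi₂ (M : ℝ) (A : Fin 4 → Pt → ℝ) (x : Pt) : ℂ :=
  ∑ μ, ∑ ν, fieldStrength (fun k y => (A k y : ℂ)) μ ν x * star (mUp x μ) * (nUp M x ν : ℂ)

/-- Pasqualotto's covector field
`Φ_a = (√2 r³ / √Δ) D [√(2Δ) (m_a φ₂ + m̄_a φ̄₂)]`, `D = l^b ∇_b`, of the real perturbation `A`. -/
def pasqVector (M : ℝ) (A : Fin 4 → Pt → ℝ) (μ : Fin 4) (x : Pt) : ℝ :=
  √2 * x 1 ^ 3 / √(Delta M x) * ∑ k, lUp M x k * covDeriv M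
    (fun ν y => √(2 * Delta M y) *
      (mDown M y ν * maxwellPhi₂ M A y + star (mDown M y ν * maxwellPhi₂ M A y)).re) k μ x

/-- `X_a X^a`. -/
def covectorSq (M : ℝ) (x : Pt) (X : Fin 4 → ℝ) : ℝ :=
  ∑ μ, ∑ ν, metricInv M x μ ν * X μ * X ν

/-- `(𝒟_b X_a)²` for a covector field `X` tangent to the spheres: the derivative `𝒟` of the sphere
is the projection of `∇`, so its components are the `∇_b X_a` with both indices in `{θ, ϕ}`. -/
def sphereDerivSq (M : ℝ) (X : Fin 4 → Pt → ℝ) (x : Pt) : ℝ :=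
  ∑ a ∈ ({2, 3} : Finset (Fin 4)), ∑ b ∈ ({2, 3} : Finset (Fin 4)),
    ∑ c ∈ ({2, 3} : Finset (Fin 4)), ∑ d ∈ ({2, 3} : Finset (Fin 4)),
      metricInv M x a c * metricInv M x b d * covDeriv M X a b x * covDeriv M X c d x

/-- The integrand
`⅛ N r⁻² [-½ (D_t X_a)² - ½ (D_r X_a)² + (𝒟_b X_a)² - r⁻² (X_a)²]`. -/
def pasqVectorDensity (M : ℝ) (X : Fin 4 → Pt → ℝ) (x : Pt) : ℝ :=
  1 / 8 * (lapse M x * (1 / x 1 ^ 2) *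
    (-(1 / 2) * covectorSq M x (fun μ => ∑ k, (lUp M x k + nUp M x k) * covDeriv M X k μ x)
      - 1 / 2 * covectorSq M x (fun μ => ∑ k, (lUp M x k - nUp M x k) * covDeriv M X k μ x)
      + sphereDerivSq M X x - 1 / x 1 ^ 2 * covectorSq M x (fun μ => X μ x)))

/-- Pasqualotto's energy `𝓔_P[A]` of the real perturbation `A`. -/
def pasqEnergy (M : ℝ) (A : Fin 4 → Pt → ℝ) : ℝ :=
  sigmaIntegral M (pasqVectorDensity M (pasqVector M A))

/-! ### Ernst potential -/

/-- `φ` is invariant under the rotations `ϕ ↦ ϕ + const`. -/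
def IsAxisymmetric (M : ℝ) (φ : Pt → ℂ) : Prop := ∀ x ∈ exterior M, pd 3 φ x = 0

/-- The Ernst potential `Ψ = i √2 r sin θ χ`. -/
def ernst (M : ℝ) (φ : Pt → ℂ) (x : Pt) : ℂ :=
  Complex.I * (√2 * x 1 * Real.sin (x 2) : ℝ) * chi M φ x

/-- `Φ = -ϕ_a ϕ^a` for the axial Killing field `ϕ^a = ∂/∂ϕ`. -/
def axialNorm (M : ℝ) (x : Pt) : ℝ := -metric M x 3 3

/-- The one-form `Z_a = -½ Φ⁻¹ ∂_a Φ`. -/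
def axialZ (M : ℝ) (μ : Fin 4) (x : Pt) : ℝ :=
  -(1 / 2) * (axialNorm M x)⁻¹ * pd μ (axialNorm M) x

/-- The integrand `N⁻¹ Φ⁻¹ |∂_t Ψ|² - N Φ⁻¹ h^{ab} D_a Ψ D_b Ψ̄`. -/
def ernstDensity (M : ℝ) (Ψ : Pt → ℂ) (x : Pt) : ℝ :=
  (lapse M x)⁻¹ * (axialNorm M x)⁻¹ * ‖pd 0 Ψ x‖ ^ 2
    - lapse M x * (axialNorm M x)⁻¹ *
      (∑ i : Fin 3, ∑ j : Fin 3, (metricInv M x i.succ j.succ : ℂ) *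
        pd i.succ Ψ x * star (pd j.succ Ψ x)).re

/-- The integrand
`N⁻¹ Φ⁻¹ |∂_t Ψ|² - N Φ⁻¹ h^{ab} [(D_a Ψ + Z_a Ψ)(D_b Ψ̄ + Z_b Ψ̄) + Z_a Z_b |Ψ|²]`. -/
def ernstDensityZ (M : ℝ) (Ψ : Pt → ℂ) (x : Pt) : ℝ :=
  (lapse M x)⁻¹ * (axialNorm M x)⁻¹ * ‖pd 0 Ψ x‖ ^ 2
    - lapse M x * (axialNorm M x)⁻¹ *
      (∑ i : Fin 3, ∑ j : Fin 3, (metricInv M x i.succ j.succ : ℂ) *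
        ((pd i.succ Ψ x + (axialZ M i.succ x : ℂ) * Ψ x) *
            star (pd j.succ Ψ x + (axialZ M j.succ x : ℂ) * Ψ x)
          + (axialZ M i.succ x : ℂ) * (axialZ M j.succ x : ℂ) * ((‖Ψ x‖ ^ 2 : ℝ) : ℂ))).re

end SchwarzschildEM

end

open SchwarzschildEM

open Filter Topology

namespace SchwarzschildEM

/-! ### Calculus of the coordinate derivatives -/

section Calculus

variable {E : Type*} [NormedAddCommGroup E] [NormedSpace ℝ E]

/-! Everything is reduced to two functions attached to a Hertz potential. Write φ = (r²/√Δ) f, let y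
= √2 r χ and let s be √2 r times ð of f. The weight r²/√Δ is chosen so that y and s are first
derivatives of f with coefficients rational in r, without spin coefficients left over in the radial
direction. In these terms the Teukolsky equation is first order in (y, s): with ∂_in = ∂_t - N² ∂_r
it reads ∂_in y = ∂_θ s - i ∂_ϕ s / sin θ. Since radial and angular derivatives commute, also √2 r ð
y = (r³/(r - 2M)) ∂_t s + r² ∂_r s. The components of the Hertz one-form are multiples of s and y,
and these two identities are exactly the components of self-duality (`IsDebyeOf.duality`). For a
self-dual F the Maxwell equation is the Bianchi identity (`isMaxwell_of_dual`).

Self-duality makes the magnetic and electric energies equal, and the canonical density becomes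
`canonForm`, a sum of squares of ð y, the outgoing derivative of y, and ð s. The density of the
right-hand side is `pasqForm`, which has the ingoing derivative of y where the former has ð s. By
the Teukolsky equation that ingoing derivative is ð' s up to normalization, so the two densities
differ by terms of the type |ð·|² - |ð'·|². Such terms are Jacobians plus a curvature term, hence a
divergence on each sphere r = const (`IsDebye.canonForm_sub_pasqForm`). There is no boundary
contribution: the ϕ-flux is periodic, and the θ-flux vanishes at the poles because y and s have
definite spin weight there. As both densities are non-negative, Tonelli turns equality on spheres
into equality of extended integrals, so finiteness transfers in both directions with no decay
assumption.

The analysis at the poles needs y and s to be smooth there. Smoothness of φ across the axis means φ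
= W(m̄) with W smooth in Cartesian coordinates; the polarization vector of m̄ is smooth in (θ, ϕ)
for all real θ, so f, y and s extend to a chart in which θ is unrestricted
(`IsSmoothSpinNegOne.exists_isDebyeData`).

For a Maxwell field with φ = r² φ̂₂, the field equations say that y and s are the ð'-type and the
ingoing derivative of one scalar, a multiple of r² φ̂₁ (`IsDebyeData.eq_of_maxwell`). The Teukolsky
equation is then the commutation of these derivatives. Pasqualotto's vector has frame component y up
to a factor, because m is parallel along t and r, and his density is again `pasqForm`.

In the axisymmetric case Ψ = i sin θ y. The first Ernst density is twice `canonForm` pointwise,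
since ð s and ð' s coincide. The second is twice `pasqForm` minus a radial derivative of ((r -
2M)/r²)|y|² sin θ. A nonzero limit of that quantity at the horizon or at infinity would make |y|²/r²
non-integrable, contradicting finite energy (`integral_radial_deriv_eq_zero`). -/

theorem pd_congr {f g : Pt → E} {x : Pt} (h : f =ᶠ[𝓝 x] g) (μ : Fin 4) :
    pd μ f x = pd μ g x := by
  simp only [pd, h.fderiv_eq]

theorem pd_add {f g : Pt → E} {x : Pt} (hf : DifferentiableAt ℝ f x)
    (hg : DifferentiableAt ℝ g x) (μ : Fin 4) :
    pd μ (fun y => f y + g y) x = pd μ f x + pd μ g x := by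
  simp [pd, fderiv_fun_add hf hg]

theorem pd_sub {f g : Pt → E} {x : Pt} (hf : DifferentiableAt ℝ f x)
    (hg : DifferentiableAt ℝ g x) (μ : Fin 4) :
    pd μ (fun y => f y - g y) x = pd μ f x - pd μ g x := by
  simp [pd, fderiv_fun_sub hf hg]

theorem pd_neg (f : Pt → E) (x : Pt) (μ : Fin 4) :
    pd μ (fun y => -f y) x = -pd μ f x := by
  simp [pd, fderiv_fun_neg]

theorem pd_const (a : E) (x : Pt) (μ : Fin 4) : pd μ (fun _ => a) x = 0 := by
  simp [pd]

theorem pd_sum {ι : Type*} (s : Finset ι) {f : ι → Pt → E} {x : Pt}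
    (hf : ∀ i ∈ s, DifferentiableAt ℝ (f i) x) (μ : Fin 4) :
    pd μ (fun y => ∑ i ∈ s, f i y) x = ∑ i ∈ s, pd μ (f i) x := by
  simp [pd, fderiv_fun_sum hf]

theorem pd_mul {A : Type*} [NormedCommRing A] [NormedAlgebra ℝ A] {f g : Pt → A} {x : Pt}
    (hf : DifferentiableAt ℝ f x) (hg : DifferentiableAt ℝ g x) (μ : Fin 4) :
    pd μ (fun y => f y * g y) x = pd μ f x * g x + f x * pd μ g x := by
  simp [pd, fderiv_fun_mul hf hg]; ring

theorem pd_clm {F : Type*} [NormedAddCommGroup F] [NormedSpace ℝ F] (L : E →L[ℝ] F) {f : Pt → E}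
    {x : Pt} (hf : DifferentiableAt ℝ f x) (μ : Fin 4) :
    pd μ (fun y => L (f y)) x = L (pd μ f x) := by
  have h : HasFDerivAt (fun y => L (f y)) (L.comp (fderiv ℝ f x)) x :=
    L.hasFDerivAt.comp x hf.hasFDerivAt
  simp [pd, h.fderiv]

theorem pd_ofReal {f : Pt → ℝ} {x : Pt} (hf : DifferentiableAt ℝ f x) (μ : Fin 4) :
    pd μ (fun y => (f y : ℂ)) x = ((pd μ f x : ℝ) : ℂ) := pd_clm Complex.ofRealCLM hf μ

theorem pd_re {f : Pt → ℂ} {x : Pt} (hf : DifferentiableAt ℝ f x) (μ : Fin 4) :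
    pd μ (fun y => (f y).re) x = (pd μ f x).re := pd_clm Complex.reCLM hf μ

theorem pd_im {f : Pt → ℂ} {x : Pt} (hf : DifferentiableAt ℝ f x) (μ : Fin 4) :
    pd μ (fun y => (f y).im) x = (pd μ f x).im := pd_clm Complex.imCLM hf μ

theorem pd_star {f : Pt → ℂ} {x : Pt} (hf : DifferentiableAt ℝ f x) (μ : Fin 4) :
    pd μ (fun y => star (f y)) x = star (pd μ f x) :=
  pd_clm (Complex.conjCLE : ℂ →L[ℝ] ℂ) hf μ

theorem pd_const_mul (a : ℂ) {f : Pt → ℂ} {x : Pt} (hf : DifferentiableAt ℝ f x) (μ : Fin 4) :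
    pd μ (fun y => a * f y) x = a * pd μ f x := by
  rw [pd_mul (by fun_prop) hf, pd_const]; ring

theorem pd_coord {c : ℝ → E} {c' : E} {x : Pt} {ν : Fin 4} (hc : HasDerivAt c c' (x ν))
    (μ : Fin 4) : pd μ (fun y => c (y ν)) x = if μ = ν then c' else 0 := by
  have h : HasFDerivAt (fun y : Pt => c (y ν))
      ((ContinuousLinearMap.toSpanSingleton ℝ c').comp
        (ContinuousLinearMap.proj (R := ℝ) (φ := fun _ : Fin 4 => ℝ) ν)) x :=
    HasFDerivAt.comp x (hasFDerivAt_iff_hasDerivAt.2 (by simpa using hc) :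
      HasFDerivAt c (ContinuousLinearMap.toSpanSingleton ℝ c') (x ν)) (hasFDerivAt_apply ν x)
  simp only [pd, h.fderiv]
  by_cases hμ : μ = ν
  · subst hμ; simp
  · simp [hμ, Ne.symm hμ]

theorem differentiableAt_coord {c : ℝ → E} {x : Pt} {ν : Fin 4}
    (hc : DifferentiableAt ℝ c (x ν)) : DifferentiableAt ℝ (fun y : Pt => c (y ν)) x :=
  DifferentiableAt.comp (f := fun y : Pt => y ν) x hc (by fun_prop)

/-- The product rule with a real factor depending on one coordinate. -/
theorem pd_coord_mul {c : ℝ → ℝ} {c' : ℝ} {x : Pt} {ν : Fin 4} (hc : HasDerivAt c c' (x ν))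
    {f : Pt → ℂ} (hf : DifferentiableAt ℝ f x) (μ : Fin 4) :
    pd μ (fun y => (c (y ν) : ℂ) * f y) x =
      (if μ = ν then (c' : ℂ) * f x else 0) + (c (x ν) : ℂ) * pd μ f x := by
  have hd := differentiableAt_coord (x := x) hc.differentiableAt
  have hd' : DifferentiableAt ℝ (fun y : Pt => (c (y ν) : ℂ)) x :=
    Complex.ofRealCLM.differentiableAt.comp x hd
  rw [pd_mul hd' hf, pd_ofReal hd, pd_coord hc]
  split_ifs <;> simp

theorem pd_coord_mul_of_ne {c : ℝ → ℝ} {x : Pt} {ν : Fin 4} (hc : DifferentiableAt ℝ c (x ν))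
    {f : Pt → ℂ} (hf : DifferentiableAt ℝ f x) {μ : Fin 4} (h : μ ≠ ν) :
    pd μ (fun y => (c (y ν) : ℂ) * f y) x = (c (x ν) : ℂ) * pd μ f x := by
  rw [pd_coord_mul hc.hasDerivAt hf, if_neg h, zero_add]

theorem contDiffAt_pd {f : Pt → E} {x : Pt} (hf : ContDiffAt ℝ ∞ f x) (μ : Fin 4) :
    ContDiffAt ℝ ∞ (pd μ f) x :=
  (hf.fderiv_right (m := ∞) (by simp)).clm_apply contDiffAt_const

theorem _root_.ContDiffAt.diffAt {F : Type*} [NormedAddCommGroup F] [NormedSpace ℝ F] {f : F → E}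
    {x : F} (hf : ContDiffAt ℝ ∞ f x) :
    DifferentiableAt ℝ f x := hf.differentiableAt (by simp)

/-- Symmetry of second derivatives is the only second-order input: it gives the Bianchi identity,
the relation between the divergences of `y` and `f`, and the Teukolsky equation for Maxwell fields.
-/
theorem pd_comm {f : Pt → E} {x : Pt} (hf : ContDiffAt ℝ ∞ f x) (μ ν : Fin 4) :
    pd μ (pd ν f) x = pd ν (pd μ f) x := by
  have hd : DifferentiableAt ℝ (fderiv ℝ f) x :=
    (hf.fderiv_right (m := ∞) (by simp)).differentiableAt (by simp)
  have key : ∀ a b : Fin 4, pd a (pd b f) x =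
      fderiv ℝ (fderiv ℝ f) x (Pi.single a 1) (Pi.single b 1) := by
    intro a b
    have h : HasFDerivAt (pd b f) ((fderiv ℝ (fderiv ℝ f) x).flip (Pi.single b 1)) x := by
      have := hd.hasFDerivAt.clm_apply (hasFDerivAt_const (Pi.single b (1 : ℝ)) x)
      refine (this.congr_fderiv ?_ : _)
      ext; simp
    rw [pd, h.fderiv]; rfl
  rw [key, key]
  exact (hf.isSymmSndFDerivAt (by simpa using ENat.LEInfty.out)) _ _

theorem pd_add_period {f : Pt → E} {c : Pt} (h : ∀ x, f (x + c) = f x) (μ : Fin 4) (x : Pt) :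
    pd μ f (x + c) = pd μ f x := by
  have : (fun y => f (y + c)) = f := funext h
  simp only [pd]
  rw [← fderiv_comp_add_right, this]

/-- The coordinate derivative is the derivative along the coordinate line. -/
theorem hasDerivAt_line {f : Pt → E} {x : Pt} (hf : DifferentiableAt ℝ f x) (μ : Fin 4) :
    HasDerivAt (fun τ : ℝ => f (x + Pi.single μ τ)) (pd μ f x) 0 := by
  have h1 : HasDerivAt (fun τ : ℝ => x + (Pi.single μ τ : Pt)) (Pi.single μ 1) 0 := by
    have : HasDerivAt (fun τ : ℝ => (Pi.single μ τ : Pt)) (Pi.single μ 1) 0 := by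
      rw [hasDerivAt_pi]
      intro i
      by_cases hi : i = μ
      · subst hi; simpa using hasDerivAt_id' (0 : ℝ)
      · simpa [Pi.single_apply, hi] using hasDerivAt_const (0 : ℝ) (0 : ℝ)
    simpa using this.const_add x
  have h2 : HasFDerivAt f (fderiv ℝ f x) (x + (Pi.single μ (0 : ℝ) : Pt)) := by
    simpa using hf.hasFDerivAt
  exact h2.comp_hasDerivAt 0 h1

theorem pd_comp {F : Pt → E} {κ : Pt → Pt} {x : Pt} (hF : DifferentiableAt ℝ F (κ x))
    (hκ : ∀ ν, DifferentiableAt ℝ (fun y => κ y ν) x) (μ : Fin 4) :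
    pd μ (fun y => F (κ y)) x = ∑ ν, pd μ (fun y => κ y ν) x • pd ν F (κ x) := by
  have h1 : HasFDerivAt κ (fderiv ℝ κ x) x := (differentiableAt_pi.2 hκ).hasFDerivAt
  have h2 := hF.hasFDerivAt.comp x h1
  have h3 : pd μ (fun y => F (κ y)) x = fderiv ℝ F (κ x) (fderiv ℝ κ x (Pi.single μ 1)) := by
    simp only [pd]; rw [show (fun y => F (κ y)) = F ∘ κ from rfl, h2.fderiv]; rfl
  have h4 : ∀ ν, fderiv ℝ κ x (Pi.single μ 1) ν = pd μ (fun y => κ y ν) x := by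
    intro ν
    have := (hasFDerivAt_apply ν (κ x)).comp x h1
    simp only [pd]; rw [show (fun y => κ y ν) = (fun f : Pt => f ν) ∘ κ from rfl, this.fderiv]; rfl
  rw [h3, show fderiv ℝ κ x (Pi.single μ 1)
    = ∑ ν, pd μ (fun y => κ y ν) x • (Pi.single ν (1 : ℝ) : Pt) from ?_]
  · simp [map_sum, pd]
  · ext i
    simp [h4, Pi.single_apply]

end Calculus

end SchwarzschildEM

namespace SchwarzschildEM

/-! ### The extended chart, in which `θ` is unrestricted -/

/-- The extension of the exterior chart to all values of `θ`. -/
def extChart (M : ℝ) : Set Pt := {x | 2 * M < x 1}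

theorem isOpen_extChart (M : ℝ) : IsOpen (extChart M) :=
  isOpen_lt continuous_const (continuous_apply 1)

theorem isOpen_exterior (M : ℝ) : IsOpen (exterior M) :=
  (isOpen_lt continuous_const (continuous_apply 1)).inter
    ((isOpen_lt continuous_const (continuous_apply 2)).inter
      (isOpen_lt (continuous_apply 2) continuous_const))

theorem exterior_subset (M : ℝ) : exterior M ⊆ extChart M := fun _ hx => hx.1

theorem eventuallyEq_of_exterior {α : Type*} {M : ℝ} {f g : Pt → α}
    (h : ∀ x ∈ exterior M, f x = g x) {x : Pt} (hx : x ∈ exterior M) : f =ᶠ[𝓝 x] g := by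
  filter_upwards [(isOpen_exterior M).mem_nhds hx] with y hy using h y hy

theorem pd_congr_exterior {E : Type*} [NormedAddCommGroup E] [NormedSpace ℝ E] {M : ℝ}
    {f g : Pt → E} (h : ∀ x ∈ exterior M, f x = g x) {x : Pt} (hx : x ∈ exterior M) (μ : Fin 4) :
    pd μ f x = pd μ g x := pd_congr (eventuallyEq_of_exterior h hx) μ

theorem sin_pos_of_mem {M : ℝ} {x : Pt} (hx : x ∈ exterior M) : 0 < Real.sin (x 2) :=
  Real.sin_pos_of_pos_of_lt_pi hx.2.1 hx.2.2

theorem r_pos {M : ℝ} (hM : 0 < M) {x : Pt} (hx : x ∈ extChart M) : 0 < x 1 := by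
  have : 2 * M < x 1 := hx
  linarith

theorem Delta_pos {M : ℝ} (hM : 0 < M) {x : Pt} (hx : x ∈ extChart M) : 0 < Delta M x :=
  mul_pos (r_pos hM hx) (sub_pos.2 hx)

/-- The target of the Cartesian chart. -/
def cartRange (M : ℝ) : Set Pt := {y | 2 * M < √(y 1 ^ 2 + y 2 ^ 2 + y 3 ^ 2)}

theorem isOpen_cartRange (M : ℝ) : IsOpen (cartRange M) :=
  isOpen_lt continuous_const (by fun_prop)

theorem sqrt_cart {x : Pt} (hx : 0 ≤ x 1) :
    √(cart x 1 ^ 2 + cart x 2 ^ 2 + cart x 3 ^ 2) = x 1 := by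
  rw [← Real.sqrt_sq hx]
  congr 1
  simp only [cart, Matrix.cons_val]
  linear_combination (x 1 ^ 2) * Real.sin_sq_add_cos_sq (x 2)
    + x 1 ^ 2 * Real.sin (x 2) ^ 2 * Real.sin_sq_add_cos_sq (x 3)

theorem cart_mem {M : ℝ} (hM : 0 < M) {x : Pt} (hx : x ∈ extChart M) : cart x ∈ cartRange M := by
  change 2 * M < _
  rw [sqrt_cart (r_pos hM hx).le]; exact hx

/-- The unit radial vector. -/
noncomputable def radVec (x : Pt) : Fin 4 → ℝ :=
  ![0, Real.sin (x 2) * Real.cos (x 3), Real.sin (x 2) * Real.sin (x 3), Real.cos (x 2)]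

/-- The polarization vector `∂_θ n - i ∂_ϕ n / sin θ` of the unit sphere. -/
noncomputable def polVec (x : Pt) : Fin 4 → ℂ :=
  ![0, Real.cos (x 2) * Real.cos (x 3) + Complex.I * Real.sin (x 3),
    Real.cos (x 2) * Real.sin (x 3) - Complex.I * Real.cos (x 3), -Real.sin (x 2)]

theorem contDiff_cart (ν : Fin 4) : ContDiff ℝ ∞ (fun x => cart x ν) := by
  fin_cases ν <;> simp only [cart, Fin.reduceFinMk, Matrix.cons_val] <;> fun_prop

theorem contDiff_cart' : ContDiff ℝ ∞ cart := contDiff_pi.2 contDiff_cart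

theorem contDiff_radVec (ν : Fin 4) : ContDiff ℝ ∞ (fun x => radVec x ν) := by
  fin_cases ν <;> simp only [radVec, Fin.reduceFinMk, Matrix.cons_val] <;> fun_prop

theorem contDiff_coord_ofReal {c : ℝ → ℝ} (hc : ContDiff ℝ ∞ c) (ν : Fin 4) :
    ContDiff ℝ ∞ (fun x : Pt => (c (x ν) : ℂ)) :=
  Complex.ofRealCLM.contDiff.comp (hc.comp (contDiff_apply ℝ ℝ ν))

theorem contDiff_polVec (ν : Fin 4) : ContDiff ℝ ∞ (fun x => polVec x ν) := by
  have h1 := contDiff_coord_ofReal Real.contDiff_sin 2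
  have h2 := contDiff_coord_ofReal Real.contDiff_cos 2
  have h3 := contDiff_coord_ofReal Real.contDiff_sin 3
  have h4 := contDiff_coord_ofReal Real.contDiff_cos 3
  fin_cases ν <;> simp only [polVec, Fin.reduceFinMk, Matrix.cons_val] <;> fun_prop

theorem contDiff_star_polVec (ν : Fin 4) : ContDiff ℝ ∞ (fun x => star (polVec x ν)) :=
  (Complex.conjCLE : ℂ →L[ℝ] ℂ).contDiff.comp (contDiff_polVec ν)

theorem pd_cast_coord {c : ℝ → ℝ} {c' : ℝ} {x : Pt} {ν : Fin 4} (hc : HasDerivAt c c' (x ν))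
    (μ : Fin 4) : pd μ (fun y => (c (y ν) : ℂ)) x = if μ = ν then (c' : ℂ) else 0 :=
  pd_coord hc.ofReal_comp μ

theorem diff_cast_coord {c : ℝ → ℝ} {x : Pt} {ν : Fin 4} (hc : DifferentiableAt ℝ c (x ν)) :
    DifferentiableAt ℝ (fun y : Pt => (c (y ν) : ℂ)) x :=
  Complex.ofRealCLM.differentiableAt.comp x (differentiableAt_coord hc)

/-- No sine is divided by in this derivative or in the ϕ-derivative below, so both structure
equations of the frame remain valid at the poles. -/
theorem pd_two_polVec (ν : Fin 4) (x : Pt) : pd 2 (fun y => polVec y ν) x = -(radVec x ν : ℂ) := by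
  have hs2 := diff_cast_coord (x := x) (ν := 2) Real.differentiable_sin.differentiableAt
  have hc2 := diff_cast_coord (x := x) (ν := 2) Real.differentiable_cos.differentiableAt
  have hs3 := diff_cast_coord (x := x) (ν := 3) Real.differentiable_sin.differentiableAt
  have hc3 := diff_cast_coord (x := x) (ν := 3) Real.differentiable_cos.differentiableAt
  have ps2 := pd_cast_coord (x := x) (ν := 2) (Real.hasDerivAt_sin _) 2
  have pc2 := pd_cast_coord (x := x) (ν := 2) (Real.hasDerivAt_cos _) 2
  have ps3 := pd_cast_coord (x := x) (ν := 3) (Real.hasDerivAt_sin _) 2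
  have pc3 := pd_cast_coord (x := x) (ν := 3) (Real.hasDerivAt_cos _) 2
  fin_cases ν <;> simp only [polVec, radVec, Fin.reduceFinMk, Fin.zero_eta, Matrix.cons_val]
  · simp [pd_const]
  · rw [pd_add (by fun_prop) (by fun_prop), pd_mul hc2 hc3, pd_const_mul _ hs3, pc2, pc3, ps3]
    simp
  · rw [pd_sub (by fun_prop) (by fun_prop), pd_mul hc2 hs3, pd_const_mul _ hc3, pc2, pc3, ps3]
    simp
  · rw [pd_neg, ps2]; simp

/-- At a pole only the rotation `i cos θ` of the polarization vector survives; this is the phase of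
spin weight -1 used for all boundary conditions there. -/
theorem pd_three_polVec (ν : Fin 4) (x : Pt) : pd 3 (fun y => polVec y ν) x =
    Complex.I * Real.cos (x 2) * polVec x ν + Complex.I * Real.sin (x 2) * radVec x ν := by
  have hs2 := diff_cast_coord (x := x) (ν := 2) Real.differentiable_sin.differentiableAt
  have hc2 := diff_cast_coord (x := x) (ν := 2) Real.differentiable_cos.differentiableAt
  have hs3 := diff_cast_coord (x := x) (ν := 3) Real.differentiable_sin.differentiableAt
  have hc3 := diff_cast_coord (x := x) (ν := 3) Real.differentiable_cos.differentiableAt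
  have ps2 := pd_cast_coord (x := x) (ν := 2) (Real.hasDerivAt_sin _) 3
  have pc2 := pd_cast_coord (x := x) (ν := 2) (Real.hasDerivAt_cos _) 3
  have ps3 := pd_cast_coord (x := x) (ν := 3) (Real.hasDerivAt_sin _) 3
  have pc3 := pd_cast_coord (x := x) (ν := 3) (Real.hasDerivAt_cos _) 3
  have e : (Real.sin (x 2) : ℂ) ^ 2 + (Real.cos (x 2) : ℂ) ^ 2 = 1 := by
    exact_mod_cast Real.sin_sq_add_cos_sq (x 2)
  fin_cases ν <;> simp only [polVec, radVec, Fin.reduceFinMk, Fin.zero_eta, Matrix.cons_val]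
  · simp [pd_const]
  · rw [pd_add (by fun_prop) (by fun_prop), pd_mul hc2 hc3, pd_const_mul _ hs3, pc2, pc3, ps3]
    simp only [reduceIte, Fin.reduceEq]
    push_cast at e ⊢
    linear_combination (-Complex.I * Complex.cos (x 3)) * e
      - Complex.cos (x 2) * Complex.sin (x 3) * Complex.I_sq
  · rw [pd_sub (by fun_prop) (by fun_prop), pd_mul hc2 hs3, pd_const_mul _ hc3, pc2, pc3, ps3]
    simp only [reduceIte, Fin.reduceEq]
    push_cast at e ⊢
    linear_combination (-Complex.I * Complex.sin (x 3)) * e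
      + Complex.cos (x 2) * Complex.cos (x 3) * Complex.I_sq
  · rw [pd_neg, ps2]
    simp only [reduceIte, Fin.reduceEq]
    push_cast
    ring

/-- With e the polarization vector, (e + ē)/2 is the unit tangent along θ, and i(e - ē)/2 the one
along ϕ in the next lemma. -/
theorem pd_two_cart (ν : Fin 4) (x : Pt) :
    ((pd 2 (fun y => cart y ν) x : ℝ) : ℂ) = x 1 * (polVec x ν + star (polVec x ν)) / 2 := by
  have hr : DifferentiableAt ℝ (fun y : Pt => y 1) x := by fun_prop
  have hs2 := differentiableAt_coord (x := x) (ν := 2) Real.differentiable_sin.differentiableAt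
  have hs3 := differentiableAt_coord (x := x) (ν := 3) Real.differentiable_sin.differentiableAt
  have hc3 := differentiableAt_coord (x := x) (ν := 3) Real.differentiable_cos.differentiableAt
  have hc2 := differentiableAt_coord (x := x) (ν := 2) Real.differentiable_cos.differentiableAt
  have pr := pd_coord (x := x) (ν := 1) (hasDerivAt_id' _) 2
  have pt := pd_coord (x := x) (ν := 0) (hasDerivAt_id' _) 2
  have ps2 := pd_coord (x := x) (ν := 2) (Real.hasDerivAt_sin _) 2
  have pc2 := pd_coord (x := x) (ν := 2) (Real.hasDerivAt_cos _) 2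
  have ps3 := pd_coord (x := x) (ν := 3) (Real.hasDerivAt_sin _) 2
  have pc3 := pd_coord (x := x) (ν := 3) (Real.hasDerivAt_cos _) 2
  fin_cases ν <;> simp only [cart, polVec, Fin.reduceFinMk, Fin.zero_eta, Matrix.cons_val]
  · rw [pt]; simp
  · rw [pd_mul (hr.fun_mul hs2) hc3, pd_mul hr hs2, pr, ps2, pc3]
    simp [-Complex.ofReal_cos, -Complex.ofReal_sin]
    ring
  · rw [pd_mul (hr.fun_mul hs2) hs3, pd_mul hr hs2, pr, ps2, ps3]
    simp [-Complex.ofReal_cos, -Complex.ofReal_sin]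
    ring
  · rw [pd_mul hr hc2, pr, pc2]
    simp [-Complex.ofReal_cos, -Complex.ofReal_sin]
    ring

theorem pd_three_cart (ν : Fin 4) (x : Pt) : ((pd 3 (fun y => cart y ν) x : ℝ) : ℂ) =
    x 1 * Real.sin (x 2) * (Complex.I * (polVec x ν - star (polVec x ν)) / 2) := by
  have hr : DifferentiableAt ℝ (fun y : Pt => y 1) x := by fun_prop
  have hs2 := differentiableAt_coord (x := x) (ν := 2) Real.differentiable_sin.differentiableAt
  have hs3 := differentiableAt_coord (x := x) (ν := 3) Real.differentiable_sin.differentiableAt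
  have hc3 := differentiableAt_coord (x := x) (ν := 3) Real.differentiable_cos.differentiableAt
  have hc2 := differentiableAt_coord (x := x) (ν := 2) Real.differentiable_cos.differentiableAt
  have pr := pd_coord (x := x) (ν := 1) (hasDerivAt_id' _) 3
  have pt := pd_coord (x := x) (ν := 0) (hasDerivAt_id' _) 3
  have ps2 := pd_coord (x := x) (ν := 2) (Real.hasDerivAt_sin _) 3
  have pc2 := pd_coord (x := x) (ν := 2) (Real.hasDerivAt_cos _) 3
  have ps3 := pd_coord (x := x) (ν := 3) (Real.hasDerivAt_sin _) 3
  have pc3 := pd_coord (x := x) (ν := 3) (Real.hasDerivAt_cos _) 3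
  have hI := Complex.I_sq
  fin_cases ν <;> simp only [cart, polVec, Fin.reduceFinMk, Fin.zero_eta, Matrix.cons_val]
  · rw [pt]; simp
  · rw [pd_mul (hr.fun_mul hs2) hc3, pd_mul hr hs2, pr, ps2, pc3]
    simp [-Complex.ofReal_cos, -Complex.ofReal_sin, -mul_eq_mul_left_iff]
    linear_combination (-(x 1 : ℂ) * Real.sin (x 2) * Real.sin (x 3)) * hI
  · rw [pd_mul (hr.fun_mul hs2) hs3, pd_mul hr hs2, pr, ps2, ps3]
    simp [-Complex.ofReal_cos, -Complex.ofReal_sin, -mul_eq_mul_left_iff]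
    linear_combination ((x 1 : ℂ) * Real.sin (x 2) * Real.cos (x 3)) * hI
  · rw [pd_mul hr hc2, pr, pc2]
    simp [-Complex.ofReal_cos, -Complex.ofReal_sin, -mul_eq_mul_left_iff]

end SchwarzschildEM

namespace SchwarzschildEM

/-! ### Smooth fields in the extended chart -/

/-- `f` is smooth on the extended chart. -/
def SmoothExt (M : ℝ) (f : Pt → ℂ) : Prop := ∀ x ∈ extChart M, ContDiffAt ℝ ∞ f x

/-- `f` has period `2π` in `ϕ`. -/
def IsAngular (f : Pt → ℂ) : Prop := ∀ x, f (x + Pi.single 3 (2 * Real.pi)) = f x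

theorem cart_add_period (x : Pt) : cart (x + Pi.single 3 (2 * Real.pi)) = cart x := by
  simp [cart]

theorem radVec_add_period (x : Pt) : radVec (x + Pi.single 3 (2 * Real.pi)) = radVec x := by
  simp [radVec]

theorem polVec_add_period (x : Pt) : polVec (x + Pi.single 3 (2 * Real.pi)) = polVec x := by
  simp [polVec]

theorem ContDiffOn.comp_cart {M : ℝ} (hM : 0 < M) {w : (Fin 4 → ℝ) → ℂ}
    (hw : ContDiffOn ℝ ∞ w (cartRange M)) : SmoothExt M (fun x => w (cart x)) := fun x hx =>
  (hw.contDiffAt ((isOpen_cartRange M).mem_nhds (cart_mem hM hx))).comp x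
    contDiff_cart'.contDiffAt

/-- A smooth function of the radius is smooth on the extended chart. -/
theorem SmoothExt.radial {M : ℝ} {c : ℝ → ℝ} (hc : ∀ r, 2 * M < r → ContDiffAt ℝ ∞ c r) :
    SmoothExt M (fun x => (c (x 1) : ℂ)) := fun x hx =>
  Complex.ofRealCLM.contDiff.contDiffAt.comp x
    ((hc _ hx).comp x (contDiff_apply ℝ ℝ (1 : Fin 4)).contDiffAt)

theorem contDiffAt_sqrt_Delta {M : ℝ} (hM : 0 < M) {r : ℝ} (hr : 2 * M < r) :
    ContDiffAt ℝ ∞ (fun r : ℝ => √(r * (r - 2 * M)) / r ^ 2) r := by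
  have h1 : 0 < r := by linarith
  have h2 : r * (r - 2 * M) ≠ 0 := (mul_pos h1 (by linarith)).ne'
  have h3 : ContDiffAt ℝ ∞ (fun r : ℝ => r * (r - 2 * M)) r := by fun_prop
  have h4 : ContDiffAt ℝ ∞ (fun r : ℝ => r ^ 2) r := by fun_prop
  exact (h3.sqrt h2).div h4 (by positivity)

theorem pd_three_comp_cart {w : (Fin 4 → ℝ) → ℂ} {x : Pt} (hw : DifferentiableAt ℝ w (cart x)) :
    pd 3 (fun y => w (cart y)) x =
      x 1 * Real.sin (x 2) * ∑ k, (Complex.I * (polVec x k - star (polVec x k)) / 2)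
        * pd k w (cart x) := by
  rw [pd_comp hw (fun ν => (contDiff_cart ν).contDiffAt.diffAt), Finset.mul_sum]
  refine Finset.sum_congr rfl fun k _ => ?_
  rw [Complex.real_smul, pd_three_cart]; ring

theorem pd_two_comp_cart {w : (Fin 4 → ℝ) → ℂ} {x : Pt} (hw : DifferentiableAt ℝ w (cart x)) :
    pd 2 (fun y => w (cart y)) x =
      x 1 * ∑ k, ((polVec x k + star (polVec x k)) / 2) * pd k w (cart x) := by
  rw [pd_comp hw (fun ν => (contDiff_cart ν).contDiffAt.diffAt), Finset.mul_sum]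
  refine Finset.sum_congr rfl fun k _ => ?_
  rw [Complex.real_smul, pd_two_cart]; ring

/-- The spin-weighted function `∑ w_ν e_ν` of a Cartesian field `w`. -/
noncomputable def spinField (w : Fin 4 → (Fin 4 → ℝ) → ℂ) (x : Pt) : ℂ :=
  ∑ ν, w ν (cart x) * polVec x ν

/-- The spin-weighted divergence of `spinField w` on the unit sphere, in Cartesian form. -/
noncomputable def spinDiv (w : Fin 4 → (Fin 4 → ℝ) → ℂ) (x : Pt) : ℂ :=
  ∑ ν, (∑ k, (x 1 : ℂ) * pd k (w ν) (cart x) * (star (polVec x k) * polVec x ν)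
    - 2 * (w ν (cart x) * radVec x ν))

section SpinField

variable {M : ℝ} {w : Fin 4 → (Fin 4 → ℝ) → ℂ}

theorem smoothExt_spinField (hM : 0 < M) (hw : ∀ ν, ContDiffOn ℝ ∞ (w ν) (cartRange M)) :
    SmoothExt M (spinField w) := fun x hx =>
  ContDiffAt.sum fun ν _ => (ContDiffOn.comp_cart hM (hw ν) x hx).mul (contDiff_polVec ν).contDiffAt

theorem contDiffOn_pd_cart (hw : ∀ ν, ContDiffOn ℝ ∞ (w ν) (cartRange M)) (k ν : Fin 4) :
    ContDiffOn ℝ ∞ (pd k (w ν)) (cartRange M) := fun _ hy =>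
  (contDiffAt_pd ((hw ν).contDiffAt ((isOpen_cartRange M).mem_nhds hy)) k).contDiffWithinAt

theorem contDiffAt_radVec (ν : Fin 4) (x : Pt) :
    ContDiffAt ℝ ∞ (fun y => (radVec y ν : ℂ)) x :=
  Complex.ofRealCLM.contDiff.contDiffAt.comp x (contDiff_radVec ν).contDiffAt

theorem contDiffAt_coord_cast (ν : Fin 4) (x : Pt) :
    ContDiffAt ℝ ∞ (fun y : Pt => (y ν : ℂ)) x :=
  (contDiff_coord_ofReal contDiff_id ν).contDiffAt

theorem smoothExt_spinDiv (hM : 0 < M) (hw : ∀ ν, ContDiffOn ℝ ∞ (w ν) (cartRange M)) :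
    SmoothExt M (spinDiv w) := fun x hx => by
  refine ContDiffAt.sum fun ν _ => ContDiffAt.sub (ContDiffAt.sum fun k _ => ?_) ?_
  · exact ((contDiffAt_coord_cast 1 x).mul
      (ContDiffOn.comp_cart hM (contDiffOn_pd_cart hw k ν) x hx)).mul
      ((contDiff_star_polVec k).contDiffAt.mul (contDiff_polVec ν).contDiffAt)
  · exact contDiffAt_const.mul ((ContDiffOn.comp_cart hM (hw ν) x hx).mul (contDiffAt_radVec ν x))

theorem isAngular_spinField : IsAngular (spinField w) := fun x => by
  simp only [spinField, cart_add_period, polVec_add_period]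

theorem isAngular_spinDiv : IsAngular (spinDiv w) := fun x => by
  simp only [spinDiv, cart_add_period, polVec_add_period, radVec_add_period]
  simp

theorem pd_spinField (hM : 0 < M) (hw : ∀ ν, ContDiffOn ℝ ∞ (w ν) (cartRange M)) {x : Pt}
    (hx : x ∈ extChart M) (μ : Fin 4) : pd μ (spinField w) x =
      ∑ ν, (pd μ (fun y => w ν (cart y)) x * polVec x ν
        + w ν (cart x) * pd μ (fun y => polVec y ν) x) := by
  have h1 : ∀ ν, DifferentiableAt ℝ (fun y => w ν (cart y)) x :=
    fun ν => (ContDiffOn.comp_cart hM (hw ν) x hx).diffAt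
  have h2 : ∀ ν, DifferentiableAt ℝ (fun y => polVec y ν) x :=
    fun ν => (contDiff_polVec ν).contDiffAt.diffAt
  have := pd_sum Finset.univ (f := fun ν y => w ν (cart y) * polVec y ν) (x := x)
    (fun ν _ => (h1 ν).mul (h2 ν)) μ
  exact this.trans (Finset.sum_congr rfl fun ν _ => pd_mul (h1 ν) (h2 ν) μ)

theorem diffAt_cart_field (hM : 0 < M) (hw : ∀ ν, ContDiffOn ℝ ∞ (w ν) (cartRange M)) {x : Pt}
    (hx : x ∈ extChart M) (ν : Fin 4) : DifferentiableAt ℝ (w ν) (cart x) :=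
  ((hw ν).contDiffAt ((isOpen_cartRange M).mem_nhds (cart_mem hM hx))).diffAt

/-- The polarization vector contributes `-cos θ` through its ϕ-derivative, which cancels the
explicit `cos θ` term. What remains is divisible by `sin θ`, so ð of a smooth spin-weighted field
extends smoothly over the poles. -/
theorem sin_mul_spinDiv (hM : 0 < M) (hw : ∀ ν, ContDiffOn ℝ ∞ (w ν) (cartRange M)) {x : Pt}
    (hx : x ∈ extChart M) : Real.sin (x 2) * spinDiv w x =
      Real.sin (x 2) * pd 2 (spinField w) x + Complex.I * pd 3 (spinField w) x
        + Real.cos (x 2) * spinField w x := by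
  rw [pd_spinField hM hw hx, pd_spinField hM hw hx, spinDiv, spinField, Finset.mul_sum,
    Finset.mul_sum, Finset.mul_sum, Finset.mul_sum, ← Finset.sum_add_distrib,
    ← Finset.sum_add_distrib]
  refine Finset.sum_congr rfl fun ν _ => ?_
  have hd := diffAt_cart_field hM hw hx ν
  rw [pd_two_comp_cart hd, pd_three_comp_cart hd, pd_two_polVec, pd_three_polVec]
  simp only [Fin.sum_univ_four]
  linear_combination ((1 / 2) * (x 1 : ℂ) * Real.sin (x 2) * polVec x ν *
    (pd 0 (w ν) (cart x) * (-star (polVec x 0) + polVec x 0)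
    + pd 1 (w ν) (cart x) * (-star (polVec x 1) + polVec x 1)
    + pd 2 (w ν) (cart x) * (-star (polVec x 2) + polVec x 2)
    + pd 3 (w ν) (cart x) * (-star (polVec x 3) + polVec x 3))
    + w ν (cart x) * (Real.cos (x 2) * polVec x ν + Real.sin (x 2) * radVec x ν)) *
      (-Complex.I_sq)

/-- At a pole the Cartesian point does not move with ϕ; only the polarization vector rotates. -/
theorem pd_three_spinField_pole (hM : 0 < M) (hw : ∀ ν, ContDiffOn ℝ ∞ (w ν) (cartRange M))
    {x : Pt} (hx : x ∈ extChart M) (hs : Real.sin (x 2) = 0) :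
    pd 3 (spinField w) x = Complex.I * Real.cos (x 2) * spinField w x := by
  rw [pd_spinField hM hw hx, spinField, Finset.mul_sum]
  refine Finset.sum_congr rfl fun ν _ => ?_
  rw [pd_three_comp_cart (diffAt_cart_field hM hw hx ν), pd_three_polVec, hs]
  push_cast; ring

/-- Spin weight 0: every factor of `spinDiv` is stationary in ϕ at a pole, so the product rule
yields zero. -/
theorem pd_three_spinDiv_pole (hM : 0 < M) (hw : ∀ ν, ContDiffOn ℝ ∞ (w ν) (cartRange M))
    {x : Pt} (hx : x ∈ extChart M) (hs : Real.sin (x 2) = 0) : pd 3 (spinDiv w) x = 0 := by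
  have hmul : ∀ {a b : Pt → ℂ}, DifferentiableAt ℝ a x ∧ pd 3 a x = 0 →
      DifferentiableAt ℝ b x ∧ pd 3 b x = 0 →
      DifferentiableAt ℝ (fun y => a y * b y) x ∧ pd 3 (fun y => a y * b y) x = 0 := by
    rintro a b ⟨ha, ha'⟩ ⟨hb, hb'⟩
    exact ⟨ha.fun_mul hb, by rw [pd_mul ha hb, ha', hb']; ring⟩
  have hcart : ∀ {v : (Fin 4 → ℝ) → ℂ}, ContDiffOn ℝ ∞ v (cartRange M) →
      DifferentiableAt ℝ (fun y => v (cart y)) x ∧ pd 3 (fun y => v (cart y)) x = 0 := by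
    intro v hv
    refine ⟨(ContDiffOn.comp_cart hM hv x hx).diffAt, ?_⟩
    rw [pd_three_comp_cart (diffAt_cart_field (w := fun _ => v) hM (fun _ => hv) hx 0), hs]
    simp
  have hr : DifferentiableAt ℝ (fun y : Pt => (y 1 : ℂ)) x ∧ pd 3 (fun y => (y 1 : ℂ)) x = 0 :=
    ⟨(contDiffAt_coord_cast 1 x).diffAt, by
      rw [pd_cast_coord (c := fun r => r) (hasDerivAt_id' _)]; simp⟩
  have hrad : ∀ ν, DifferentiableAt ℝ (fun y => (radVec y ν : ℂ)) x ∧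
      pd 3 (fun y => (radVec y ν : ℂ)) x = 0 := by
    intro ν
    refine ⟨(contDiffAt_radVec ν x).diffAt, ?_⟩
    -- The radial vector is minus the θ-derivative of the polarization vector, so its ϕ-derivative
    -- follows by commuting partial derivatives.
    have h1 := pd_two_polVec ν
    have h2 : (fun y => (radVec y ν : ℂ)) = fun y => -pd 2 (fun z => polVec z ν) y := by
      funext y; rw [h1]; ring
    have h3 : pd 3 (fun z => polVec z ν) = fun y =>
      Complex.I * (Real.cos (y 2) * polVec y ν + Real.sin (y 2) * radVec y ν) := by
      funext y; rw [pd_three_polVec]; ring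
    rw [h2, pd_neg, pd_comm (contDiff_polVec ν).contDiffAt, h3]
    have d1 := (contDiff_polVec ν).contDiffAt (x := x) |>.diffAt
    have d2 := (contDiffAt_radVec ν x).diffAt
    have d3 := diff_cast_coord (x := x) (ν := 2) Real.differentiable_sin.differentiableAt
    have d4 := diff_cast_coord (x := x) (ν := 2) Real.differentiable_cos.differentiableAt
    rw [pd_const_mul _ ((d4.fun_mul d1).fun_add (d3.fun_mul d2)),
      pd_add (d4.fun_mul d1) (d3.fun_mul d2), pd_coord_mul (Real.hasDerivAt_cos _) d1,
      pd_coord_mul (Real.hasDerivAt_sin _) d2, pd_two_polVec, hs]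
    simp
  -- The phases `-i cos θ` of the conjugate factor and `i cos θ` of the other cancel.
  have hpol : ∀ k ν, DifferentiableAt ℝ (fun y => star (polVec y k) * polVec y ν) x ∧
      pd 3 (fun y => star (polVec y k) * polVec y ν) x = 0 := by
    intro k ν
    have d1 := (contDiff_polVec ν).contDiffAt (x := x) |>.diffAt
    have d2 := (contDiff_star_polVec k).contDiffAt (x := x) |>.diffAt
    have d3 := (contDiff_polVec k).contDiffAt (x := x) |>.diffAt
    refine ⟨d2.fun_mul d1, ?_⟩
    rw [pd_mul d2 d1, pd_star d3, pd_three_polVec, pd_three_polVec, hs]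
    simp [-Complex.ofReal_cos]
    ring
  have hterm1 : ∀ ν k, DifferentiableAt ℝ (fun y => (y 1 : ℂ) * pd k (w ν) (cart y) *
      (star (polVec y k) * polVec y ν)) x ∧ pd 3 (fun y => (y 1 : ℂ) * pd k (w ν) (cart y) *
      (star (polVec y k) * polVec y ν)) x = 0 := fun ν k =>
    hmul (hmul hr (hcart (contDiffOn_pd_cart hw k ν))) (hpol k ν)
  have hterm2 : ∀ ν, DifferentiableAt ℝ (fun y => w ν (cart y) * (radVec y ν : ℂ)) x ∧
      pd 3 (fun y => w ν (cart y) * (radVec y ν : ℂ)) x = 0 := fun ν =>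
    hmul (hcart (hw ν)) (hrad ν)
  have e : spinDiv w = fun x => ∑ ν, (∑ k, (x 1 : ℂ) * pd k (w ν) (cart x) *
    (star (polVec x k) * polVec x ν) - 2 * (w ν (cart x) * radVec x ν)) := rfl
  have dsum : ∀ ν, DifferentiableAt ℝ (fun y => ∑ k, (y 1 : ℂ) * pd k (w ν) (cart y) *
      (star (polVec y k) * polVec y ν)) x := fun ν =>
    DifferentiableAt.fun_sum fun k _ => (hterm1 ν k).1
  rw [e, pd_sum _ (fun ν _ => (dsum ν).fun_sub ((hterm2 ν).1.const_mul 2))]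
  refine Finset.sum_eq_zero fun ν _ => ?_
  rw [pd_sub (dsum ν) ((hterm2 ν).1.const_mul 2), pd_sum _ (fun k _ => (hterm1 ν k).1),
    pd_const_mul _ (hterm2 ν).1, (hterm2 ν).2,
    Finset.sum_eq_zero (fun k _ => (hterm1 ν k).2)]
  simp

end SpinField

end SchwarzschildEM

namespace SchwarzschildEM

/-! ### Hertz potentials as Debye potentials

A Hertz potential `φ` is rescaled to `f = (√Δ / r²) φ`; then `y = √2 r χ` and
`s = √2 r (√Δ / r²) ð φ` are first derivatives of `f` with rational coefficients. -/

/-- A rescaled Hertz potential `f`, with its radial derivative `y` along `l` and its spin-weighted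
divergence `s`, as smooth functions in the extended chart. -/
structure IsDebyeData (M : ℝ) (f y s : Pt → ℂ) : Prop where
  smooth_f : SmoothExt M f
  smooth_y : SmoothExt M y
  smooth_s : SmoothExt M s
  y_eq : ∀ x ∈ extChart M, y x = ((x 1 ^ 3 / (x 1 - 2 * M) : ℝ) : ℂ) * pd 0 f x
    + ((x 1 ^ 2 : ℝ) : ℂ) * pd 1 f x
  s_eq : ∀ x ∈ extChart M, Real.sin (x 2) * s x =
    Real.sin (x 2) * pd 2 f x + Complex.I * pd 3 f x + Real.cos (x 2) * f x
  angular_y : IsAngular y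
  angular_s : IsAngular s
  pole_y : ∀ x ∈ extChart M, Real.sin (x 2) = 0 → pd 3 y x = Complex.I * Real.cos (x 2) * y x
  pole_s : ∀ x ∈ extChart M, Real.sin (x 2) = 0 → pd 3 s x = 0

/-- Rescaled data that satisfy the Teukolsky equation. -/
structure IsDebye (M : ℝ) (f y s : Pt → ℂ) : Prop extends IsDebyeData M f y s where
  wave : ∀ x ∈ exterior M,
    Real.sin (x 2) * ((x 1 : ℂ) * pd 0 y x - ((x 1 - 2 * M : ℝ) : ℂ) * pd 1 y x) =
      x 1 * (Real.sin (x 2) * pd 2 s x - Complex.I * pd 3 s x)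

theorem npD_eq (M : ℝ) (ξ : Pt → ℂ) (x : Pt) :
    npD M ξ x = ((x 1 ^ 2 / √(Delta M x) / (√2 * x 1) : ℝ) : ℂ) * pd 0 ξ x
      + ((√(Delta M x) / (√2 * x 1) : ℝ) : ℂ) * pd 1 ξ x := by
  simp [npD, lUp, Fin.sum_univ_four]

theorem npD'_eq (M : ℝ) (ξ : Pt → ℂ) (x : Pt) :
    npD' M ξ x = ((x 1 ^ 2 / √(Delta M x) / (√2 * x 1) : ℝ) : ℂ) * pd 0 ξ x
      - ((√(Delta M x) / (√2 * x 1) : ℝ) : ℂ) * pd 1 ξ x := by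
  simp [npD', nUp, Fin.sum_univ_four]; ring

theorem npDelta_eq (ξ : Pt → ℂ) (x : Pt) :
    npDelta ξ x = ((√2 * x 1 : ℝ) : ℂ)⁻¹ * (pd 2 ξ x
      + Complex.I * (Real.sin (x 2) : ℂ)⁻¹ * pd 3 ξ x) := by
  simp [npDelta, mUp, Fin.sum_univ_four]
  field_simp

theorem npDelta'_eq (ξ : Pt → ℂ) (x : Pt) :
    npDelta' ξ x = ((√2 * x 1 : ℝ) : ℂ)⁻¹ * (pd 2 ξ x
      - Complex.I * (Real.sin (x 2) : ℂ)⁻¹ * pd 3 ξ x) := by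
  simp [npDelta', mUp, Fin.sum_univ_four, -Complex.ofReal_sin]
  field_simp
  ring

theorem hasDerivAt_sqrt_Delta {M : ℝ} (hM : 0 < M) {r : ℝ} (hr : 2 * M < r) :
    HasDerivAt (fun r : ℝ => √(r * (r - 2 * M))) ((r - M) / √(r * (r - 2 * M))) r := by
  have h1 : 0 < r := by linarith
  have h2 : r * (r - 2 * M) ≠ 0 := (mul_pos h1 (by linarith)).ne'
  have h3 : HasDerivAt (fun r : ℝ => r * (r - 2 * M)) (1 * (r - 2 * M) + r * 1) r :=
    (hasDerivAt_id' r).mul ((hasDerivAt_id' r).sub_const _)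
  convert h3.sqrt h2 using 1
  field_simp
  ring

section Rescaled

variable {M : ℝ} {φ f : Pt → ℂ}

/-- `χ` in terms of the rescaled potential. -/
theorem chi_eq_of_rescaled (hM : 0 < M)
    (hφ : ∀ x ∈ exterior M, φ x = ((x 1 ^ 2 / √(Delta M x) : ℝ) : ℂ) * f x)
    (hf : SmoothExt M f) {x : Pt} (hx : x ∈ exterior M) :
    chi M φ x = ((√2 * x 1 : ℝ) : ℂ)⁻¹ * (((x 1 ^ 3 / (x 1 - 2 * M) : ℝ) : ℂ) * pd 0 f x
    + ((x 1 ^ 2 : ℝ) : ℂ) * pd 1 f x) := by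
  have hr : 0 < x 1 := r_pos hM (exterior_subset M hx)
  have hr' : 0 < x 1 - 2 * M := sub_pos.2 hx.1
  have hq : 0 < √(Delta M x) := Real.sqrt_pos.2 (Delta_pos hM (exterior_subset M hx))
  have hq2 : √(Delta M x) ^ 2 = x 1 * (x 1 - 2 * M) :=
    Real.sq_sqrt (Delta_pos hM (exterior_subset M hx)).le
  have h2 : √2 ^ 2 = (2 : ℝ) := by norm_num
  -- On weight (-2, 0), þ + ρ is D + 2ε + ρ, and `r² / √Δ` is annihilated by it: its logarithmic
  -- derivative is (r - 3M)/Δ = 1/r - M/Δ. Hence only derivatives of `f` survive.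
  have hc : HasDerivAt (fun r : ℝ => r ^ 2 / √(r * (r - 2 * M)))
      ((2 * x 1 * √(Delta M x) - x 1 ^ 2 * ((x 1 - M) / √(Delta M x))) / √(Delta M x) ^ 2)
      (x 1) := by
    exact ((hasDerivAt_pow 2 (x 1)).div (hasDerivAt_sqrt_Delta hM hx.1) hq.ne').congr_deriv
      (by simp [Delta])
  have hd := (hf x (exterior_subset M hx)).diffAt
  have hpd : ∀ μ, pd μ φ x = _ := fun μ => (pd_congr_exterior hφ hx μ).trans
    (pd_coord_mul hc hd μ)
  rw [chi, thorn, npD_eq, hpd, hpd, hφ x hx, rho, eps, Real.sqrt_mul (by norm_num : (0:ℝ) ≤ 2)]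
  change _ + _ * ((if (1 : Fin 4) = 1 then _ else _) + ((x 1 ^ 2 / √(Delta M x) : ℝ) : ℂ) * _)
    - _ - _ + _ = _
  change _ * ((if (0 : Fin 4) = 1 then _ else _) + ((x 1 ^ 2 / √(Delta M x) : ℝ) : ℂ) * _) + _
    - _ - _ + _ = _
  simp only [Fin.reduceEq, if_false, if_true]
  generalize √(Delta M x) = q at *
  generalize √2 = a at *
  have ha : a ≠ 0 := by rintro rfl; norm_num at h2
  have e1 : (x 1 : ℂ) ≠ 0 := by exact_mod_cast hr.ne'
  have e2 : ((x 1 : ℂ) - 2 * M) ≠ 0 := by exact_mod_cast hr'.ne'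
  have e3 : (q : ℂ) ≠ 0 := by exact_mod_cast hq.ne'
  have e4 : (a : ℂ) ≠ 0 := by exact_mod_cast ha
  have e5 : (q : ℂ) ^ 2 = x 1 * (x 1 - 2 * M) := by exact_mod_cast hq2
  have e6 : (a : ℂ) ^ 2 = 2 := by exact_mod_cast h2
  push_cast
  field_simp
  simp only [e5]
  ring

/-- `ð φ` in terms of the rescaled potential. -/
theorem eth_eq_of_rescaled (hM : 0 < M)
    (hφ : ∀ x ∈ exterior M, φ x = ((x 1 ^ 2 / √(Delta M x) : ℝ) : ℂ) * f x)
    (hf : SmoothExt M f) {s : Pt → ℂ}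
    (hs : ∀ x ∈ extChart M, Real.sin (x 2) * s x =
      Real.sin (x 2) * pd 2 f x + Complex.I * pd 3 f x + Real.cos (x 2) * f x)
    {x : Pt} (hx : x ∈ exterior M) :
    eth (-2) 0 φ x = ((x 1 / (√2 * √(Delta M x)) : ℝ) : ℂ) * s x := by
  have hr : 0 < x 1 := r_pos hM (exterior_subset M hx)
  have hq : 0 < √(Delta M x) := Real.sqrt_pos.2 (Delta_pos hM (exterior_subset M hx))
  have hc : DifferentiableAt ℝ (fun r : ℝ => r ^ 2 / √(r * (r - 2 * M))) (x 1) :=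
    ((hasDerivAt_pow 2 (x 1)).div (hasDerivAt_sqrt_Delta hM hx.1) hq.ne').differentiableAt
  have hd := (hf x (exterior_subset M hx)).diffAt
  have hpd : ∀ μ ≠ 1, pd μ φ x = ((x 1 ^ 2 / √(Delta M x) : ℝ) : ℂ) * pd μ f x := fun μ hμ =>
    (pd_congr_exterior hφ hx μ).trans (pd_coord_mul_of_ne hc hd hμ)
  have hs' := hs x (exterior_subset M hx)
  have hsin : (Real.sin (x 2) : ℂ) ≠ 0 := by exact_mod_cast (sin_pos_of_mem hx).ne'
  rw [mul_comm, ← eq_div_iff hsin] at hs'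
  rw [eth, npDelta_eq, hpd 2 (by decide), hpd 3 (by decide), hφ x hx, beta, hs']
  have e1 : (x 1 : ℂ) ≠ 0 := by exact_mod_cast hr.ne'
  have e3 : (√(Delta M x) : ℂ) ≠ 0 := by exact_mod_cast hq.ne'
  have e4 : (√2 : ℂ) ≠ 0 := by exact_mod_cast (by norm_num : √2 ≠ 0)
  push_cast at hsin ⊢
  field_simp
  ring

/-- The Teukolsky operator in terms of `y = √2 r χ` and the spin-weighted divergence `s`. -/
theorem teukolsky_eq_of_rescaled (hM : 0 < M) {y s : Pt → ℂ}
    (hχ : ∀ x ∈ exterior M, chi M φ x = ((√2 * x 1 : ℝ) : ℂ)⁻¹ * y x)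
    (he : ∀ x ∈ exterior M, eth (-2) 0 φ x = ((x 1 / (√2 * √(Delta M x)) : ℝ) : ℂ) * s x)
    (hy : SmoothExt M y) (hs : SmoothExt M s) {x : Pt} (hx : x ∈ exterior M) :
    teukolsky M φ x = ((2 * √(Delta M x) * x 1 * Real.sin (x 2) : ℝ) : ℂ)⁻¹ *
      (Real.sin (x 2) * ((x 1 : ℂ) * pd 0 y x - ((x 1 - 2 * M : ℝ) : ℂ) * pd 1 y x) -
      x 1 * (Real.sin (x 2) * pd 2 s x - Complex.I * pd 3 s x)) := by
  have hr : 0 < x 1 := r_pos hM (exterior_subset M hx)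
  have hr' : 0 < x 1 - 2 * M := sub_pos.2 hx.1
  have hq : 0 < √(Delta M x) := Real.sqrt_pos.2 (Delta_pos hM (exterior_subset M hx))
  have hq2 : √(Delta M x) ^ 2 = x 1 * (x 1 - 2 * M) :=
    Real.sq_sqrt (Delta_pos hM (exterior_subset M hx)).le
  have h2 : √2 ^ 2 = (2 : ℝ) := by norm_num
  have hyd := (hy x (exterior_subset M hx)).diffAt
  have hsd := (hs x (exterior_subset M hx)).diffAt
  -- On weight (-1, 1) the ε' terms cancel and `1 / r` is annihilated by D' - ρ', so no
  -- undifferentiated `y` remains. Likewise ð' acts on weight (-1, -1), of spin 0, without a β term.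
  have hc1 : HasDerivAt (fun r : ℝ => (√2 * r)⁻¹) (-(√2) / (√2 * x 1) ^ 2) (x 1) := by
    have : HasDerivAt (fun r : ℝ => √2 * r) (√2) (x 1) := by
      simpa using (hasDerivAt_id' (x 1)).const_mul (√2)
    exact this.inv (by positivity)
  have hc2 : DifferentiableAt ℝ (fun r : ℝ => r / (√2 * √(r * (r - 2 * M)))) (x 1) :=
    ((hasDerivAt_id' (x 1)).div ((hasDerivAt_sqrt_Delta hM hx.1).const_mul √2)
      (mul_pos (by norm_num) hq).ne').differentiableAt
  have hp1 : ∀ μ, pd μ (chi M φ) x = (if μ = 1 then ((-(√2) / (√2 * x 1) ^ 2 : ℝ) : ℂ) * y x else 0)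
      + (((√2 * x 1)⁻¹ : ℝ) : ℂ) * pd μ y x := fun μ =>
    (pd_congr_exterior (g := fun x => (((√2 * x 1)⁻¹ : ℝ) : ℂ) * y x)
      (fun z hz => by rw [hχ z hz]; push_cast; rfl) hx μ).trans (pd_coord_mul hc1 hyd μ)
  have hp2 : ∀ μ ≠ 1, pd μ (eth (-2) 0 φ) x = ((x 1 / (√2 * √(Delta M x)) : ℝ) : ℂ) * pd μ s x :=
    fun μ hμ => (pd_congr_exterior he hx μ).trans (pd_coord_mul_of_ne hc2 hsd hμ)
  rw [teukolsky, thorn', npD'_eq, eth', npDelta'_eq, hp1, hp1, hp2 2 (by decide),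
    hp2 3 (by decide), hχ x hx, rho', rho, eps']
  simp only [Fin.reduceEq, if_false, if_true]
  generalize √(Delta M x) = q at *
  generalize √2 = a at *
  have ha : a ≠ 0 := by rintro rfl; norm_num at h2
  have hsin : (Real.sin (x 2) : ℂ) ≠ 0 := by exact_mod_cast (sin_pos_of_mem hx).ne'
  have e1 : (x 1 : ℂ) ≠ 0 := by exact_mod_cast hr.ne'
  have e2 : ((x 1 : ℂ) - 2 * M) ≠ 0 := by exact_mod_cast hr'.ne'
  have e3 : (q : ℂ) ≠ 0 := by exact_mod_cast hq.ne'
  have e4 : (a : ℂ) ≠ 0 := by exact_mod_cast ha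
  have e5 : (q : ℂ) ^ 2 = x 1 * (x 1 - 2 * M) := by exact_mod_cast hq2
  have e6 : (a : ℂ) ^ 2 = 2 := by exact_mod_cast h2
  push_cast at hsin ⊢
  field_simp
  simp only [e5, e6]
  ring

end Rescaled

/-- The factor `r` in the tangent vectors cancels the `1 / r` in `m̄`, leaving the polarization
vector over `√2`. -/
theorem spin_eq_spinField {M : ℝ} (hM : 0 < M) {W : Fin 4 → Pt → ℂ}
    {w : Fin 4 → (Fin 4 → ℝ) → ℂ} {x : Pt} (hx : x ∈ exterior M)
    (h : ∀ μ, W μ x = ∑ ν, w ν (cart x) * (pd μ (fun y => cart y ν) x : ℂ)) :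
    ∑ μ, W μ x * star (mUp x μ) = ((√2)⁻¹ : ℝ) * spinField w x := by
  have hr : 0 < x 1 := r_pos hM (exterior_subset M hx)
  have h' : ∀ μ, W μ x = ∑ ν, w ν (cart x) * ((pd μ (fun y => cart y ν) x : ℝ) : ℂ) := by
    intro μ; rw [h]
    exact Finset.sum_congr rfl fun ν _ => by
      rw [pd_ofReal (contDiff_cart ν).contDiffAt.diffAt]
  have e1 : (x 1 : ℂ) ≠ 0 := by exact_mod_cast hr.ne'
  have e4 : (√2 : ℂ) ≠ 0 := by exact_mod_cast (by norm_num : √2 ≠ 0)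
  have hsin : (Real.sin (x 2) : ℂ) ≠ 0 := by exact_mod_cast (sin_pos_of_mem hx).ne'
  have hm : ∑ μ, W μ x * star (mUp x μ) = W 2 x * ((√2 * x 1 : ℝ) : ℂ)⁻¹ +
      W 3 x * (-Complex.I * ((√2 * x 1 * Real.sin (x 2) : ℝ) : ℂ)⁻¹) := by
    simp [mUp, Fin.sum_univ_four, -Complex.ofReal_sin]
    ring
  rw [hm, h', h', spinField, Finset.mul_sum, Finset.sum_mul, Finset.sum_mul,
    ← Finset.sum_add_distrib]
  refine Finset.sum_congr rfl fun ν _ => ?_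
  rw [pd_two_cart, pd_three_cart]
  push_cast at hsin ⊢
  field_simp
  linear_combination (-w ν (cart x) * (polVec x ν - star (polVec x ν))) * Complex.I_sq

/-- The relations at the poles hold only on `sin θ = 0`, which has no interior; agreement along one
coordinate line suffices to differentiate them in directions that stay in this set. -/
theorem pd_eq_of_line {g₁ g₂ : Pt → ℂ} {x : Pt} {μ : Fin 4} (h₁ : DifferentiableAt ℝ g₁ x)
    (h₂ : DifferentiableAt ℝ g₂ x)
    (h : ∀ᶠ τ : ℝ in 𝓝 0, g₁ (x + Pi.single μ τ) = g₂ (x + Pi.single μ τ)) :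
    pd μ g₁ x = pd μ g₂ x := by
  have e1 := hasDerivAt_line h₁ μ
  have e2 := hasDerivAt_line h₂ μ
  exact e1.unique (e2.congr_of_eventuallyEq h)

/-- The Cartesian one-form behind `φ` provides the extension to all θ: `f` and `s` are radial
multiples of `spinField w` and `spinDiv w`, and `y` is defined by its formula. Periodicity and the
conditions at the poles are inherited. The Teukolsky equation plays no role here. -/
theorem IsSmoothSpinNegOne.exists_isDebyeData {M : ℝ} (hM : 0 < M) {φ : Pt → ℂ}
    (h : IsSmoothSpinNegOne M φ) : ∃ f y s, IsDebyeData M f y s ∧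
      (∀ x ∈ exterior M, φ x = ((x 1 ^ 2 / √(Delta M x) : ℝ) : ℂ) * f x) ∧
      (∀ x ∈ exterior M, chi M φ x = ((√2 * x 1 : ℝ) : ℂ)⁻¹ * y x) ∧
      (∀ x ∈ exterior M, eth (-2) 0 φ x = ((x 1 / (√2 * √(Delta M x)) : ℝ) : ℂ) * s x) := by
  obtain ⟨W, ⟨w, hw, hW⟩, hφ⟩ := h
  change ∀ ν, ContDiffOn ℝ ∞ (w ν) (cartRange M) at hw
  set c : ℝ → ℝ := fun r => (√2)⁻¹ * (√(r * (r - 2 * M)) / r ^ 2) with hcdef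
  have hc : ∀ r, 2 * M < r → ContDiffAt ℝ ∞ c r := fun r hr =>
    contDiffAt_const.mul (contDiffAt_sqrt_Delta hM hr)
  have hcs := SmoothExt.radial hc
  set f : Pt → ℂ := fun x => (c (x 1) : ℂ) * spinField w x with hf
  set s : Pt → ℂ := fun x => (c (x 1) : ℂ) * spinDiv w x with hs
  set y : Pt → ℂ := fun x => ((x 1 ^ 3 / (x 1 - 2 * M) : ℝ) : ℂ) * pd 0 f x
    + ((x 1 ^ 2 : ℝ) : ℂ) * pd 1 f x with hy
  have sf : SmoothExt M f := fun x hx => (hcs x hx).mul (smoothExt_spinField hM hw x hx)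
  have ss : SmoothExt M s := fun x hx => (hcs x hx).mul (smoothExt_spinDiv hM hw x hx)
  have h31 : ∀ r, 2 * M < r → ContDiffAt ℝ ∞ (fun r : ℝ => r ^ 3 / (r - 2 * M)) r := by
    intro r hr
    have h1 : ContDiffAt ℝ ∞ (fun r : ℝ => r ^ 3) r := by fun_prop
    have h2 : ContDiffAt ℝ ∞ (fun r : ℝ => r - 2 * M) r := by fun_prop
    exact h1.div h2 (by linarith)
  have h32 : ∀ r, 2 * M < r → ContDiffAt ℝ ∞ (fun r : ℝ => r ^ 2) r := by
    intro r _; fun_prop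
  have sy : SmoothExt M y := fun x hx =>
    ((SmoothExt.radial h31 x hx).mul (contDiffAt_pd (sf x hx) 0)).add
      ((SmoothExt.radial h32 x hx).mul (contDiffAt_pd (sf x hx) 1))
  have df : ∀ x ∈ extChart M, ∀ μ ≠ 1, pd μ f x = (c (x 1) : ℂ) * pd μ (spinField w) x :=
    fun x hx μ hμ => pd_coord_mul_of_ne (hc _ hx).diffAt (smoothExt_spinField hM hw x hx).diffAt hμ
  have hφf : ∀ x ∈ exterior M, φ x = ((x 1 ^ 2 / √(Delta M x) : ℝ) : ℂ) * f x := by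
    intro x hx
    have hr : 0 < x 1 := r_pos hM (exterior_subset M hx)
    have hq : 0 < √(Delta M x) := Real.sqrt_pos.2 (Delta_pos hM (exterior_subset M hx))
    rw [hφ x hx, spin_eq_spinField hM hx (hW x hx), hf, hcdef]
    change _ = _ * ((((√2)⁻¹ * (√(Delta M x) / x 1 ^ 2) : ℝ) : ℂ) * _)
    have e1 : (x 1 : ℂ) ≠ 0 := by exact_mod_cast hr.ne'
    have e3 : (√(Delta M x) : ℂ) ≠ 0 := by exact_mod_cast hq.ne'
    push_cast
    field_simp
  have hseq : ∀ x ∈ extChart M, Real.sin (x 2) * s x =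
      Real.sin (x 2) * pd 2 f x + Complex.I * pd 3 f x + Real.cos (x 2) * f x := by
    intro x hx
    rw [df x hx 2 (by decide), df x hx 3 (by decide)]
    linear_combination (c (x 1) : ℂ) * sin_mul_spinDiv hM hw hx
  have hχ : ∀ x ∈ exterior M, chi M φ x = ((√2 * x 1 : ℝ) : ℂ)⁻¹ * y x := fun x hx =>
    chi_eq_of_rescaled hM hφf sf hx
  have he := fun x (hx : x ∈ exterior M) => eth_eq_of_rescaled hM hφf sf hseq hx
  have af : IsAngular f := fun x => by
    simp only [hf]; rw [isAngular_spinField]; simp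
  have pf : ∀ x ∈ extChart M, Real.sin (x 2) = 0 →
      pd 3 f x = Complex.I * Real.cos (x 2) * f x := by
    intro x hx h0
    rw [df x hx 3 (by decide), pd_three_spinField_pole hM hw hx h0]
    ring
  -- Motion along any coordinate other than θ preserves `sin θ = 0`, so the relation for `f` may be
  -- differentiated in t and r, which is all that `y` involves.
  have pf' : ∀ x ∈ extChart M, Real.sin (x 2) = 0 → ∀ μ, μ ≠ 2 →
      pd 3 (pd μ f) x = Complex.I * Real.cos (x 2) * pd μ f x := by
    intro x hx h0 μ h2
    have hcd : DifferentiableAt ℝ (fun x : Pt => ((Real.cos (x 2) : ℝ) : ℂ)) x :=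
      diff_cast_coord Real.differentiable_cos.differentiableAt
    have hfd := (sf x hx).diffAt
    rw [pd_comm (sf x hx), pd_eq_of_line (g₂ := fun x => Complex.I * (Real.cos (x 2) * f x))
      (contDiffAt_pd (sf x hx) 3).diffAt ((hcd.fun_mul hfd).const_mul _) ?_,
      pd_const_mul _ (hcd.fun_mul hfd), pd_coord_mul (Real.hasDerivAt_cos _) hfd, if_neg h2]
    · ring
    · have hcont : Continuous fun τ : ℝ => x + (Pi.single μ τ : Pt) :=
        continuous_const.add (continuous_single (A := fun _ : Fin 4 => ℝ) μ)
      have := hcont.continuousAt.preimage_mem_nhds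
        ((isOpen_extChart M).mem_nhds (x := x + Pi.single μ (0 : ℝ)) (by simpa using hx))
      filter_upwards [this] with τ hτ
      rw [pf _ hτ (by simpa [h2.symm] using h0)]
      ring
  refine ⟨f, y, s, ⟨sf, sy, ss, fun _ _ => rfl, hseq, fun x => ?_, fun x => ?_,
    fun x hx h0 => ?_, fun x hx h0 => ?_⟩, hφf, hχ, he⟩
  · simp only [hy]
    rw [pd_add_period af, pd_add_period af]; simp
  · simp only [hs]; rw [isAngular_spinDiv]; simp
  · have d0 := (contDiffAt_pd (sf x hx) 0).diffAt
    have d1 := (contDiffAt_pd (sf x hx) 1).diffAt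
    have c1 := (SmoothExt.radial h31 x hx).diffAt
    have c2 := (SmoothExt.radial h32 x hx).diffAt
    simp only [hy]
    rw [pd_add (c1.fun_mul d0) (c2.fun_mul d1),
      pd_coord_mul_of_ne (c := fun r => r ^ 3 / (r - 2 * M)) (h31 _ hx).diffAt d0 (by decide),
      pd_coord_mul_of_ne (c := fun r => r ^ 2) (h32 _ hx).diffAt d1 (by decide),
      pf' x hx h0 0 (by decide), pf' x hx h0 1 (by decide)]
    ring
  · exact (pd_coord_mul_of_ne (hc _ hx).diffAt (smoothExt_spinDiv hM hw x hx).diffAt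
      (by decide)).trans (by rw [pd_three_spinDiv_pole hM hw hx h0, mul_zero])

/-- The Teukolsky equation in terms of the rescaled data. -/
theorem IsDebyeData.teukolsky_eq_zero_iff {M : ℝ} (hM : 0 < M) {φ f y s : Pt → ℂ}
    (h : IsDebyeData M f y s)
    (hχ : ∀ x ∈ exterior M, chi M φ x = ((√2 * x 1 : ℝ) : ℂ)⁻¹ * y x)
    (he : ∀ x ∈ exterior M, eth (-2) 0 φ x = ((x 1 / (√2 * √(Delta M x)) : ℝ) : ℂ) * s x)
    {x : Pt} (hx : x ∈ exterior M) : teukolsky M φ x = 0 ↔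
      Real.sin (x 2) * ((x 1 : ℂ) * pd 0 y x - ((x 1 - 2 * M : ℝ) : ℂ) * pd 1 y x) =
        x 1 * (Real.sin (x 2) * pd 2 s x - Complex.I * pd 3 s x) := by
  have hr : 0 < x 1 := r_pos hM (exterior_subset M hx)
  have hq : 0 < √(Delta M x) := Real.sqrt_pos.2 (Delta_pos hM (exterior_subset M hx))
  have := sin_pos_of_mem hx
  rw [teukolsky_eq_of_rescaled hM hχ he h.smooth_y h.smooth_s hx, mul_eq_zero, sub_eq_zero,
    or_iff_right (inv_ne_zero ?_)]
  exact_mod_cast (by positivity : (0:ℝ) < 2 * √(Delta M x) * x 1 * Real.sin (x 2)).ne'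

end SchwarzschildEM

namespace SchwarzschildEM

/-! ### The field strength of the Hertz vector potential -/

/-- The diagonal entries of the inverse metric. -/
noncomputable def gInv (M : ℝ) (x : Pt) : Fin 4 → ℝ :=
  ![x 1 ^ 2 / Delta M x, -(Delta M x / x 1 ^ 2), -(x 1 ^ 2)⁻¹,
    -(x 1 ^ 2 * Real.sin (x 2) ^ 2)⁻¹]

theorem metricInv_apply (M : ℝ) (x : Pt) (μ ν : Fin 4) :
    metricInv M x μ ν = if μ = ν then gInv M x μ else 0 := rfl

theorem raise₂_eq (M : ℝ) (F : Fin 4 → Fin 4 → Pt → ℂ) (μ ν : Fin 4) (x : Pt) :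
    raise₂ M F μ ν x = (gInv M x μ : ℂ) * (gInv M x ν : ℂ) * F μ ν x := by
  simp only [raise₂, metricInv_apply]
  rw [Finset.sum_eq_single μ, Finset.sum_eq_single ν]
  · simp
  · intro b _ hb; simp [hb.symm]
  · simp
  · intro b _ hb; simp [hb.symm]
  · simp

/-- The sign of a permutation of 0, 1, 2, 3 is its Vandermonde product divided by 1!·2!·3! = 12, and
both sides vanish on repeated indices. The polynomial form makes every component of the volume form
computable. -/
theorem det_index_eq (μ ν α β : Fin 4) :
    12 * Matrix.det (Matrix.of fun i j : Fin 4 => if ![μ, ν, α, β] i = j then (1 : ℤ) else 0) =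
      ((ν : ℤ) - μ) * ((α : ℤ) - μ) * ((β : ℤ) - μ) * ((α : ℤ) - ν) * ((β : ℤ) - ν)
        * ((β : ℤ) - α) := by
  revert μ ν α β
  decide +kernel

theorem volForm_eq (x : Pt) (μ ν α β : Fin 4) : volForm x μ ν α β = -sqrtDetMetric x *
    ((((ν : ℕ) : ℝ) - (μ : ℕ)) * (((α : ℕ) : ℝ) - (μ : ℕ)) * (((β : ℕ) : ℝ) - (μ : ℕ)) *
      (((α : ℕ) : ℝ) - (ν : ℕ)) * (((β : ℕ) : ℝ) - (ν : ℕ)) * (((β : ℕ) : ℝ) - (α : ℕ)) / 12) := by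
  have h1 := congrArg (Int.cast : ℤ → ℝ) (det_index_eq μ ν α β)
  have h2 : ((Matrix.det (Matrix.of fun i j : Fin 4 =>
      if ![μ, ν, α, β] i = j then (1 : ℤ) else 0) : ℤ) : ℝ) = Matrix.det (Matrix.of fun i j : Fin 4 =>
      if ![μ, ν, α, β] i = j then (1 : ℝ) else 0) := by
    refine (RingHom.map_det (Int.castRingHom ℝ) _).trans ?_
    congr 1
    ext i j
    simp
  push_cast [h2] at h1
  rw [volForm, ← h1]
  ring

theorem hodge_swap (M : ℝ) (F : Fin 4 → Fin 4 → Pt → ℂ) (μ ν : Fin 4) (x : Pt) :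
    hodge M F ν μ x = -hodge M F μ ν x := by
  simp only [hodge, ← mul_neg, ← Finset.sum_neg_distrib, volForm_eq]
  refine congrArg _ (Finset.sum_congr rfl fun α _ => Finset.sum_congr rfl fun β _ => ?_)
  push_cast; ring

theorem hodge_eq (M : ℝ) (F : Fin 4 → Fin 4 → Pt → ℂ) (hF : ∀ μ ν x, F ν μ x = -F μ ν x)
    (x : Pt) :
    hodge M F 0 1 x = -(sqrtDetMetric x : ℂ) * raise₂ M F 2 3 x ∧
    hodge M F 0 2 x = (sqrtDetMetric x : ℂ) * raise₂ M F 1 3 x ∧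
    hodge M F 0 3 x = -(sqrtDetMetric x : ℂ) * raise₂ M F 1 2 x ∧
    hodge M F 1 2 x = -(sqrtDetMetric x : ℂ) * raise₂ M F 0 3 x ∧
    hodge M F 1 3 x = (sqrtDetMetric x : ℂ) * raise₂ M F 0 2 x ∧
    hodge M F 2 3 x = -(sqrtDetMetric x : ℂ) * raise₂ M F 0 1 x := by
  have hR : ∀ μ ν, raise₂ M F ν μ x = -raise₂ M F μ ν x := fun μ ν => by
    rw [raise₂_eq, raise₂_eq, hF]; ring
  refine ⟨?_, ?_, ?_, ?_, ?_, ?_⟩ <;>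
  · simp only [hodge, volForm_eq, Fin.sum_univ_four, hR 0 1, hR 0 2, hR 0 3, hR 1 2, hR 1 3,
      hR 2 3]
    push_cast
    simp only [Fin.coe_ofNat_eq_mod]
    norm_num
    try ring

theorem fieldStrength_swap (A : Fin 4 → Pt → ℂ) (μ ν : Fin 4) (x : Pt) :
    fieldStrength A ν μ x = -fieldStrength A μ ν x := by
  simp [fieldStrength]

theorem fieldStrength_self (A : Fin 4 → Pt → ℂ) (μ : Fin 4) (x : Pt) :
    fieldStrength A μ μ x = 0 := by
  simp [fieldStrength]

theorem contDiffAt_fieldStrength {A : Fin 4 → Pt → ℂ} {x : Pt}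
    (hA : ∀ μ, ContDiffAt ℝ ∞ (A μ) x) (μ ν : Fin 4) :
    ContDiffAt ℝ ∞ (fieldStrength A μ ν) x :=
  (contDiffAt_pd (hA ν) μ).sub (contDiffAt_pd (hA μ) ν)

theorem bianchi {A : Fin 4 → Pt → ℂ} {x : Pt} (hA : ∀ μ, ContDiffAt ℝ ∞ (A μ) x)
    (a b c : Fin 4) : pd a (fieldStrength A b c) x + pd b (fieldStrength A c a) x
      + pd c (fieldStrength A a b) x = 0 := by
  have h : ∀ a b c, pd a (fieldStrength A b c) x = pd a (pd b (A c)) x - pd a (pd c (A b)) x :=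
    fun a b c => pd_sub (contDiffAt_pd (hA c) b).diffAt (contDiffAt_pd (hA b) c).diffAt a
  rw [h, h, h, pd_comm (hA c) b a, pd_comm (hA b) c a, pd_comm (hA a) c b]
  ring

/-- A self-dual field strength solves the Maxwell equation, in components. -/
theorem isMaxwell_of_dual {M : ℝ} (hM : 0 < M) {A : Fin 4 → Pt → ℂ}
    (hA : ∀ x ∈ exterior M, ∀ μ, ContDiffAt ℝ ∞ (A μ) x)
    (d1 : ∀ x ∈ exterior M, fieldStrength A 2 3 x =
      -Complex.I * Real.sin (x 2) * x 1 ^ 2 * fieldStrength A 0 1 x)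
    (d2 : ∀ x ∈ exterior M, ((x 1 : ℂ) - 2 * M) * fieldStrength A 1 3 x =
      Complex.I * Real.sin (x 2) * x 1 * fieldStrength A 0 2 x)
    (d3 : ∀ x ∈ exterior M, Complex.I * Real.sin (x 2) * ((x 1 : ℂ) - 2 * M) *
      fieldStrength A 1 2 x = x 1 * fieldStrength A 0 3 x) :
    IsMaxwell M (fieldStrength A) ∧ IsSelfDual M (fieldStrength A) := by
  -- Duality replaces each densitized contravariant component by ±i times the complementary
  -- covariant one. The divergence of F is thereby a cyclic sum of derivatives of F, and
  -- self-duality can be read off from the same list.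
  have key : ∀ x ∈ exterior M,
      sqrtDetMetric x * raise₂ M (fieldStrength A) 0 1 x = -Complex.I * fieldStrength A 2 3 x ∧
      sqrtDetMetric x * raise₂ M (fieldStrength A) 0 2 x = Complex.I * fieldStrength A 1 3 x ∧
      sqrtDetMetric x * raise₂ M (fieldStrength A) 0 3 x = -Complex.I * fieldStrength A 1 2 x ∧
      sqrtDetMetric x * raise₂ M (fieldStrength A) 1 2 x = -Complex.I * fieldStrength A 0 3 x ∧
      sqrtDetMetric x * raise₂ M (fieldStrength A) 1 3 x = Complex.I * fieldStrength A 0 2 x ∧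
      sqrtDetMetric x * raise₂ M (fieldStrength A) 2 3 x = -Complex.I * fieldStrength A 0 1 x := by
    intro x hx
    have hI := Complex.I_sq
    have e1 : (x 1 : ℂ) ≠ 0 := by exact_mod_cast (r_pos hM (exterior_subset M hx)).ne'
    have e2 : ((x 1 : ℂ) - 2 * M) ≠ 0 := by exact_mod_cast (sub_pos.2 hx.1).ne'
    have e3 : (Real.sin (x 2) : ℂ) ≠ 0 := by exact_mod_cast (sin_pos_of_mem hx).ne'
    have h1 := d1 x hx
    have h2 := d2 x hx
    have h3 := d3 x hx
    simp only [raise₂_eq, sqrtDetMetric, gInv, Delta, Matrix.cons_val]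
    push_cast at e3 h1 h2 h3 ⊢
    refine ⟨?_, ?_, ?_, ?_, ?_, ?_⟩ <;> field_simp
    · linear_combination Complex.I * h1 - Complex.sin (x 2) * x 1 ^ 2 * fieldStrength A 0 1 x * hI
    · linear_combination -Complex.I * h2 - x 1 * Complex.sin (x 2) * fieldStrength A 0 2 x * hI
    · linear_combination h3
    · linear_combination -Complex.I * h3 + Complex.sin (x 2) * (x 1 - 2 * M) * fieldStrength A 1 2 x * hI
    · linear_combination h2
    · linear_combination h1
  refine ⟨fun x hx μ => ?_, fun x hx μ ν => ?_⟩
  · have hG : ∀ ν μ, ∀ a b : Fin 4, ∀ c : ℂ, (∀ y ∈ exterior M,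
        sqrtDetMetric y * raise₂ M (fieldStrength A) ν μ y = c * fieldStrength A a b y) →
        pd ν (fun y => (sqrtDetMetric y : ℂ) * raise₂ M (fieldStrength A) ν μ y) x =
          c * pd ν (fieldStrength A a b) x := fun ν μ a b c h =>
      (pd_congr_exterior h hx ν).trans
        (pd_const_mul c (contDiffAt_fieldStrength (hA x hx) a b).diffAt ν)
    have hG' : ∀ ν μ, ∀ a b : Fin 4, ∀ c : ℂ, (∀ y ∈ exterior M,
        sqrtDetMetric y * raise₂ M (fieldStrength A) μ ν y = c * fieldStrength A a b y) →
        pd ν (fun y => (sqrtDetMetric y : ℂ) * raise₂ M (fieldStrength A) ν μ y) x =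
          -c * pd ν (fieldStrength A a b) x := fun ν μ a b c h => by
      refine hG ν μ a b (-c) fun y hy => ?_
      have := h y hy
      rw [raise₂_eq] at this ⊢
      rw [fieldStrength_swap]
      linear_combination -this
    have h0 : ∀ μ, pd μ (fun y => (sqrtDetMetric y : ℂ) * raise₂ M (fieldStrength A) μ μ y) x =
        0 := fun μ => by
      rw [hG μ μ 0 0 0 fun y _ => by rw [raise₂_eq, fieldStrength_self]; ring]; ring
    have hs : ∀ a b c : Fin 4, pd a (fieldStrength A b c) x = -pd a (fieldStrength A c b) x := by
      intro a b c
      rw [← pd_neg]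
      exact congrArg (fun f => pd a f x) (funext fun y => fieldStrength_swap A c b y)
    have b123 := bianchi (hA x hx) 1 2 3
    have b023 := bianchi (hA x hx) 0 2 3
    have b013 := bianchi (hA x hx) 0 1 3
    have b012 := bianchi (hA x hx) 0 1 2
    rw [hs 2 3 1] at b123
    rw [hs 2 3 0] at b023
    rw [hs 1 3 0] at b013
    rw [hs 1 2 0] at b012
    rw [mul_eq_zero]
    right
    rw [Fin.sum_univ_four]
    have k1 := fun y hy => (key y hy).1
    have k2 := fun y hy => (key y hy).2.1
    have k3 := fun y hy => (key y hy).2.2.1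
    have k4 := fun y hy => (key y hy).2.2.2.1
    have k5 := fun y hy => (key y hy).2.2.2.2.1
    have k6 := fun y hy => (key y hy).2.2.2.2.2
    revert μ
    rw [Fin.forall_fin_succ, Fin.forall_fin_succ, Fin.forall_fin_succ, Fin.forall_fin_succ]
    refine ⟨?_, ?_, ?_, ?_, fun i => i.elim0⟩
    · rw [h0, hG' 1 0 _ _ _ k1, hG' 2 0 _ _ _ k2, hG' 3 0 _ _ _ k3]
      linear_combination Complex.I * b123
    · change _ + pd 1 (fun y => _ * raise₂ M (fieldStrength A) 1 1 y) x + _ + _ = _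
      rw [h0]
      erw [hG 0 1 _ _ _ k1, hG' 2 1 _ _ _ k4, hG' 3 1 _ _ _ k5]
      linear_combination -Complex.I * b023
    · change _ + _ + pd 2 (fun y => _ * raise₂ M (fieldStrength A) 2 2 y) x + _ = _
      rw [h0]
      erw [hG 0 2 _ _ _ k2, hG 1 2 _ _ _ k4, hG' 3 2 _ _ _ k6]
      linear_combination Complex.I * b013
    · change _ + _ + _ + pd 3 (fun y => _ * raise₂ M (fieldStrength A) 3 3 y) x = _
      rw [h0]
      erw [hG 0 3 _ _ _ k3, hG 1 3 _ _ _ k5, hG 2 3 _ _ _ k6]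
      linear_combination -Complex.I * b012
  · obtain ⟨k1, k2, k3, k4, k5, k6⟩ := key x hx
    obtain ⟨b1, b2, b3, b4, b5, b6⟩ := hodge_eq M (fieldStrength A) (fieldStrength_swap A) x
    have h0 : ∀ μ, hodge M (fieldStrength A) μ μ x = Complex.I * fieldStrength A μ μ x := fun μ => by
      rw [fieldStrength_self]
      linear_combination (1 / 2) * hodge_swap M (fieldStrength A) μ μ x
    have hsw : ∀ μ ν, hodge M (fieldStrength A) μ ν x = Complex.I * fieldStrength A μ ν x →
        hodge M (fieldStrength A) ν μ x = Complex.I * fieldStrength A ν μ x := fun μ ν h => by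
      rw [hodge_swap, fieldStrength_swap A μ ν, h]; ring
    replace b1 := b1.trans (by linear_combination -k6 : _ = Complex.I * fieldStrength A 0 1 x)
    replace b2 := b2.trans (by linear_combination k5 : _ = Complex.I * fieldStrength A 0 2 x)
    replace b3 := b3.trans (by linear_combination -k4 : _ = Complex.I * fieldStrength A 0 3 x)
    replace b4 := b4.trans (by linear_combination -k3 : _ = Complex.I * fieldStrength A 1 2 x)
    replace b5 := b5.trans (by linear_combination k2 : _ = Complex.I * fieldStrength A 1 3 x)
    replace b6 := b6.trans (by linear_combination -k1 : _ = Complex.I * fieldStrength A 2 3 x)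
    fin_cases μ <;> fin_cases ν
    · exact h0 0
    · exact b1
    · exact b2
    · exact b3
    · exact hsw 0 1 b1
    · exact h0 1
    · exact b4
    · exact b5
    · exact hsw 0 2 b2
    · exact hsw 1 2 b4
    · exact h0 2
    · exact b6
    · exact hsw 0 3 b3
    · exact hsw 1 3 b5
    · exact hsw 2 3 b6
    · exact h0 3

end SchwarzschildEM

/-! ### Components and self-duality of the field of a Hertz potential -/

namespace SchwarzschildEM

/-- The relation between a Hertz potential `φ` and its rescaled version. -/
structure IsDebyeOf (M : ℝ) (φ f y s : Pt → ℂ) : Prop extends IsDebye M f y s where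
  phi_eq : ∀ x ∈ exterior M, φ x = ((x 1 ^ 2 / √(Delta M x) : ℝ) : ℂ) * f x
  chi_eq : ∀ x ∈ exterior M, chi M φ x = ((√2 * x 1 : ℝ) : ℂ)⁻¹ * y x
  eth_eq : ∀ x ∈ exterior M, eth (-2) 0 φ x = ((x 1 / (√2 * √(Delta M x)) : ℝ) : ℂ) * s x

theorem IsHertzPotential.exists_isDebyeOf {M : ℝ} (hM : 0 < M) {φ : Pt → ℂ}
    (h : IsHertzPotential M φ) : ∃ f y s, IsDebyeOf M φ f y s := by
  obtain ⟨f, y, s, h1, h2, h3, h4⟩ := h.1.exists_isDebyeData hM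
  exact ⟨f, y, s, ⟨⟨h1, fun x hx => (h1.teukolsky_eq_zero_iff hM h3 h4 hx).1 (h.2 x hx)⟩,
    h2, h3, h4⟩⟩

theorem lDown_eq {M : ℝ} (hM : 0 < M) {x : Pt} (hx : x ∈ exterior M) :
    lDown M x = ![√(Delta M x) / (√2 * x 1), -(x 1 / (√2 * √(Delta M x))), 0, 0] := by
  have hr : 0 < x 1 := r_pos hM (exterior_subset M hx)
  have hD := Delta_pos hM (exterior_subset M hx)
  have hq : 0 < √(Delta M x) := Real.sqrt_pos.2 hD
  have hq2 : Delta M x = √(Delta M x) ^ 2 := (Real.sq_sqrt hD.le).symm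
  funext μ
  fin_cases μ <;> simp [lDown, metric, lUp, Matrix.diagonal_apply]
  · generalize hq' : √(Delta M x) = q at *
    rw [hq2]; field_simp
  · generalize hq' : √(Delta M x) = q at *
    rw [hq2]; field_simp

theorem mDown_eq {M : ℝ} (hM : 0 < M) {x : Pt} (hx : x ∈ exterior M) :
    mDown M x = ![0, 0, -((x 1 / √2 : ℝ) : ℂ),
      -Complex.I * ((x 1 * Real.sin (x 2) / √2 : ℝ) : ℂ)] := by
  have e1 : (x 1 : ℂ) ≠ 0 := by exact_mod_cast (r_pos hM (exterior_subset M hx)).ne'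
  have e3 : (Real.sin (x 2) : ℂ) ≠ 0 := by exact_mod_cast (sin_pos_of_mem hx).ne'
  have e4 : (√2 : ℂ) ≠ 0 := by exact_mod_cast (by norm_num : √2 ≠ 0)
  push_cast at e3
  funext μ
  fin_cases μ <;> simp [mDown, metric, mUp, Fin.sum_univ_four, Matrix.diagonal_apply] <;>
    field_simp

section Debye

variable {M : ℝ} {φ f y s : Pt → ℂ}

/-- The square roots in the frame cancel those in `χ` and ð φ, so the field strength can be computed
with rational coefficients. -/
theorem IsDebyeOf.hertzA_eq (h : IsDebyeOf M φ f y s) (hM : 0 < M) {x : Pt} (hx : x ∈ exterior M) :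
    hertzA M φ 0 x = -(1 / 2) * s x ∧
    hertzA M φ 1 x = ((x 1 / (2 * (x 1 - 2 * M)) : ℝ) : ℂ) * s x ∧
    hertzA M φ 2 x = -(1 / 2) * y x ∧
    hertzA M φ 3 x = -(1 / 2) * (Complex.I * (Real.sin (x 2) * y x)) := by
  have hr : 0 < x 1 := r_pos hM (exterior_subset M hx)
  have hr' : 0 < x 1 - 2 * M := sub_pos.2 hx.1
  have hD := Delta_pos hM (exterior_subset M hx)
  have hq : 0 < √(Delta M x) := Real.sqrt_pos.2 hD
  have hq2 : √(Delta M x) ^ 2 = x 1 * (x 1 - 2 * M) := Real.sq_sqrt hD.le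
  have h2 : √2 ^ 2 = (2 : ℝ) := by norm_num
  simp only [hertzA, lDown_eq hM hx, mDown_eq hM hx, h.chi_eq x hx, h.eth_eq x hx,
    Matrix.cons_val]
  generalize √(Delta M x) = q at *
  generalize √2 = a at *
  have ha : a ≠ 0 := by rintro rfl; norm_num at h2
  have e1 : (x 1 : ℂ) ≠ 0 := by exact_mod_cast hr.ne'
  have e2 : ((x 1 : ℂ) - 2 * M) ≠ 0 := by exact_mod_cast hr'.ne'
  have e3 : (q : ℂ) ≠ 0 := by exact_mod_cast hq.ne'
  have e4 : (a : ℂ) ≠ 0 := by exact_mod_cast ha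
  have e5 : (q : ℂ) ^ 2 = x 1 * (x 1 - 2 * M) := by exact_mod_cast hq2
  have e6 : (a : ℂ) ^ 2 = 2 := by exact_mod_cast h2
  push_cast
  refine ⟨?_, ?_, ?_, ?_⟩ <;> field_simp <;> simp only [e5, e6] <;> ring

theorem hertzA_three_eq_ernst (hM : 0 < M) {x : Pt} (hx : x ∈ exterior M) :
    hertzA M φ 3 x = -(1 / 2) * ernst M φ x := by
  have h2 : √2 ^ 2 = (2 : ℝ) := by norm_num
  have e6 : (√2 : ℂ) ^ 2 = 2 := by exact_mod_cast h2
  have e4 : (√2 : ℂ) ≠ 0 := by exact_mod_cast (by norm_num : √2 ≠ 0)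
  simp only [hertzA, lDown_eq hM hx, mDown_eq hM hx, ernst, Matrix.cons_val]
  push_cast
  field_simp
  simp only [e6]
  ring

theorem IsDebyeOf.contDiffAt_hertzA (h : IsDebyeOf M φ f y s) (hM : 0 < M) {x : Pt}
    (hx : x ∈ exterior M) (μ : Fin 4) : ContDiffAt ℝ ∞ (hertzA M φ μ) x := by
  have hs := h.smooth_s x (exterior_subset M hx)
  have hy := h.smooth_y x (exterior_subset M hx)
  have hc : ContDiffAt ℝ ∞ (fun x : Pt => ((x 1 / (2 * (x 1 - 2 * M)) : ℝ) : ℂ)) x := by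
    refine SmoothExt.radial (M := M) (c := fun r => r / (2 * (r - 2 * M))) (fun r hr => ?_) x
      (exterior_subset M hx)
    have h2 : ContDiffAt ℝ ∞ (fun r : ℝ => 2 * (r - 2 * M)) r := by fun_prop
    exact contDiffAt_id.div h2 (by linarith)
  have hsin := (contDiff_coord_ofReal Real.contDiff_sin 2).contDiffAt (x := x)
  revert μ
  rw [Fin.forall_fin_succ, Fin.forall_fin_succ, Fin.forall_fin_succ, Fin.forall_fin_succ]
  refine ⟨?_, ?_, ?_, ?_, fun i => i.elim0⟩
  · exact (contDiffAt_const.mul hs).congr_of_eventuallyEq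
      (eventuallyEq_of_exterior (fun z hz => (h.hertzA_eq hM hz).1) hx)
  · exact (hc.mul hs).congr_of_eventuallyEq
      (eventuallyEq_of_exterior (fun z hz => (h.hertzA_eq hM hz).2.1) hx)
  · exact (contDiffAt_const.mul hy).congr_of_eventuallyEq
      (eventuallyEq_of_exterior (fun z hz => (h.hertzA_eq hM hz).2.2.1) hx)
  · exact (contDiffAt_const.mul (contDiffAt_const.mul (hsin.mul hy))).congr_of_eventuallyEq
      (eventuallyEq_of_exterior (fun z hz => (h.hertzA_eq hM hz).2.2.2) hx)

/-- The r-derivative of the r-component never enters an antisymmetrized derivative, whence the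
restriction on `μ` in the second clause. -/
theorem IsDebyeOf.pd_hertzA (h : IsDebyeOf M φ f y s) (hM : 0 < M) {x : Pt} (hx : x ∈ exterior M)
    (μ : Fin 4) :
    pd μ (hertzA M φ 0) x = -(1 / 2) * pd μ s x ∧
    (μ ≠ 1 → pd μ (hertzA M φ 1) x = ((x 1 / (2 * (x 1 - 2 * M)) : ℝ) : ℂ) * pd μ s x) ∧
    pd μ (hertzA M φ 2) x = -(1 / 2) * pd μ y x ∧
    pd μ (hertzA M φ 3) x = -(1 / 2) * (Complex.I *
      ((if μ = 2 then Real.cos (x 2) * y x else 0) + Real.sin (x 2) * pd μ y x)) := by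
  have hs := (h.smooth_s x (exterior_subset M hx)).diffAt
  have hy := (h.smooth_y x (exterior_subset M hx)).diffAt
  have hr' : 0 < x 1 - 2 * M := sub_pos.2 hx.1
  have hc : DifferentiableAt ℝ (fun r : ℝ => r / (2 * (r - 2 * M))) (x 1) :=
    differentiableAt_id.fun_div (by fun_prop) (by positivity)
  have hsin : DifferentiableAt ℝ (fun x : Pt => (Real.sin (x 2) : ℂ)) x :=
    diff_cast_coord Real.differentiable_sin.differentiableAt
  refine ⟨?_, fun hμ => ?_, ?_, ?_⟩
  · rw [pd_congr_exterior (fun z hz => (h.hertzA_eq hM hz).1) hx, pd_const_mul _ hs]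
  · exact (pd_congr_exterior (fun z hz => (h.hertzA_eq hM hz).2.1) hx μ).trans
      (pd_coord_mul_of_ne hc hs hμ)
  · rw [pd_congr_exterior (fun z hz => (h.hertzA_eq hM hz).2.2.1) hx, pd_const_mul _ hy]
  · rw [pd_congr_exterior (fun z hz => (h.hertzA_eq hM hz).2.2.2) hx,
      pd_const_mul _ ((hsin.fun_mul hy).const_mul _), pd_const_mul _ (hsin.fun_mul hy),
      pd_coord_mul (Real.hasDerivAt_sin _) hy]

theorem IsDebyeOf.fieldStrength_eq (h : IsDebyeOf M φ f y s) (hM : 0 < M) {x : Pt}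
    (hx : x ∈ exterior M) :
    fieldStrength (hertzA M φ) 0 1 x =
      (1 / 2) * ((x 1 : ℂ) / (x 1 - 2 * M) * pd 0 s x + pd 1 s x) ∧
    fieldStrength (hertzA M φ) 0 2 x = (1 / 2) * (pd 2 s x - pd 0 y x) ∧
    fieldStrength (hertzA M φ) 0 3 x =
      (1 / 2) * (pd 3 s x - Complex.I * Real.sin (x 2) * pd 0 y x) ∧
    fieldStrength (hertzA M φ) 1 2 x =
      -(1 / 2) * (pd 1 y x + (x 1 : ℂ) / (x 1 - 2 * M) * pd 2 s x) ∧
    fieldStrength (hertzA M φ) 1 3 x =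
      -(1 / 2) * (Complex.I * Real.sin (x 2) * pd 1 y x
        + (x 1 : ℂ) / (x 1 - 2 * M) * pd 3 s x) ∧
    fieldStrength (hertzA M φ) 2 3 x = (1 / 2) * (pd 3 y x
      - Complex.I * (Real.cos (x 2) * y x + Real.sin (x 2) * pd 2 y x)) := by
  have H := h.pd_hertzA hM hx
  have e2 : ((x 1 : ℂ) - 2 * M) ≠ 0 := by exact_mod_cast (sub_pos.2 hx.1).ne'
  simp only [fieldStrength, (H 0).2.1 (by decide), (H 2).2.1 (by decide), (H 3).2.1 (by decide),
    (H _).1, (H _).2.2.1, (H _).2.2.2]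
  simp only [Fin.reduceEq, if_false, if_true]
  push_cast
  refine ⟨?_, ?_, ?_, ?_, ?_, ?_⟩ <;> field_simp <;> ring

/-- The spin-weighted divergences of `y` and of `f`. -/
theorem IsDebye.div_y (h : IsDebye M f y s) {x : Pt} (hx : x ∈ extChart M) :
    Real.sin (x 2) * pd 2 y x + Complex.I * pd 3 y x + Real.cos (x 2) * y x =
      Real.sin (x 2) * (((x 1 ^ 3 / (x 1 - 2 * M) : ℝ) : ℂ) * pd 0 s x
        + ((x 1 ^ 2 : ℝ) : ℂ) * pd 1 s x) := by
  have hr : 2 * M < x 1 := hx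
  have hf := h.smooth_f x hx
  have hs := (h.smooth_s x hx).diffAt
  have hU := (isOpen_extChart M).mem_nhds hx
  have c3 : DifferentiableAt ℝ (fun r : ℝ => r ^ 3 / (r - 2 * M)) (x 1) :=
    DifferentiableAt.fun_div (by fun_prop) (by fun_prop) (by linarith)
  have c2 : DifferentiableAt ℝ (fun r : ℝ => r ^ 2) (x 1) := by fun_prop
  have dsin : DifferentiableAt ℝ (fun x : Pt => (Real.sin (x 2) : ℂ)) x :=
    diff_cast_coord Real.differentiable_sin.differentiableAt
  have dcos : DifferentiableAt ℝ (fun x : Pt => (Real.cos (x 2) : ℂ)) x :=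
    diff_cast_coord Real.differentiable_cos.differentiableAt
  have dp : ∀ μ, DifferentiableAt ℝ (pd μ f) x := fun μ => (contDiffAt_pd hf μ).diffAt
  -- Both `y` and `s` are first order in `f`, one in (t, r) and the other in (θ, ϕ), with
  -- coefficients depending only on their own variables; the two operators therefore commute. The
  -- Teukolsky equation is not involved.
  have py : ∀ μ ≠ 1, pd μ y x = ((x 1 ^ 3 / (x 1 - 2 * M) : ℝ) : ℂ) * pd μ (pd 0 f) x
      + ((x 1 ^ 2 : ℝ) : ℂ) * pd μ (pd 1 f) x := fun μ hμ => by
    rw [pd_congr (Filter.eventuallyEq_of_mem hU h.y_eq),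
      pd_add ((diff_cast_coord c3).fun_mul (dp 0)) ((diff_cast_coord c2).fun_mul (dp 1)),
      pd_coord_mul_of_ne c3 (dp 0) hμ, pd_coord_mul_of_ne c2 (dp 1) hμ]
  have ps : ∀ μ ≠ 2, Real.sin (x 2) * pd μ s x = Real.sin (x 2) * pd μ (pd 2 f) x
      + Complex.I * pd μ (pd 3 f) x + Real.cos (x 2) * pd μ f x := fun μ hμ => by
    have e := pd_congr (Filter.eventuallyEq_of_mem hU h.s_eq) μ
    rwa [pd_add ((dsin.fun_mul (dp 2)).fun_add ((dp 3).const_mul _)) (dcos.fun_mul hf.diffAt),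
      pd_add (dsin.fun_mul (dp 2)) ((dp 3).const_mul _), pd_const_mul _ (dp 3),
      pd_coord_mul_of_ne Real.differentiable_sin.differentiableAt hs hμ,
      pd_coord_mul_of_ne Real.differentiable_sin.differentiableAt (dp 2) hμ,
      pd_coord_mul_of_ne Real.differentiable_cos.differentiableAt hf.diffAt hμ] at e
  rw [py 2 (by decide), py 3 (by decide), h.y_eq x hx, pd_comm hf 2 0, pd_comm hf 2 1,
    pd_comm hf 3 0, pd_comm hf 3 1]
  linear_combination -((x 1 ^ 3 / (x 1 - 2 * M) : ℝ) : ℂ) * ps 0 (by decide)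
    - ((x 1 ^ 2 : ℝ) : ℂ) * ps 1 (by decide)

/-- The first relation is the commutation identity `IsDebye.div_y`; the other two are both i times
the Teukolsky equation. -/
theorem IsDebyeOf.duality (h : IsDebyeOf M φ f y s) (hM : 0 < M) {x : Pt} (hx : x ∈ exterior M) :
    fieldStrength (hertzA M φ) 2 3 x =
      -Complex.I * Real.sin (x 2) * x 1 ^ 2 * fieldStrength (hertzA M φ) 0 1 x ∧
    ((x 1 : ℂ) - 2 * M) * fieldStrength (hertzA M φ) 1 3 x =
      Complex.I * Real.sin (x 2) * x 1 * fieldStrength (hertzA M φ) 0 2 x ∧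
    Complex.I * Real.sin (x 2) * ((x 1 : ℂ) - 2 * M) * fieldStrength (hertzA M φ) 1 2 x =
      x 1 * fieldStrength (hertzA M φ) 0 3 x := by
  obtain ⟨f1, f2, f3, f4, f5, f6⟩ := h.fieldStrength_eq hM hx
  have hI := Complex.I_sq
  have e2 : ((x 1 : ℂ) - 2 * M) ≠ 0 := by exact_mod_cast (sub_pos.2 hx.1).ne'
  have hd := h.div_y (exterior_subset M hx)
  have hw := h.wave x hx
  rw [f1, f2, f3, f4, f5, f6]
  push_cast at hd hw ⊢
  refine ⟨?_, ?_, ?_⟩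
  · linear_combination (-(1 / 2) * Complex.I) * hd + (1 / 2) * pd 3 y x * hI
  · field_simp
    linear_combination Complex.I * hw - x 1 * pd 3 s x * hI
  · field_simp
    linear_combination Complex.I * hw - x 1 * pd 3 s x * hI

theorem IsDebyeOf.isMaxwell_isSelfDual (h : IsDebyeOf M φ f y s) (hM : 0 < M) :
    IsMaxwell M (fieldStrength (hertzA M φ)) ∧ IsSelfDual M (fieldStrength (hertzA M φ)) :=
  isMaxwell_of_dual hM (fun _ hx => h.contDiffAt_hertzA hM hx)
    (fun _ hx => (h.duality hM hx).1) (fun _ hx => (h.duality hM hx).2.1)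
    (fun _ hx => (h.duality hM hx).2.2)

end Debye

end SchwarzschildEM

namespace SchwarzschildEM

/-! ### The energy densities in terms of `y` and `s` -/

/-- `√2 r ð` on spin weight `-1`. -/
noncomputable def dPlus (y : Pt → ℂ) (x : Pt) : ℂ :=
  pd 2 y x + (Complex.I * pd 3 y x + Real.cos (x 2) * y x) / Real.sin (x 2)

/-- `√2 r ð'` on spin weight `-1`. -/
noncomputable def dMinus (y : Pt → ℂ) (x : Pt) : ℂ :=
  pd 2 y x - (Complex.I * pd 3 y x + Real.cos (x 2) * y x) / Real.sin (x 2)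

/-- The outgoing derivative `∂_t + N² ∂_r`. -/
noncomputable def outDeriv (M : ℝ) (y : Pt → ℂ) (x : Pt) : ℂ :=
  pd 0 y x + ((x 1 - 2 * M) / x 1 : ℝ) * pd 1 y x

/-- The ingoing derivative `∂_t - N² ∂_r`. -/
noncomputable def inDeriv (M : ℝ) (y : Pt → ℂ) (x : Pt) : ℂ :=
  pd 0 y x - ((x 1 - 2 * M) / x 1 : ℝ) * pd 1 y x

/-- `√2 r ð` on spin weight `0`. -/
noncomputable def ethZero (s : Pt → ℂ) (x : Pt) : ℂ :=
  pd 2 s x + Complex.I * pd 3 s x / Real.sin (x 2)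

/-- The canonical energy density with the volume element, in terms of `y` and `s`. -/
noncomputable def canonForm (M : ℝ) (y s : Pt → ℂ) (x : Pt) : ℝ :=
  Real.sin (x 2) * (1 / (2 * x 1 ^ 2) * ‖dPlus y x‖ ^ 2
    + x 1 / (4 * (x 1 - 2 * M)) * (‖outDeriv M y x‖ ^ 2 + ‖ethZero s x‖ ^ 2))

/-- Pasqualotto's energy density with the volume element, in terms of `y`. -/
noncomputable def pasqForm (M : ℝ) (y : Pt → ℂ) (x : Pt) : ℝ :=
  Real.sin (x 2) * (x 1 / (4 * (x 1 - 2 * M)) * (‖outDeriv M y x‖ ^ 2 + ‖inDeriv M y x‖ ^ 2)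
    + 1 / (4 * x 1 ^ 2) * (‖dPlus y x‖ ^ 2 + ‖dMinus y x‖ ^ 2 + 2 * ‖y x‖ ^ 2))

theorem out_in_norm (M : ℝ) (y : Pt → ℂ) (x : Pt) :
    ‖outDeriv M y x‖ ^ 2 + ‖inDeriv M y x‖ ^ 2 =
      2 * (‖pd 0 y x‖ ^ 2 + ((x 1 - 2 * M) / x 1) ^ 2 * ‖pd 1 y x‖ ^ 2) := by
  have p := parallelogram_law_with_norm ℝ (pd 0 y x) (((x 1 - 2 * M) / x 1 : ℝ) * pd 1 y x)
  rw [norm_mul, Complex.norm_real, Real.norm_eq_abs] at p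
  rw [outDeriv, inDeriv, ← sq_abs ((x 1 - 2 * M) / x 1)]
  linear_combination p

theorem dPlus_dMinus_norm (y : Pt → ℂ) (x : Pt) : ‖dPlus y x‖ ^ 2 + ‖dMinus y x‖ ^ 2 =
    2 * (‖pd 2 y x‖ ^ 2 + ‖Complex.I * pd 3 y x + Real.cos (x 2) * y x‖ ^ 2
      / Real.sin (x 2) ^ 2) := by
  have p := parallelogram_law_with_norm ℝ (pd 2 y x)
    ((Complex.I * pd 3 y x + Real.cos (x 2) * y x) / Real.sin (x 2))
  rw [norm_div, Complex.norm_real, Real.norm_eq_abs] at p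
  rw [dPlus, dMinus, ← sq_abs (Real.sin (x 2)), ← div_pow]
  linear_combination p

theorem ofReal_sq_norm (z : ℂ) : ((‖z‖ : ℝ) : ℂ) ^ 2 = z * star z := by
  rw [Complex.star_def, Complex.mul_conj']

theorem electricDensity_eq {M : ℝ} (hM : 0 < M) (F : Fin 4 → Fin 4 → Pt → ℂ) {x : Pt}
    (hx : x ∈ exterior M) : electricDensity M F x = ‖F 0 1 x‖ ^ 2
      + 1 / (x 1 * (x 1 - 2 * M)) * ‖F 0 2 x‖ ^ 2
      + 1 / (x 1 * (x 1 - 2 * M) * Real.sin (x 2) ^ 2) * ‖F 0 3 x‖ ^ 2 := by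
  have hr : 0 < x 1 := r_pos hM (exterior_subset M hx)
  have hr' : 0 < x 1 - 2 * M := sub_pos.2 hx.1
  have hD := Delta_pos hM (exterior_subset M hx)
  have hq : 0 < √(Delta M x) := Real.sqrt_pos.2 hD
  have hq2 : √(Delta M x) ^ 2 = x 1 * (x 1 - 2 * M) := Real.sq_sqrt hD.le
  have hsin := sin_pos_of_mem hx
  have h2 : √2 ^ 2 = (2 : ℝ) := by norm_num
  have hu : uUp M x = ![x 1 / √(Delta M x), 0, 0, 0] := by
    funext μ
    fin_cases μ <;> simp [uUp, lUp, nUp]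
    field_simp
    rw [h2]; norm_num
  have hE : ∀ μ, electric M F μ x = ((x 1 / √(Delta M x) : ℝ) : ℂ) * F 0 μ x := fun μ => by
    simp [electric, hu, Fin.sum_univ_four]
  have hz : ∀ (a : ℝ) (z : ℂ), ((a : ℂ) * star z * z).re = a * ‖z‖ ^ 2 := fun a z => by
    rw [mul_assoc, mul_comm (star z), ← ofReal_sq_norm]
    norm_cast
  have hn : ∀ μ, ‖electric M F μ x‖ ^ 2 = x 1 / (x 1 - 2 * M) * ‖F 0 μ x‖ ^ 2 := fun μ => by
    rw [hE, norm_mul, Complex.norm_real, Real.norm_eq_abs, mul_pow, sq_abs, div_pow, hq2]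
    field_simp
  simp only [electricDensity, metricInv_apply, Fin.sum_univ_three, Complex.add_re, Fin.succ_inj]
  simp only [Fin.reduceEq, Fin.isValue, if_false, if_true, Complex.ofReal_zero, zero_mul,
    Complex.zero_re, add_zero, zero_add, hz, hn]
  simp only [gInv, Delta, Fin.reduceSucc, Fin.succ_zero_eq_one, Fin.succ_one_eq_two,
    Matrix.cons_val]
  field_simp
  ring

theorem magneticDensity_eq (M : ℝ) (F : Fin 4 → Fin 4 → Pt → ℂ)
    (hF : ∀ μ ν x, F ν μ x = -F μ ν x) (x : Pt) : magneticDensity M F x =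
      gInv M x 1 * gInv M x 2 * ‖F 1 2 x‖ ^ 2 + gInv M x 1 * gInv M x 3 * ‖F 1 3 x‖ ^ 2
      + gInv M x 2 * gInv M x 3 * ‖F 2 3 x‖ ^ 2 := by
  have h0 : ∀ μ, F μ μ x = 0 := fun μ => by
    have := hF μ μ x; linear_combination this / 2
  have hz : ∀ (a b : ℝ) (z : ℂ), ((a : ℂ) * b * star z * z).re = a * b * ‖z‖ ^ 2 := fun a b z => by
    rw [mul_assoc, mul_comm (star z), ← ofReal_sq_norm]
    norm_cast
  simp only [magneticDensity, metricInv_apply, Fin.sum_univ_three, Complex.add_re, Fin.succ_inj]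
  simp only [Fin.reduceEq, Fin.isValue, if_false, if_true, Complex.ofReal_zero, zero_mul, mul_zero,
    Complex.zero_re, add_zero, zero_add, hz]
  simp only [Fin.reduceSucc, Fin.succ_zero_eq_one, Fin.succ_one_eq_two, h0, hF 1 2, hF 1 3, hF 2 3,
    norm_neg, norm_zero]
  ring

/-- The lapse in front of each energy integrand cancels the one in the volume element, so no square
root remains. -/
theorem lapse_mul_sigmaVol {M : ℝ} (hM : 0 < M) {x : Pt} (hx : x ∈ exterior M) (a : ℝ) :
    lapse M x * a * sigmaVol M x = x 1 ^ 2 * Real.sin (x 2) * a := by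
  have hr : 0 < x 1 := r_pos hM (exterior_subset M hx)
  have hq : 0 < √(Delta M x) := Real.sqrt_pos.2 (Delta_pos hM (exterior_subset M hx))
  simp only [sigmaVol, lapse]
  field_simp

section Debye

variable {M : ℝ} {φ f y s : Pt → ℂ}

/-- The Teukolsky equation divided by `r sin θ`. It is the bridge between the two energies: the
ingoing derivative of `y` is the ð'-type derivative of `s`. -/
theorem IsDebye.ethZero_star (h : IsDebye M f y s) (hM : 0 < M) {x : Pt} (hx : x ∈ exterior M) :
    pd 2 s x - Complex.I * pd 3 s x / Real.sin (x 2) = inDeriv M y x := by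
  have e1 : (x 1 : ℂ) ≠ 0 := by exact_mod_cast (r_pos hM (exterior_subset M hx)).ne'
  have e3 : (Real.sin (x 2) : ℂ) ≠ 0 := by exact_mod_cast (sin_pos_of_mem hx).ne'
  have hw := h.wave x hx
  rw [inDeriv]
  push_cast at hw e3 ⊢
  field_simp
  linear_combination -hw

/-- By self-duality the magnetic part equals the electric part, so the density is twice the electric
one. The radial electric component is ð y; the two angular ones are the sum and difference of the
outgoing derivative of `y` and ð s, so the parallelogram law decouples them. -/
theorem IsDebyeOf.canonicalDensity_eq (h : IsDebyeOf M φ f y s) (hM : 0 < M) {x : Pt}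
    (hx : x ∈ exterior M) :
    canonicalDensity M (hertzA M φ) x * sigmaVol M x = canonForm M y s x := by
  have hr : 0 < x 1 := r_pos hM (exterior_subset M hx)
  have hr' : 0 < x 1 - 2 * M := sub_pos.2 hx.1
  have e1 : (x 1 : ℂ) ≠ 0 := by exact_mod_cast hr.ne'
  have e2 : ((x 1 : ℂ) - 2 * M) ≠ 0 := by exact_mod_cast hr'.ne'
  have hsin := sin_pos_of_mem hx
  have e3 : (Real.sin (x 2) : ℂ) ≠ 0 := by exact_mod_cast hsin.ne'
  obtain ⟨d1, d2, d3⟩ := h.duality hM hx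
  obtain ⟨f1, f2, f3, -, -, f6⟩ := h.fieldStrength_eq hM hx
  set F := fieldStrength (hertzA M φ) with hFdef
  have n1 : ‖F 2 3 x‖ ^ 2 = (Real.sin (x 2) * x 1 ^ 2) ^ 2 * ‖F 0 1 x‖ ^ 2 := by
    rw [d1]; simp [abs_of_pos hr, abs_of_pos hsin, -Complex.ofReal_sin]; ring
  have n2 : (x 1 - 2 * M) ^ 2 * ‖F 1 3 x‖ ^ 2 = (Real.sin (x 2) * x 1) ^ 2 * ‖F 0 2 x‖ ^ 2 := by
    have := congrArg (fun z => ‖z‖ ^ 2) d2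
    simp only [norm_mul, mul_pow, Complex.norm_I, Complex.norm_real, Real.norm_eq_abs, sq_abs,
      one_mul] at this
    rw [show (x 1 : ℂ) - 2 * M = ((x 1 - 2 * M : ℝ) : ℂ) by push_cast; ring, Complex.norm_real,
      Real.norm_eq_abs, sq_abs] at this
    linear_combination this
  have n3 : (Real.sin (x 2) * (x 1 - 2 * M)) ^ 2 * ‖F 1 2 x‖ ^ 2 = x 1 ^ 2 * ‖F 0 3 x‖ ^ 2 := by
    have := congrArg (fun z => ‖z‖ ^ 2) d3
    simp only [norm_mul, mul_pow, Complex.norm_I, Complex.norm_real, Real.norm_eq_abs, sq_abs,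
      one_mul] at this
    rw [show (x 1 : ℂ) - 2 * M = ((x 1 - 2 * M : ℝ) : ℂ) by push_cast; ring, Complex.norm_real,
      Real.norm_eq_abs, sq_abs] at this
    linear_combination this
  replace n2 : ‖F 1 3 x‖ ^ 2 = (Real.sin (x 2) * x 1) ^ 2 / (x 1 - 2 * M) ^ 2 * ‖F 0 2 x‖ ^ 2 := by
    field_simp; linear_combination n2
  replace n3 : ‖F 1 2 x‖ ^ 2 = x 1 ^ 2 / (Real.sin (x 2) * (x 1 - 2 * M)) ^ 2 * ‖F 0 3 x‖ ^ 2 := by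
    field_simp; linear_combination n3
  rw [canonicalDensity, lapse_mul_sigmaVol hM hx, electricDensity_eq hM _ hx,
    magneticDensity_eq _ _ (fieldStrength_swap _), ← hFdef, n1, n2, n3]
  simp only [gInv, Delta, Matrix.cons_val]
  have g1 : F 0 1 x = (((2 * x 1 ^ 2)⁻¹ : ℝ) : ℂ) * dPlus y x := by
    have h23 : F 2 3 x = -(1 / 2) * Complex.I * (Real.sin (x 2) * dPlus y x) := by
      have : Real.sin (x 2) * dPlus y x = Real.sin (x 2) * pd 2 y x +
          (Complex.I * pd 3 y x + Real.cos (x 2) * y x) := by rw [dPlus]; field_simp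
      rw [f6, this]
      linear_combination (1 / 2) * pd 3 y x * Complex.I_sq
    have hS : (Complex.I * Real.sin (x 2)) ≠ 0 := mul_ne_zero Complex.I_ne_zero e3
    have : F 0 1 x * (2 * x 1 ^ 2) = dPlus y x :=
      mul_left_cancel₀ hS (by linear_combination 2 * d1 - 2 * h23)
    rw [← this]
    push_cast
    field_simp
  have g2 : F 0 2 x = ((-(1 / 4) : ℝ) : ℂ) * (outDeriv M y x - ethZero s x) := by
    have hw := h.ethZero_star hM hx
    rw [f2]
    simp only [outDeriv, inDeriv, ethZero] at hw ⊢
    push_cast at hw ⊢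
    linear_combination (1 / 4) * hw
  have g3 : F 0 3 x = ((-(1 / 4) * Real.sin (x 2) : ℝ) : ℂ) * (Complex.I *
      (outDeriv M y x + ethZero s x)) := by
    have hw := h.ethZero_star hM hx
    -- Writing the ϕ-derivative as a multiple of `sin θ` keeps the algebra free of inverse sines.
    obtain ⟨a, ha⟩ : ∃ a, pd 3 s x = Real.sin (x 2) * a := ⟨pd 3 s x / Real.sin (x 2), by field_simp⟩
    rw [f3]
    simp only [outDeriv, inDeriv, ethZero] at hw ⊢
    rw [ha, mul_left_comm Complex.I (Real.sin (x 2) : ℂ) a, mul_div_cancel_left₀ _ e3] at hw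
    rw [ha, mul_left_comm Complex.I (Real.sin (x 2) : ℂ) a, mul_div_cancel_left₀ _ e3]
    push_cast at hw ⊢
    linear_combination (1 / 4) * Complex.I * Complex.sin (x 2) * hw
      + (1 / 2) * Complex.sin (x 2) * a * Complex.I_sq
  have n4 : ‖F 0 1 x‖ ^ 2 = ((2 * x 1 ^ 2)⁻¹) ^ 2 * ‖dPlus y x‖ ^ 2 := by
    rw [g1, norm_mul, mul_pow, Complex.norm_real, Real.norm_eq_abs, sq_abs]
  have n5 : ‖F 0 2 x‖ ^ 2 + ‖F 0 3 x‖ ^ 2 / Real.sin (x 2) ^ 2 =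
      1 / 8 * (‖outDeriv M y x‖ ^ 2 + ‖ethZero s x‖ ^ 2) := by
    have p := parallelogram_law_with_norm ℝ (outDeriv M y x) (ethZero s x)
    rw [g2, g3]
    simp only [norm_mul, Complex.norm_I, Complex.norm_real, mul_pow, Real.norm_eq_abs, sq_abs]
    field_simp
    linear_combination 8 * p
  rw [n4, canonForm]
  have n6 : ‖F 0 3 x‖ ^ 2 = Real.sin (x 2) ^ 2 * (1 / 8 * (‖outDeriv M y x‖ ^ 2 + ‖ethZero s x‖ ^ 2) -
    ‖F 0 2 x‖ ^ 2) := by rw [← n5]; field_simp; ring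
  rw [n6]
  field_simp
  ring

/-- In D_r - 2ρ the term -2ρ compensates the derivative of `1 / r` in `χ`, leaving a pure
r-derivative of `y`. Only smoothness of `y` and its relation to `χ` are used, so the identity serves
both Hertz potentials and Maxwell fields. -/
theorem pasqScalarDensity_eq (hM : 0 < M) {χ : Pt → ℂ} (hy : SmoothExt M y)
    (hχ : ∀ x ∈ exterior M, χ x = ((√2 * x 1 : ℝ) : ℂ)⁻¹ * y x) {x : Pt} (hx : x ∈ exterior M) :
    pasqScalarDensity M χ x * sigmaVol M x = pasqForm M y x := by
  have hr : 0 < x 1 := r_pos hM (exterior_subset M hx)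
  have hr' : 0 < x 1 - 2 * M := sub_pos.2 hx.1
  have hD := Delta_pos hM (exterior_subset M hx)
  have hq : 0 < √(Delta M x) := Real.sqrt_pos.2 hD
  have hq2 : √(Delta M x) ^ 2 = x 1 * (x 1 - 2 * M) := Real.sq_sqrt hD.le
  have hsin := sin_pos_of_mem hx
  have h2 : √2 ^ 2 = (2 : ℝ) := by norm_num
  have h20 : √2 ≠ 0 := by norm_num
  have e1 : (x 1 : ℂ) ≠ 0 := by exact_mod_cast hr.ne'
  have e2 : ((x 1 : ℂ) - 2 * M) ≠ 0 := by exact_mod_cast hr'.ne'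
  have e3 : (Real.sin (x 2) : ℂ) ≠ 0 := by exact_mod_cast hsin.ne'
  have e4 : (√2 : ℂ) ≠ 0 := by exact_mod_cast h20
  have e5 : (√(Delta M x) : ℂ) ≠ 0 := by exact_mod_cast hq.ne'
  have e6 : (√(Delta M x) : ℂ) ^ 2 = x 1 * (x 1 - 2 * M) := by exact_mod_cast hq2
  have e7 : (√2 : ℂ) ^ 2 = 2 := by exact_mod_cast h2
  have hyd := (hy x (exterior_subset M hx)).diffAt
  have hc1 : HasDerivAt (fun r : ℝ => (√2 * r)⁻¹) (-(√2) / (√2 * x 1) ^ 2) (x 1) := by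
    have : HasDerivAt (fun r : ℝ => √2 * r) (√2) (x 1) := by
      simpa using (hasDerivAt_id' (x 1)).const_mul (√2)
    exact this.inv (by positivity)
  have hp : ∀ μ, pd μ χ x = (if μ = 1 then ((-(√2) / (√2 * x 1) ^ 2 : ℝ) : ℂ) * y x else 0)
      + (((√2 * x 1)⁻¹ : ℝ) : ℂ) * pd μ y x := fun μ =>
    (pd_congr_exterior (g := fun x => (((√2 * x 1)⁻¹ : ℝ) : ℂ) * y x)
      (fun z hz => by rw [hχ z hz]; push_cast; rfl) hx μ).trans (pd_coord_mul hc1 hyd μ)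
  have t1 : npD M χ x + npD' M χ x = ((1 / √(Delta M x) : ℝ) : ℂ) * pd 0 y x := by
    rw [npD_eq, npD'_eq, hp, hp]
    simp only [Fin.reduceEq, if_false, if_true]
    push_cast
    field_simp
    simp only [e7]
    ring
  have t2 : npD M χ x - npD' M χ x - 2 * (rho M x : ℂ) * χ x =
      ((√(Delta M x) / x 1 ^ 2 : ℝ) : ℂ) * pd 1 y x := by
    rw [npD_eq, npD'_eq, hp, hp, hχ x hx, rho]
    simp only [Fin.reduceEq, if_false, if_true]
    push_cast
    field_simp
    simp only [e7]
    ring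
  have t3 : eth (-1) 1 χ x = (((2 * x 1 ^ 2)⁻¹ : ℝ) : ℂ) * dPlus y x := by
    rw [eth, npDelta_eq, hp, hp, hχ x hx, dPlus, beta]
    simp only [Fin.reduceEq, if_false]
    push_cast at e3 ⊢
    field_simp
    simp only [e7]
    ring
  have t4 : eth' (-1) 1 χ x = (((2 * x 1 ^ 2)⁻¹ : ℝ) : ℂ) * dMinus y x := by
    rw [eth', npDelta'_eq, hp, hp, hχ x hx, dMinus, beta]
    simp only [Fin.reduceEq, if_false]
    push_cast at e3 ⊢
    field_simp
    simp only [e7]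
    ring
  have t5 : ‖χ x‖ ^ 2 = 1 / (2 * x 1 ^ 2) * ‖y x‖ ^ 2 := by
    rw [hχ x hx, norm_mul, norm_inv, Complex.norm_real, Real.norm_eq_abs, mul_pow, inv_pow, sq_abs,
      mul_pow, h2, one_div]
  rw [pasqScalarDensity, lapse_mul_sigmaVol hM hx, t1, t2, t3, t4, t5, pasqForm,
    out_in_norm M y x]
  simp only [norm_mul, mul_pow, Complex.norm_real, Real.norm_eq_abs, sq_abs, div_pow, hq2]
  field_simp
  ring

end Debye

end SchwarzschildEM

namespace SchwarzschildEM

/-! ### Integration by parts on the spheres -/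

/-- The ranges of `(θ, ϕ)`. -/
def angleBox : Set (ℝ × ℝ) := Ioo 0 Real.pi ×ˢ Ioo 0 (2 * Real.pi)

theorem measurableSet_angleBox : MeasurableSet angleBox := measurableSet_Ioo.prod measurableSet_Ioo

theorem measurableSet_sigmaRegion (M : ℝ) : MeasurableSet (sigmaRegion M) :=
  measurableSet_Ioi.prod measurableSet_angleBox

theorem sigmaPt_mem {M : ℝ} {p : ℝ × ℝ × ℝ} (hp : p ∈ sigmaRegion M) : sigmaPt p ∈ exterior M :=
  ⟨hp.1, hp.2.1.1, hp.2.1.2⟩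

theorem continuous_sigmaPt : Continuous sigmaPt := by
  refine continuous_pi fun μ => ?_
  fin_cases μ <;> simp only [sigmaPt, Fin.zero_eta, Fin.mk_one, Fin.reduceFinMk, Matrix.cons_val] <;>
    fun_prop

/-- The inclusion of the angular directions. -/
noncomputable def angleIncl : ℝ × ℝ →L[ℝ] Pt :=
  (ContinuousLinearMap.fst ℝ ℝ ℝ).smulRight (Pi.single 2 1) +
    (ContinuousLinearMap.snd ℝ ℝ ℝ).smulRight (Pi.single 3 1)

theorem sigmaPt_eq (r : ℝ) (q : ℝ × ℝ) : sigmaPt (r, q) = Pi.single 1 r + angleIncl q := by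
  funext μ
  fin_cases μ <;> simp [sigmaPt, angleIncl]

theorem hasFDerivAt_angle {f : Pt → ℝ} {r : ℝ} {q : ℝ × ℝ}
    (hf : DifferentiableAt ℝ f (sigmaPt (r, q))) :
    HasFDerivAt (fun q => f (sigmaPt (r, q))) ((fderiv ℝ f (sigmaPt (r, q))).comp angleIncl) q := by
  have h : HasFDerivAt (fun q => sigmaPt (r, q)) angleIncl q := by
    simp only [sigmaPt_eq]
    exact angleIncl.hasFDerivAt.const_add _
  exact hf.hasFDerivAt.comp q h

/-- The divergence theorem on a sphere, in the chart `(θ, ϕ)`. -/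
theorem integral_sphere_divergence {M : ℝ} {b c : Pt → ℝ}
    (hb : ∀ x ∈ extChart M, ContDiffAt ℝ ∞ b x) (hc : ∀ x ∈ extChart M, ContDiffAt ℝ ∞ c x)
    (hb0 : ∀ x ∈ extChart M, Real.sin (x 2) = 0 → b x = 0)
    (hcp : ∀ x, c (x + Pi.single 3 (2 * Real.pi)) = c x) {r : ℝ} (hr : 2 * M < r) :
    IntegrableOn (fun q => pd 2 b (sigmaPt (r, q)) - pd 3 c (sigmaPt (r, q))) angleBox ∧
    ∫ q in angleBox, (pd 2 b (sigmaPt (r, q)) - pd 3 c (sigmaPt (r, q))) = 0 := by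
  have hmem : ∀ q, sigmaPt (r, q) ∈ extChart M := fun q => hr
  have hcont : Continuous fun q : ℝ × ℝ => sigmaPt (r, q) :=
    continuous_sigmaPt.comp (by fun_prop)
  have cb : Continuous fun q => b (sigmaPt (r, q)) := continuous_iff_continuousAt.2 fun q =>
    ContinuousAt.comp (f := fun q => sigmaPt (r, q)) (hb _ (hmem q)).continuousAt hcont.continuousAt
  have cc : Continuous fun q => c (sigmaPt (r, q)) := continuous_iff_continuousAt.2 fun q =>
    ContinuousAt.comp (f := fun q => sigmaPt (r, q)) (hc _ (hmem q)).continuousAt hcont.continuousAt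
  have cD : Continuous fun q => pd 2 b (sigmaPt (r, q)) - pd 3 c (sigmaPt (r, q)) :=
    continuous_iff_continuousAt.2 fun q =>
      (ContinuousAt.comp (f := fun q => sigmaPt (r, q)) (contDiffAt_pd (hb _ (hmem q)) 2).continuousAt
        hcont.continuousAt).sub
      (ContinuousAt.comp (f := fun q => sigmaPt (r, q)) (contDiffAt_pd (hc _ (hmem q)) 3).continuousAt
        hcont.continuousAt)
  have hset : angleBox =ᵐ[volume] Icc ((0 : ℝ), (0 : ℝ)) (Real.pi, 2 * Real.pi) := by
    rw [← Icc_prod_Icc, Measure.volume_eq_prod]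
    exact Measure.set_prod_ae_eq Ioo_ae_eq_Icc Ioo_ae_eq_Icc
  have hint : IntegrableOn (fun q => pd 2 b (sigmaPt (r, q)) - pd 3 c (sigmaPt (r, q)))
      (Icc ((0 : ℝ), (0 : ℝ)) (Real.pi, 2 * Real.pi)) := cD.continuousOn.integrableOn_compact isCompact_Icc
  refine ⟨hint.congr_set_ae hset, ?_⟩
  rw [setIntegral_congr_set hset]
  have key := integral_divergence_prod_Icc_of_hasFDerivAt_off_countable_of_le
    (fun q => b (sigmaPt (r, q))) (fun q => -c (sigmaPt (r, q)))
    (fun q => (fderiv ℝ b (sigmaPt (r, q))).comp angleIncl)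
    (fun q => -(fderiv ℝ c (sigmaPt (r, q))).comp angleIncl)
    ((0 : ℝ), (0 : ℝ)) (Real.pi, 2 * Real.pi) ⟨Real.pi_pos.le, by positivity⟩ ∅ countable_empty
    cb.continuousOn cc.neg.continuousOn
    (fun q _ => hasFDerivAt_angle (hb _ (hmem q)).diffAt)
    (fun q _ => (hasFDerivAt_angle (hc _ (hmem q)).diffAt).neg)
  have e : (fun q : ℝ × ℝ => ((fderiv ℝ b (sigmaPt (r, q))).comp angleIncl) (1, 0) +
      (-(fderiv ℝ c (sigmaPt (r, q))).comp angleIncl) (0, 1)) =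
      fun q => pd 2 b (sigmaPt (r, q)) - pd 3 c (sigmaPt (r, q)) := by
    funext q
    simp [angleIncl, pd, sub_eq_add_neg]
  rw [e] at key
  rw [key hint]
  -- Of the four edges of the rectangle, ϕ = 0 and ϕ = 2π cancel by periodicity, and θ = 0 and θ = π
  -- are the poles, where `b` vanishes.
  have h1 : ∀ θ, c (sigmaPt (r, θ, 2 * Real.pi)) = c (sigmaPt (r, θ, 0)) := fun θ => by
    rw [← hcp (sigmaPt (r, θ, 0))]
    congr 1
    funext μ
    fin_cases μ <;> simp [sigmaPt]
  have h2 : ∀ ϕ, b (sigmaPt (r, Real.pi, ϕ)) = 0 := fun ϕ => hb0 _ (hmem _) (by simp [sigmaPt])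
  have h3 : ∀ ϕ, b (sigmaPt (r, 0, ϕ)) = 0 := fun ϕ => hb0 _ (hmem _) (by simp [sigmaPt])
  simp only [h1, h2, h3]
  simp

/-- If the difference is integrable, then `f` and `g` are integrable together or not at all; in the
second case both extended integrals are infinite. No integrability of either density on a single
sphere has to be known beforehand. -/
theorem lintegral_eq_of_integral_sub_eq_zero {α : Type*} [MeasurableSpace α] {μ : Measure α}
    {f g : α → ℝ} (hf : 0 ≤ᵐ[μ] f) (hg : 0 ≤ᵐ[μ] g) (hfm : AEStronglyMeasurable f μ)
    (hgm : AEStronglyMeasurable g μ) (hi : Integrable (fun a => f a - g a) μ)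
    (h0 : ∫ a, (f a - g a) ∂μ = 0) :
    ∫⁻ a, ENNReal.ofReal (f a) ∂μ = ∫⁻ a, ENNReal.ofReal (g a) ∂μ := by
  by_cases hgi : Integrable g μ
  · have hfi : Integrable f μ := by
      have := hi.add hgi
      exact this.congr (Filter.Eventually.of_forall fun a => by simp)
    rw [← ofReal_integral_eq_lintegral_ofReal hfi hf, ← ofReal_integral_eq_lintegral_ofReal hgi hg]
    rw [integral_sub hfi hgi] at h0
    rw [sub_eq_zero.1 h0]
  · have hfi : ¬ Integrable f μ := fun hfi => hgi <| by
      have := hfi.sub hi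
      exact this.congr (Filter.Eventually.of_forall fun a => by simp)
    have top : ∀ {k : α → ℝ}, 0 ≤ᵐ[μ] k → AEStronglyMeasurable k μ → ¬ Integrable k μ →
        ∫⁻ a, ENNReal.ofReal (k a) ∂μ = ⊤ := fun {k} hk hkm hki => by
      by_contra h
      exact hki ⟨hkm, (hasFiniteIntegral_iff_ofReal hk).2 (lt_top_iff_ne_top.2 h)⟩
    rw [top hf hfm hfi, top hg hgm hgi]

theorem integrable_iff_and_integral_eq_of_lintegral_eq {α : Type*} [MeasurableSpace α]
    {μ : Measure α} {f g : α → ℝ} (hf : 0 ≤ᵐ[μ] f) (hg : 0 ≤ᵐ[μ] g)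
    (hfm : AEStronglyMeasurable f μ) (hgm : AEStronglyMeasurable g μ)
    (h : ∫⁻ a, ENNReal.ofReal (f a) ∂μ = ∫⁻ a, ENNReal.ofReal (g a) ∂μ) :
    (Integrable f μ ↔ Integrable g μ) ∧ ∫ a, f a ∂μ = ∫ a, g a ∂μ := by
  refine ⟨⟨fun hi => ⟨hgm, ?_⟩, fun hi => ⟨hfm, ?_⟩⟩, ?_⟩
  · rw [hasFiniteIntegral_iff_ofReal hg, ← h]
    exact (hasFiniteIntegral_iff_ofReal hf).1 hi.2
  · rw [hasFiniteIntegral_iff_ofReal hf, h]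
    exact (hasFiniteIntegral_iff_ofReal hg).1 hi.2
  · rw [integral_eq_lintegral_of_nonneg_ae hf hfm, integral_eq_lintegral_of_nonneg_ae hg hgm, h]

theorem continuousOn_sigma {M : ℝ} {F : Pt → ℝ} (hF : ∀ x ∈ exterior M, ContinuousAt F x) :
    ContinuousOn (fun p => F (sigmaPt p)) (sigmaRegion M) := fun _ hp =>
  (ContinuousAt.comp (f := sigmaPt) (hF _ (sigmaPt_mem hp))
    continuous_sigmaPt.continuousAt).continuousWithinAt

theorem volume_sigmaRegion (M : ℝ) : (volume : Measure (ℝ × ℝ × ℝ)).restrict (sigmaRegion M) =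
    (volume.restrict (Ioi (2 * M))).prod (volume.restrict angleBox) := by
  rw [Measure.prod_restrict]; rfl

/-- Two non-negative densities on `Σ` that differ by a divergence on the spheres have the same
integral. -/
theorem sigma_integral_eq_of_divergence {M : ℝ} {F G b c : Pt → ℝ}
    (hF : ∀ x ∈ exterior M, ContinuousAt F x) (hG : ∀ x ∈ exterior M, ContinuousAt G x)
    (hF0 : ∀ x ∈ exterior M, 0 ≤ F x) (hG0 : ∀ x ∈ exterior M, 0 ≤ G x)
    (hb : ∀ x ∈ extChart M, ContDiffAt ℝ ∞ b x) (hc : ∀ x ∈ extChart M, ContDiffAt ℝ ∞ c x)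
    (hb0 : ∀ x ∈ extChart M, Real.sin (x 2) = 0 → b x = 0)
    (hcp : ∀ x, c (x + Pi.single 3 (2 * Real.pi)) = c x)
    (h : ∀ x ∈ exterior M, F x - G x = pd 2 b x - pd 3 c x) :
    (IntegrableOn (fun p => F (sigmaPt p)) (sigmaRegion M) ↔
      IntegrableOn (fun p => G (sigmaPt p)) (sigmaRegion M)) ∧
    ∫ p in sigmaRegion M, F (sigmaPt p) = ∫ p in sigmaRegion M, G (sigmaPt p) := by
  have mR := measurableSet_sigmaRegion M
  have hFm := (continuousOn_sigma hF).aestronglyMeasurable (μ := volume) mR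
  have hGm := (continuousOn_sigma hG).aestronglyMeasurable (μ := volume) mR
  have hFn : 0 ≤ᵐ[volume.restrict (sigmaRegion M)] fun p => F (sigmaPt p) :=
    ae_restrict_of_forall_mem mR fun p hp => hF0 _ (sigmaPt_mem hp)
  have hGn : 0 ≤ᵐ[volume.restrict (sigmaRegion M)] fun p => G (sigmaPt p) :=
    ae_restrict_of_forall_mem mR fun p hp => hG0 _ (sigmaPt_mem hp)
  refine integrable_iff_and_integral_eq_of_lintegral_eq hFn hGn hFm hGm ?_
  have hFm' := hFm.aemeasurable.ennreal_ofReal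
  have hGm' := hGm.aemeasurable.ennreal_ofReal
  rw [volume_sigmaRegion] at hFm' hGm' ⊢
  rw [lintegral_prod _ hFm', lintegral_prod _ hGm']
  -- Tonelli needs no finiteness; it remains to compare the two integrals on each sphere of radius
  -- `r > 2M`.
  refine lintegral_congr_ae (ae_restrict_of_forall_mem measurableSet_Ioi fun r hr => ?_)
  have hmem : ∀ q ∈ angleBox, (r, q) ∈ sigmaRegion M := fun q hq => ⟨hr, hq⟩
  have hslice : ContinuousOn (fun q : ℝ × ℝ => (r, q)) angleBox := by fun_prop
  have hmemx : ∀ q ∈ angleBox, sigmaPt (r, q) ∈ exterior M := fun q hq => sigmaPt_mem (hmem q hq)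
  obtain ⟨hi, h0⟩ := integral_sphere_divergence hb hc hb0 hcp hr
  have e : ∀ q ∈ angleBox, F (sigmaPt (r, q)) - G (sigmaPt (r, q)) =
      pd 2 b (sigmaPt (r, q)) - pd 3 c (sigmaPt (r, q)) := fun q hq => h _ (hmemx q hq)
  exact lintegral_eq_of_integral_sub_eq_zero
    (ae_restrict_of_forall_mem measurableSet_angleBox fun q hq => hF0 _ (hmemx q hq))
    (ae_restrict_of_forall_mem measurableSet_angleBox fun q hq => hG0 _ (hmemx q hq))
    (((continuousOn_sigma hF).comp hslice hmem).aestronglyMeasurable measurableSet_angleBox)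
    (((continuousOn_sigma hG).comp hslice hmem).aestronglyMeasurable measurableSet_angleBox)
    (hi.congr_fun (fun q hq => (e q hq).symm) measurableSet_angleBox)
    ((setIntegral_congr_fun measurableSet_angleBox e).trans h0)

/-! ### Comparison of the two energies -/

/-- The `θ`-component of the boundary term relating the two energies. -/
noncomputable def bdryTheta (M : ℝ) (y s : Pt → ℂ) (x : Pt) : ℂ :=
  ((x 1 / (2 * (x 1 - 2 * M)) : ℝ) : ℂ) * (s x * star (pd 3 s x)) +
    ((1 / (2 * x 1 ^ 2) : ℝ) : ℂ) * (y x * star (pd 3 y x)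
      + Complex.I * (Real.cos (x 2) * (y x * star (y x))))

/-- The `ϕ`-component of the boundary term relating the two energies. -/
noncomputable def bdryPhi (M : ℝ) (y s : Pt → ℂ) (x : Pt) : ℂ :=
  ((x 1 / (2 * (x 1 - 2 * M)) : ℝ) : ℂ) * (s x * star (pd 2 s x)) +
    ((1 / (2 * x 1 ^ 2) : ℝ) : ℂ) * (y x * star (pd 2 y x))

theorem contDiffAt_star {f : Pt → ℂ} {x : Pt} (hf : ContDiffAt ℝ ∞ f x) :
    ContDiffAt ℝ ∞ (fun y => star (f y)) x :=
  (Complex.conjCLE : ℂ →L[ℝ] ℂ).contDiff.contDiffAt.comp x hf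

theorem norm_sq_sub (a b : ℂ) : ‖a + b‖ ^ 2 - ‖a - b‖ ^ 2 = 4 * (a * star b).re := by
  simp only [Complex.sq_norm, Complex.normSq_apply, Complex.add_re, Complex.add_im, Complex.sub_re,
    Complex.sub_im, Complex.mul_re, Complex.star_def, Complex.conj_re, Complex.conj_im]
  ring

section Debye

variable {M : ℝ} {f y s : Pt → ℂ}

theorem contDiffAt_quot₁ {r : ℝ} (hr : 2 * M < r) :
    ContDiffAt ℝ ∞ (fun r : ℝ => r / (2 * (r - 2 * M))) r := by
  have h2 : ContDiffAt ℝ ∞ (fun r : ℝ => 2 * (r - 2 * M)) r := by fun_prop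
  exact contDiffAt_id.div h2 (by linarith)

theorem contDiffAt_quot₂ (hM : 0 < M) {r : ℝ} (hr : 2 * M < r) :
    ContDiffAt ℝ ∞ (fun r : ℝ => 1 / (2 * r ^ 2)) r := by
  have h2 : ContDiffAt ℝ ∞ (fun r : ℝ => 2 * r ^ 2) r := by fun_prop
  have : 0 < r := by linarith
  exact contDiffAt_const.div h2 (by positivity)

theorem IsDebye.contDiffAt_bdry (h : IsDebye M f y s) (hM : 0 < M) {x : Pt} (hx : x ∈ extChart M) :
    ContDiffAt ℝ ∞ (bdryTheta M y s) x ∧ ContDiffAt ℝ ∞ (bdryPhi M y s) x := by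
  have hy := h.smooth_y x hx
  have hs := h.smooth_s x hx
  have c1 := SmoothExt.radial (fun _ => contDiffAt_quot₁ (M := M)) x hx
  have c2 := SmoothExt.radial (fun _ => contDiffAt_quot₂ hM) x hx
  have c3 := (contDiff_coord_ofReal Real.contDiff_cos 2).contDiffAt (x := x)
  exact ⟨(c1.mul (hs.mul (contDiffAt_star (contDiffAt_pd hs 3)))).add
      (c2.mul ((hy.mul (contDiffAt_star (contDiffAt_pd hy 3))).add
        (contDiffAt_const.mul (c3.mul (hy.mul (contDiffAt_star hy)))))),
    (c1.mul (hs.mul (contDiffAt_star (contDiffAt_pd hs 2)))).add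
      (c2.mul (hy.mul (contDiffAt_star (contDiffAt_pd hy 2))))⟩

/-- The differences |a + u|² - |a - u|² = 4 Re(a ū) produce the Jacobians Im(∂_θ y ∂_ϕ ȳ) and Im(∂_θ
s ∂_ϕ s̄), which are exact. The remaining ½ cos θ ∂_θ|y|² is completed to ½ ∂_θ(cos θ |y|²)
precisely by the zeroth-order term of `pasqForm`. -/
theorem IsDebye.canonForm_sub_pasqForm (h : IsDebye M f y s) (hM : 0 < M) {x : Pt}
    (hx : x ∈ exterior M) : canonForm M y s x - pasqForm M y x =
      (pd 2 (bdryTheta M y s) x - pd 3 (bdryPhi M y s) x).im := by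
  have hr : 0 < x 1 := r_pos hM (exterior_subset M hx)
  have hr' : 0 < x 1 - 2 * M := sub_pos.2 hx.1
  have hsin := sin_pos_of_mem hx
  have e3 : (Real.sin (x 2) : ℂ) ≠ 0 := by exact_mod_cast hsin.ne'
  have hy := h.smooth_y x (exterior_subset M hx)
  have hs := h.smooth_s x (exterior_subset M hx)
  have dy := hy.diffAt
  have ds := hs.diffAt
  have dy' : ∀ μ, DifferentiableAt ℝ (pd μ y) x := fun μ => (contDiffAt_pd hy μ).diffAt
  have ds' : ∀ μ, DifferentiableAt ℝ (pd μ s) x := fun μ => (contDiffAt_pd hs μ).diffAt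
  have sdy : DifferentiableAt ℝ (fun x => star (y x)) x := (contDiffAt_star hy).diffAt
  have sdy' : ∀ μ, DifferentiableAt ℝ (fun x => star (pd μ y x)) x := fun μ =>
    (contDiffAt_star (contDiffAt_pd hy μ)).diffAt
  have sds' : ∀ μ, DifferentiableAt ℝ (fun x => star (pd μ s x)) x := fun μ =>
    (contDiffAt_star (contDiffAt_pd hs μ)).diffAt
  have c1 : DifferentiableAt ℝ (fun r : ℝ => r / (2 * (r - 2 * M))) (x 1) :=
    (contDiffAt_quot₁ hx.1).diffAt
  have c2 : DifferentiableAt ℝ (fun r : ℝ => 1 / (2 * r ^ 2)) (x 1) :=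
    (contDiffAt_quot₂ hM hx.1).diffAt
  have dcos : DifferentiableAt ℝ (fun x : Pt => (Real.cos (x 2) : ℂ)) x :=
    diff_cast_coord Real.differentiable_cos.differentiableAt
  have p2 : pd 2 (bdryTheta M y s) x =
      ((x 1 / (2 * (x 1 - 2 * M)) : ℝ) : ℂ) *
        (pd 2 s x * star (pd 3 s x) + s x * star (pd 2 (pd 3 s) x)) +
      ((1 / (2 * x 1 ^ 2) : ℝ) : ℂ) * (pd 2 y x * star (pd 3 y x) + y x * star (pd 2 (pd 3 y) x)
      + Complex.I * (((-Real.sin (x 2) : ℝ) : ℂ) * (y x * star (y x))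
        + Real.cos (x 2) * (pd 2 y x * star (y x) + y x * star (pd 2 y x)))) := by
    have a1 := ds.fun_mul (sds' 3)
    have a2 := dy.fun_mul (sdy' 3)
    have a3 := dcos.fun_mul (dy.fun_mul sdy)
    refine (pd_add ((diff_cast_coord c1).fun_mul a1)
      ((diff_cast_coord c2).fun_mul (a2.fun_add (a3.const_mul _))) 2).trans ?_
    rw [pd_coord_mul_of_ne c1 a1 (by decide), pd_coord_mul_of_ne c2 (a2.fun_add (a3.const_mul _))
      (by decide), pd_add a2 (a3.const_mul _), pd_const_mul _ a3,
      pd_coord_mul (Real.hasDerivAt_cos _) (dy.fun_mul sdy), pd_mul ds (sds' 3),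
      pd_mul dy (sdy' 3), pd_mul dy sdy, pd_star (ds' 3), pd_star (dy' 3), pd_star dy, if_pos rfl]
  have p3 : pd 3 (bdryPhi M y s) x =
      ((x 1 / (2 * (x 1 - 2 * M)) : ℝ) : ℂ) *
        (pd 3 s x * star (pd 2 s x) + s x * star (pd 2 (pd 3 s) x)) +
      ((1 / (2 * x 1 ^ 2) : ℝ) : ℂ) *
        (pd 3 y x * star (pd 2 y x) + y x * star (pd 2 (pd 3 y) x)) := by
    have a1 := ds.fun_mul (sds' 2)
    have a2 := dy.fun_mul (sdy' 2)
    refine (pd_add ((diff_cast_coord c1).fun_mul a1) ((diff_cast_coord c2).fun_mul a2) 3).trans ?_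
    rw [pd_coord_mul_of_ne c1 a1 (by decide), pd_coord_mul_of_ne c2 a2 (by decide),
      pd_mul ds (sds' 2), pd_mul dy (sdy' 2), pd_star (ds' 2), pd_star (dy' 2),
      pd_comm hs 2 3, pd_comm hy 2 3]
  -- With `u` and `v` the four angular derivatives take the form a ± u and a ± v, and multiplying by
  -- `sin θ` later removes the quotients.
  obtain ⟨u, hu⟩ : ∃ u, Complex.I * pd 3 y x + Real.cos (x 2) * y x = Real.sin (x 2) * u :=
    ⟨(Complex.I * pd 3 y x + Real.cos (x 2) * y x) / Real.sin (x 2), by field_simp⟩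
  obtain ⟨v, hv⟩ : ∃ v, Complex.I * pd 3 s x = Real.sin (x 2) * v :=
    ⟨Complex.I * pd 3 s x / Real.sin (x 2), by field_simp⟩
  have n1 := norm_sq_sub (pd 2 y x) u
  have n2 := norm_sq_sub (pd 2 s x) v
  have m1 : Real.sin (x 2) * (pd 2 y x * star u).re =
      (pd 2 y x * star (Complex.I * pd 3 y x + Real.cos (x 2) * y x)).re := by
    rw [hu, star_mul', mul_left_comm, Complex.star_def, Complex.conj_ofReal, Complex.re_ofReal_mul]
  have m2 : Real.sin (x 2) * (pd 2 s x * star v).re =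
      (pd 2 s x * star (Complex.I * pd 3 s x)).re := by
    rw [hv, star_mul', mul_left_comm, Complex.star_def, Complex.conj_ofReal, Complex.re_ofReal_mul]
  have hin : inDeriv M y x = pd 2 s x - v := by
    rw [← h.ethZero_star hM hx, hv, mul_div_cancel_left₀ _ e3]
  have hdP : dPlus y x = pd 2 y x + u := by rw [dPlus, hu, mul_div_cancel_left₀ _ e3]
  have hdM : dMinus y x = pd 2 y x - u := by rw [dMinus, hu, mul_div_cancel_left₀ _ e3]
  have hez : ethZero s x = pd 2 s x + v := by rw [ethZero, hv, mul_div_cancel_left₀ _ e3]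
  have key : canonForm M y s x - pasqForm M y x =
      1 / x 1 ^ 2 * (Real.sin (x 2) * (pd 2 y x * star u).re)
      - Real.sin (x 2) / (2 * x 1 ^ 2) * ‖y x‖ ^ 2
      + x 1 / (x 1 - 2 * M) * (Real.sin (x 2) * (pd 2 s x * star v).re) := by
    rw [canonForm, pasqForm, hin, hdP, hdM, hez]
    field_simp
    linear_combination 2 * (x 1 - 2 * M) * n1 + 2 * x 1 ^ 3 * n2
  rw [key, m1, m2, p2, p3, Complex.sq_norm, Complex.normSq_apply]
  simp only [Complex.add_re, Complex.add_im, Complex.sub_im, Complex.mul_re, Complex.mul_im,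
    Complex.star_def, Complex.conj_re, Complex.conj_im, Complex.I_re, Complex.I_im,
    Complex.ofReal_re, Complex.ofReal_im]
  field_simp
  ring

/-- The `s` part vanishes by spin weight 0; in the `y` part the spin phase `-i cos θ ȳ` of the
conjugate derivative cancels the explicit `i cos θ |y|²`. -/
theorem IsDebye.bdryTheta_pole (h : IsDebye M f y s) {x : Pt} (hx : x ∈ extChart M)
    (h0 : Real.sin (x 2) = 0) : bdryTheta M y s x = 0 := by
  rw [bdryTheta, h.pole_s x hx h0, h.pole_y x hx h0]
  simp [-Complex.ofReal_cos]
  right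
  ring

theorem IsDebye.bdryPhi_add_period (h : IsDebye M f y s) (x : Pt) :
    bdryPhi M y s (x + Pi.single 3 (2 * Real.pi)) = bdryPhi M y s x := by
  simp only [bdryPhi, pd_add_period h.angular_s, pd_add_period h.angular_y, h.angular_s x,
    h.angular_y x]
  simp

theorem canonForm_nonneg (hM : 0 < M) {x : Pt} (hx : x ∈ exterior M) : 0 ≤ canonForm M y s x := by
  have hr : 0 < x 1 := r_pos hM (exterior_subset M hx)
  have hr' : 0 < x 1 - 2 * M := sub_pos.2 hx.1
  have hsin := sin_pos_of_mem hx
  rw [canonForm]; positivity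

theorem pasqForm_nonneg (hM : 0 < M) {x : Pt} (hx : x ∈ exterior M) : 0 ≤ pasqForm M y x := by
  have hr : 0 < x 1 := r_pos hM (exterior_subset M hx)
  have hr' : 0 < x 1 - 2 * M := sub_pos.2 hx.1
  have hsin := sin_pos_of_mem hx
  rw [pasqForm]; positivity

theorem IsDebye.continuousAt_forms (h : IsDebye M f y s) (hM : 0 < M) {x : Pt}
    (hx : x ∈ exterior M) :
    ContinuousAt (canonForm M y s) x ∧ ContinuousAt (pasqForm M y) x := by
  have hr : x 1 ≠ 0 := (r_pos hM (exterior_subset M hx)).ne'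
  have hr' : x 1 - 2 * M ≠ 0 := (sub_pos.2 hx.1).ne'
  have hsin : (Real.sin (x 2) : ℂ) ≠ 0 := by exact_mod_cast (sin_pos_of_mem hx).ne'
  have hy := (h.smooth_y x (exterior_subset M hx)).continuousAt
  have hy' := fun μ => (contDiffAt_pd (h.smooth_y x (exterior_subset M hx)) μ).continuousAt
  have hs' := fun μ => (contDiffAt_pd (h.smooth_s x (exterior_subset M hx)) μ).continuousAt
  have c0 : ContinuousAt (fun x : Pt => x 1) x := (continuous_apply 1).continuousAt
  have csin : ContinuousAt (fun x : Pt => Real.sin (x 2)) x :=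
    (Real.continuous_sin.comp (continuous_apply 2)).continuousAt
  have csin' : ContinuousAt (fun x : Pt => (Real.sin (x 2) : ℂ)) x :=
    (contDiff_coord_ofReal Real.contDiff_sin 2).continuous.continuousAt
  have ccos' : ContinuousAt (fun x : Pt => (Real.cos (x 2) : ℂ)) x :=
    (contDiff_coord_ofReal Real.contDiff_cos 2).continuous.continuousAt
  have cu : ContinuousAt (fun x => (Complex.I * pd 3 y x + Real.cos (x 2) * y x)
      / Real.sin (x 2)) x :=
    ((continuousAt_const.mul (hy' 3)).add (ccos'.mul hy)).div csin' hsin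
  have cP : ContinuousAt (dPlus y) x := (hy' 2).add cu
  have cM : ContinuousAt (dMinus y) x := (hy' 2).sub cu
  have cE : ContinuousAt (ethZero s) x :=
    (hs' 2).add ((continuousAt_const.mul (hs' 3)).div csin' hsin)
  have cq : ContinuousAt (fun x : Pt => (((x 1 - 2 * M) / x 1 : ℝ) : ℂ)) x :=
    Complex.continuous_ofReal.continuousAt.comp ((c0.sub continuousAt_const).div c0 hr)
  have cO : ContinuousAt (outDeriv M y) x := (hy' 0).add (cq.mul (hy' 1))
  have cI : ContinuousAt (inDeriv M y) x := (hy' 0).sub (cq.mul (hy' 1))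
  have k1 : ContinuousAt (fun x : Pt => x 1 / (4 * (x 1 - 2 * M))) x :=
    c0.div (continuousAt_const.mul (c0.sub continuousAt_const)) (by simpa using hr')
  have k2 : ∀ a : ℝ, a ≠ 0 → ContinuousAt (fun x : Pt => 1 / (a * x 1 ^ 2)) x := fun a ha =>
    continuousAt_const.div (continuousAt_const.mul (c0.pow 2)) (by simp [ha, hr])
  exact ⟨csin.mul (((k2 2 (by norm_num)).mul (cP.norm.pow 2)).add
      (k1.mul ((cO.norm.pow 2).add (cE.norm.pow 2)))),
    csin.mul ((k1.mul ((cO.norm.pow 2).add (cI.norm.pow 2))).add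
      ((k2 4 (by norm_num)).mul (((cP.norm.pow 2).add (cM.norm.pow 2)).add
        (continuousAt_const.mul (hy.norm.pow 2)))))⟩

theorem IsDebye.integral_canonForm (h : IsDebye M f y s) (hM : 0 < M) :
    (IntegrableOn (fun p => canonForm M y s (sigmaPt p)) (sigmaRegion M) ↔
      IntegrableOn (fun p => pasqForm M y (sigmaPt p)) (sigmaRegion M)) ∧
    ∫ p in sigmaRegion M, canonForm M y s (sigmaPt p) =
      ∫ p in sigmaRegion M, pasqForm M y (sigmaPt p) := by
  have him : ∀ {g : Pt → ℂ} {x : Pt}, ContDiffAt ℝ ∞ g x → ContDiffAt ℝ ∞ (fun x => (g x).im) x :=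
    fun hg => Complex.imCLM.contDiff.contDiffAt.comp _ hg
  refine sigma_integral_eq_of_divergence (b := fun x => (bdryTheta M y s x).im)
    (c := fun x => (bdryPhi M y s x).im)
    (fun x hx => (h.continuousAt_forms hM hx).1) (fun x hx => (h.continuousAt_forms hM hx).2)
    (fun x hx => canonForm_nonneg hM hx) (fun x hx => pasqForm_nonneg hM hx)
    (fun x hx => him (h.contDiffAt_bdry hM hx).1) (fun x hx => him (h.contDiffAt_bdry hM hx).2)
    (fun x hx h0 => by simp only [h.bdryTheta_pole hx h0, Complex.zero_im])
    (fun x => by simp only [h.bdryPhi_add_period x]) (fun x hx => ?_)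
  have hx' := exterior_subset M hx
  rw [h.canonForm_sub_pasqForm hM hx, Complex.sub_im, pd_im (h.contDiffAt_bdry hM hx').1.diffAt,
    pd_im (h.contDiffAt_bdry hM hx').2.diffAt]

end Debye

end SchwarzschildEM

namespace SchwarzschildEM

/-! ### The Ernst form of the energy -/

/-- A radial boundary term vanishes at both ends when its density is integrable. -/
theorem integral_radial_deriv_eq_zero {a : ℝ} (ha : 0 < a) {u q' : ℝ → ℝ}
    (hu : ∀ r ∈ Ioi a, 0 ≤ u r)
    (hq : ∀ r ∈ Ioi a, HasDerivAt (fun r => (r - a) / r ^ 2 * u r) (q' r) r)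
    (hq' : IntegrableOn q' (Ioi a)) (hi : IntegrableOn (fun r => u r / r ^ 2) (Ioi a)) :
    ∫ r in Ioi a, q' r = 0 := by
  set q : ℝ → ℝ := fun r => (r - a) / r ^ 2 * u r with hqdef
  set c : ℝ := a + 1 with hc
  have hca : a < c := by linarith
  have hq0 : ∀ r ∈ Ioi a, 0 ≤ q r := fun r hr =>
    mul_nonneg (div_nonneg (sub_nonneg.2 (le_of_lt hr)) (sq_nonneg _)) (hu r hr)
  -- The integrable density is `q` times `1 / (r - a)`, which has a divergent integral both at `a`
  -- and at infinity.
  have hqu : ∀ r ∈ Ioi a, u r / r ^ 2 = q r * (r - a)⁻¹ := fun r hr => by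
    have : r - a ≠ 0 := (sub_pos.2 hr).ne'
    simp only [hqdef]; field_simp
  have hftc : ∀ r₁ ∈ Ioi a, ∀ r₂ ∈ Ioi a, ∫ r in r₁..r₂, q' r = q r₂ - q r₁ := by
    intro r₁ h₁ r₂ h₂
    have hsub : uIcc r₁ r₂ ⊆ Ioi a := ordConnected_Ioi.uIcc_subset h₁ h₂
    exact intervalIntegral.integral_eq_sub_of_hasDerivAt (fun r hr => hq r (hsub hr))
      ((hq'.mono_set hsub).intervalIntegrable)
  have hq1 : IntegrableOn q' (Ioi c) := hq'.mono_set (Ioi_subset_Ioi hca.le)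
  have hq2 : IntegrableOn q' (Ioc a c) := hq'.mono_set Ioc_subset_Ioi_self
  -- Integrability of `q'` forces `q` to have a limit at each end; the limits are shown to be zero
  -- next.
  have htop : Tendsto q atTop (𝓝 (q c + ∫ r in Ioi c, q' r)) := by
    have h := (intervalIntegral_tendsto_integral_Ioi c hq1 tendsto_id).const_add (q c)
    refine h.congr' ?_
    filter_upwards [eventually_gt_atTop a] with r hr
    rw [id, hftc c hca r hr]; ring
  have hbot : Tendsto q (𝓝[>] a) (𝓝 (q c - ∫ r in a..c, q' r)) := by
    have hI : IntegrableOn q' (uIcc a c) := by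
      rw [uIcc_of_le hca.le, integrableOn_Icc_iff_integrableOn_Ioc]; exact hq2
    have h1 := intervalIntegral.continuousOn_primitive_interval_left hI a left_mem_uIcc
    have h2 : Tendsto (fun x => ∫ t in x..c, q' t) (𝓝[>] a) (𝓝 (∫ t in a..c, q' t)) := by
      refine h1.mono_left ?_
      rw [uIcc_of_le hca.le, ← nhdsWithin_Ioc_eq_nhdsGT hca]
      exact nhdsWithin_mono _ Ioc_subset_Icc_self
    refine (h2.const_sub (q c)).congr' ?_
    filter_upwards [self_mem_nhdsWithin] with r hr
    rw [hftc r hr c hca]; ring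
  -- A positive limit `L` would give `q > L/2` eventually, so that `1 / r` would be dominated by an
  -- integrable function near infinity.
  have ltop : q c + ∫ r in Ioi c, q' r = 0 := by
    by_contra hne
    set L := q c + ∫ r in Ioi c, q' r
    have hL : 0 < L := lt_of_le_of_ne (ge_of_tendsto htop
      ((eventually_gt_atTop a).mono fun r hr => hq0 r hr)) (Ne.symm hne)
    obtain ⟨R, hR⟩ := (((tendsto_order.1 htop).1 (L / 2) (by linarith)).and
      (eventually_gt_atTop a)).exists_forall_of_atTop
    have hRa : a < R := (hR R le_rfl).2
    refine not_integrableOn_Ioi_inv (a := R) ?_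
    have h3 : IntegrableOn (fun r => (L / 2)⁻¹ * (u r / r ^ 2)) (Ioi R) :=
      (hi.mono_set (Ioi_subset_Ioi hRa.le)).const_mul _
    refine h3.mono' (measurable_inv.aestronglyMeasurable) ?_
    refine ae_restrict_of_forall_mem measurableSet_Ioi fun r hr => ?_
    have hr : R < r := hr
    have hra : a < r := hRa.trans hr
    have hr0 : 0 < r := ha.trans hra
    have hra' : 0 < r - a := sub_pos.2 hra
    rw [hqu r hra, Real.norm_of_nonneg (inv_pos.2 hr0).le]
    have h4 := (hR r hr.le).1
    calc r⁻¹ ≤ (r - a)⁻¹ := inv_anti₀ hra' (by linarith)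
      _ = (L / 2)⁻¹ * (L / 2 * (r - a)⁻¹) := by field_simp
      _ ≤ (L / 2)⁻¹ * (q r * (r - a)⁻¹) := by gcongr
  -- The same argument at the horizon, now with the non-integrable function `1 / (r - a)`.
  have lbot : q c - ∫ r in a..c, q' r = 0 := by
    by_contra hne
    set L := q c - ∫ r in a..c, q' r
    have hL : 0 < L := lt_of_le_of_ne (ge_of_tendsto hbot
      (eventually_nhdsWithin_of_forall fun r hr => hq0 r hr)) (Ne.symm hne)
    obtain ⟨b, hb, hR⟩ := (mem_nhdsGT_iff_exists_Ioo_subset (a := a)).1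
      ((tendsto_order.1 hbot).1 (L / 2) (by linarith))
    have hab : a < b := hb
    have h5 : ¬ IntervalIntegrable (fun r => (r - a)⁻¹) volume a b := by
      rw [intervalIntegrable_sub_inv_iff]
      push Not
      exact ⟨hab.ne, left_mem_uIcc⟩
    refine h5 ((intervalIntegrable_iff_integrableOn_Ioo_of_le hab.le).2 ?_)
    have h3 : IntegrableOn (fun r => (L / 2)⁻¹ * (u r / r ^ 2)) (Ioo a b) :=
      (hi.mono_set Ioo_subset_Ioi_self).const_mul _
    refine h3.mono' ((measurable_id.sub_const a).inv.aestronglyMeasurable) ?_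
    refine ae_restrict_of_forall_mem measurableSet_Ioo fun r hr => ?_
    have hra' : 0 < r - a := sub_pos.2 hr.1
    rw [hqu r hr.1, Real.norm_of_nonneg (inv_pos.2 hra').le]
    have h4 : L / 2 < q r := hR hr
    calc (r - a)⁻¹ = (L / 2)⁻¹ * (L / 2 * (r - a)⁻¹) := by field_simp
      _ ≤ (L / 2)⁻¹ * (q r * (r - a)⁻¹) := by gcongr
  rw [← Ioc_union_Ioi_eq_Ioi hca.le, setIntegral_union (Ioc_disjoint_Ioi le_rfl) measurableSet_Ioi
    hq2 hq1, ← intervalIntegral.integral_of_le hca.le]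
  linarith

/-- The second Ernst energy density with the volume element. -/
noncomputable def ernstZForm (M : ℝ) (y : Pt → ℂ) (x : Pt) : ℝ :=
  Real.sin (x 2) * (x 1 / (x 1 - 2 * M) * ‖pd 0 y x‖ ^ 2
    + (x 1 - 2 * M) / x 1 * (‖pd 1 y x - (x 1 : ℂ)⁻¹ * y x‖ ^ 2 + 1 / x 1 ^ 2 * ‖y x‖ ^ 2)
    + 1 / x 1 ^ 2 * (‖pd 2 y x‖ ^ 2 + (Real.cos (x 2) / Real.sin (x 2)) ^ 2 * ‖y x‖ ^ 2))

section Debye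

variable {M : ℝ} {φ f y s : Pt → ℂ}

theorem IsDebyeOf.axisymmetric (h : IsDebyeOf M φ f y s) (hM : 0 < M)
    (ha : IsAxisymmetric M φ) {x : Pt} (hx : x ∈ exterior M) : pd 3 y x = 0 ∧ pd 3 s x = 0 := by
  have hf3 : ∀ x ∈ exterior M, pd 3 f x = 0 := fun x hx => by
    have hq : 0 < √(Delta M x) := Real.sqrt_pos.2 (Delta_pos hM (exterior_subset M hx))
    have hc : DifferentiableAt ℝ (fun r : ℝ => r ^ 2 / √(r * (r - 2 * M))) (x 1) :=
      ((hasDerivAt_pow 2 (x 1)).div (hasDerivAt_sqrt_Delta hM hx.1) hq.ne').differentiableAt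
    have e : pd 3 φ x = ((x 1 ^ 2 / √(Delta M x) : ℝ) : ℂ) * pd 3 f x :=
      (pd_congr_exterior h.phi_eq hx 3).trans (pd_coord_mul_of_ne hc
        (h.smooth_f x (exterior_subset M hx)).diffAt (by decide))
    rw [ha x hx, eq_comm, mul_eq_zero] at e
    refine e.resolve_left ?_
    have hr : 0 < x 1 := r_pos hM (exterior_subset M hx)
    exact_mod_cast (by positivity : 0 < x 1 ^ 2 / √(Delta M x)).ne'
  have hx' := exterior_subset M hx
  have hf := h.smooth_f x hx'
  have hfμ : ∀ μ, pd 3 (pd μ f) x = 0 := fun μ => by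
    rw [pd_comm hf, pd_congr_exterior hf3 hx, pd_const]
  have hU := (isOpen_extChart M).mem_nhds hx'
  have dp : ∀ μ, DifferentiableAt ℝ (pd μ f) x := fun μ => (contDiffAt_pd hf μ).diffAt
  have c3 : DifferentiableAt ℝ (fun r : ℝ => r ^ 3 / (r - 2 * M)) (x 1) :=
    DifferentiableAt.fun_div (by fun_prop) (by fun_prop) (sub_pos.2 hx.1).ne'
  have c2 : DifferentiableAt ℝ (fun r : ℝ => r ^ 2) (x 1) := by fun_prop
  have dsin : DifferentiableAt ℝ (fun x : Pt => (Real.sin (x 2) : ℂ)) x :=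
    diff_cast_coord Real.differentiable_sin.differentiableAt
  have dcos : DifferentiableAt ℝ (fun x : Pt => (Real.cos (x 2) : ℂ)) x :=
    diff_cast_coord Real.differentiable_cos.differentiableAt
  refine ⟨?_, ?_⟩
  · rw [pd_congr (Filter.eventuallyEq_of_mem hU h.y_eq),
      pd_add ((diff_cast_coord c3).fun_mul (dp 0)) ((diff_cast_coord c2).fun_mul (dp 1)),
      pd_coord_mul_of_ne c3 (dp 0) (by decide), pd_coord_mul_of_ne c2 (dp 1) (by decide), hfμ, hfμ]
    simp
  · have e := pd_congr (Filter.eventuallyEq_of_mem hU h.s_eq) 3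
    rw [pd_add ((dsin.fun_mul (dp 2)).fun_add ((dp 3).const_mul _)) (dcos.fun_mul hf.diffAt),
      pd_add (dsin.fun_mul (dp 2)) ((dp 3).const_mul _), pd_const_mul _ (dp 3),
      pd_coord_mul_of_ne Real.differentiable_sin.differentiableAt (h.smooth_s x hx').diffAt
        (by decide),
      pd_coord_mul_of_ne Real.differentiable_sin.differentiableAt (dp 2) (by decide),
      pd_coord_mul_of_ne Real.differentiable_cos.differentiableAt hf.diffAt (by decide),
      hfμ, hfμ, hf3 x hx] at e
    have e3 : (Real.sin (x 2) : ℂ) ≠ 0 := by exact_mod_cast (sin_pos_of_mem hx).ne'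
    simpa [e3, -Complex.ofReal_sin] using e

theorem IsDebyeOf.ernst_eq (h : IsDebyeOf M φ f y s) (hM : 0 < M) {x : Pt} (hx : x ∈ exterior M) :
    ernst M φ x = Complex.I * (Real.sin (x 2) * y x) := by
  have e1 : (x 1 : ℂ) ≠ 0 := by exact_mod_cast (r_pos hM (exterior_subset M hx)).ne'
  have e4 : (√2 : ℂ) ≠ 0 := by exact_mod_cast (by norm_num : √2 ≠ 0)
  rw [ernst, h.chi_eq x hx]
  push_cast
  field_simp

theorem IsDebyeOf.pd_ernst (h : IsDebyeOf M φ f y s) (hM : 0 < M) {x : Pt} (hx : x ∈ exterior M)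
    (μ : Fin 4) : pd μ (ernst M φ) x = Complex.I *
      ((if μ = 2 then Real.cos (x 2) * y x else 0) + Real.sin (x 2) * pd μ y x) := by
  have hy := (h.smooth_y x (exterior_subset M hx)).diffAt
  have hsin : DifferentiableAt ℝ (fun x : Pt => (Real.sin (x 2) : ℂ)) x :=
    diff_cast_coord Real.differentiable_sin.differentiableAt
  rw [pd_congr_exterior (fun z hz => h.ernst_eq hM hz) hx, pd_const_mul _ (hsin.fun_mul hy),
      pd_coord_mul (Real.hasDerivAt_sin _) hy]

theorem axialNorm_eq (M : ℝ) : axialNorm M = fun x => x 1 ^ 2 * Real.sin (x 2) ^ 2 := by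
  funext x; simp [axialNorm, metric]

theorem axialZ_eq (hM : 0 < M) {x : Pt} (hx : x ∈ exterior M) :
    axialZ M 1 x = -(x 1)⁻¹ ∧ axialZ M 2 x = -(Real.cos (x 2) / Real.sin (x 2)) ∧
      axialZ M 3 x = 0 := by
  have hr : 0 < x 1 := r_pos hM (exterior_subset M hx)
  have hsin := sin_pos_of_mem hx
  have h1 : HasDerivAt (fun r : ℝ => r ^ 2) (2 * x 1) (x 1) := by simpa using hasDerivAt_pow 2 (x 1)
  have h2 : HasDerivAt (fun θ : ℝ => Real.sin θ ^ 2) (2 * Real.sin (x 2) * Real.cos (x 2)) (x 2) := by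
    simpa using (Real.hasDerivAt_sin (x 2)).fun_pow 2
  have p : ∀ μ, pd μ (axialNorm M) x = (if μ = 1 then 2 * x 1 else 0) * Real.sin (x 2) ^ 2
      + x 1 ^ 2 * (if μ = 2 then 2 * Real.sin (x 2) * Real.cos (x 2) else 0) := fun μ => by
    rw [axialNorm_eq, pd_mul (differentiableAt_coord h1.differentiableAt)
      (differentiableAt_coord h2.differentiableAt), pd_coord h1, pd_coord h2]
  simp only [axialZ, p]
  rw [axialNorm_eq]
  simp only [Fin.reduceEq, if_false, if_true]
  refine ⟨?_, ?_, ?_⟩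
  · field_simp; ring
  · field_simp; ring
  · ring

theorem norm_sq_mul_I_ofReal (a : ℝ) (z : ℂ) : ‖Complex.I * (a * z)‖ ^ 2 = a ^ 2 * ‖z‖ ^ 2 := by
  simp [mul_pow]

theorem diag_sum_re (M : ℝ) (x : Pt) (v w : Fin 4 → ℂ) :
    (∑ i : Fin 3, ∑ j : Fin 3, (metricInv M x i.succ j.succ : ℂ) * v i.succ * w j.succ).re =
      gInv M x 1 * (v 1 * w 1).re + gInv M x 2 * (v 2 * w 2).re + gInv M x 3 * (v 3 * w 3).re := by
  simp only [metricInv_apply, Fin.sum_univ_three, Complex.add_re, Fin.succ_inj]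
  simp only [Fin.reduceEq, Fin.isValue, if_false, if_true, Complex.ofReal_zero, zero_mul,
    Complex.zero_re, add_zero, zero_add, mul_assoc, Complex.re_ofReal_mul]
  rfl

theorem re_mul_star (z : ℂ) : (z * star z).re = ‖z‖ ^ 2 := by
  rw [← ofReal_sq_norm]; norm_cast

/-- Axisymmetry removes the ϕ-derivative that distinguishes ð s from ð' s, so ð s becomes the
ingoing derivative of `y`. The derivative of `sin θ` in Ψ = i sin θ y supplies the `cos θ` term of ð
y. -/
theorem IsDebyeOf.ernstDensity_eq (h : IsDebyeOf M φ f y s) (hM : 0 < M)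
    (ha : IsAxisymmetric M φ) {x : Pt} (hx : x ∈ exterior M) :
    ernstDensity M (ernst M φ) x * sigmaVol M x = 2 * canonForm M y s x := by
  have hr : 0 < x 1 := r_pos hM (exterior_subset M hx)
  have hr' : 0 < x 1 - 2 * M := sub_pos.2 hx.1
  have hD := Delta_pos hM (exterior_subset M hx)
  have hq : 0 < √(Delta M x) := Real.sqrt_pos.2 hD
  have hq2 : √(Delta M x) ^ 2 = x 1 * (x 1 - 2 * M) := Real.sq_sqrt hD.le
  have hsin := sin_pos_of_mem hx
  have e3 : (Real.sin (x 2) : ℂ) ≠ 0 := by exact_mod_cast hsin.ne'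
  obtain ⟨y3, s3⟩ := h.axisymmetric hM ha hx
  have hin := h.ethZero_star hM hx
  have hez : ethZero s x = inDeriv M y x := by
    rw [← hin, ethZero, s3]; simp
  have hP : Real.cos (x 2) * y x + Real.sin (x 2) * pd 2 y x = Real.sin (x 2) * dPlus y x := by
    rw [dPlus, y3]; field_simp; ring
  have p := h.pd_ernst hM hx
  rw [ernstDensity, diag_sum_re M x (fun μ => pd μ (ernst M φ) x)
    (fun μ => star (pd μ (ernst M φ) x))]
  simp only [re_mul_star, p, y3]
  simp only [Fin.reduceEq, if_false, if_true, zero_add, hP, norm_sq_mul_I_ofReal]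
  rw [canonForm, hez, out_in_norm M y x]
  simp only [gInv, Matrix.cons_val, sigmaVol, lapse, axialNorm_eq, norm_zero]
  rw [Delta] at *
  generalize √(x 1 * (x 1 - 2 * M)) = q at *
  field_simp
  rw [hq2]
  field_simp
  ring

/-- The angular component of `Z` cancels the derivative of `sin θ` in Ψ, and the radial one turns
∂_r y into ∂_r y - y/r. -/
theorem IsDebyeOf.ernstDensityZ_eq (h : IsDebyeOf M φ f y s) (hM : 0 < M)
    (ha : IsAxisymmetric M φ) {x : Pt} (hx : x ∈ exterior M) :
    ernstDensityZ M (ernst M φ) x * sigmaVol M x = ernstZForm M y x := by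
  have hr : 0 < x 1 := r_pos hM (exterior_subset M hx)
  have hr' : 0 < x 1 - 2 * M := sub_pos.2 hx.1
  have hD := Delta_pos hM (exterior_subset M hx)
  have hq : 0 < √(Delta M x) := Real.sqrt_pos.2 hD
  have hq2 : √(Delta M x) ^ 2 = x 1 * (x 1 - 2 * M) := Real.sq_sqrt hD.le
  have hsin := sin_pos_of_mem hx
  have e3 : (Real.sin (x 2) : ℂ) ≠ 0 := by exact_mod_cast hsin.ne'
  obtain ⟨y3, s3⟩ := h.axisymmetric hM ha hx
  obtain ⟨z1, z2, z3⟩ := axialZ_eq hM hx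
  have p := h.pd_ernst hM hx
  have hsum : (∑ i : Fin 3, ∑ j : Fin 3, (metricInv M x i.succ j.succ : ℂ) *
        ((pd i.succ (ernst M φ) x + (axialZ M i.succ x : ℂ) * ernst M φ x) *
            star (pd j.succ (ernst M φ) x + (axialZ M j.succ x : ℂ) * ernst M φ x)
          + (axialZ M i.succ x : ℂ) * (axialZ M j.succ x : ℂ) *
            ((‖ernst M φ x‖ ^ 2 : ℝ) : ℂ))).re =
      gInv M x 1 * (‖pd 1 (ernst M φ) x + (axialZ M 1 x : ℂ) * ernst M φ x‖ ^ 2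
        + axialZ M 1 x ^ 2 * ‖ernst M φ x‖ ^ 2) +
      gInv M x 2 * (‖pd 2 (ernst M φ) x + (axialZ M 2 x : ℂ) * ernst M φ x‖ ^ 2
        + axialZ M 2 x ^ 2 * ‖ernst M φ x‖ ^ 2) +
      gInv M x 3 * (‖pd 3 (ernst M φ) x + (axialZ M 3 x : ℂ) * ernst M φ x‖ ^ 2
        + axialZ M 3 x ^ 2 * ‖ernst M φ x‖ ^ 2) := by
    have hzz : ∀ a b : ℝ, ((a : ℂ) * (a : ℂ) * (b : ℂ)).re = a ^ 2 * b := fun a b => by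
      norm_cast; ring
    simp only [metricInv_apply, Fin.sum_univ_three, Complex.add_re, Fin.succ_inj]
    simp only [Fin.reduceEq, Fin.isValue, if_false, if_true, Complex.ofReal_zero, zero_mul,
      Complex.zero_re, add_zero, zero_add, Complex.re_ofReal_mul, Complex.add_re, re_mul_star, hzz]
    rfl
  have t1 : pd 1 (ernst M φ) x + (axialZ M 1 x : ℂ) * ernst M φ x =
      Complex.I * (Real.sin (x 2) * (pd 1 y x - (x 1 : ℂ)⁻¹ * y x)) := by
    rw [p, h.ernst_eq hM hx, z1, if_neg (by decide)]; push_cast; ring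
  have t2 : pd 2 (ernst M φ) x + (axialZ M 2 x : ℂ) * ernst M φ x =
      Complex.I * (Real.sin (x 2) * pd 2 y x) := by
    rw [p, h.ernst_eq hM hx, z2, if_pos rfl]; push_cast at e3 ⊢; field_simp; ring
  have t3 : pd 3 (ernst M φ) x + (axialZ M 3 x : ℂ) * ernst M φ x = 0 := by
    rw [p, z3, y3]; simp
  have t0 : pd 0 (ernst M φ) x = Complex.I * (Real.sin (x 2) * pd 0 y x) := by
    rw [p]; simp
  rw [ernstDensityZ, hsum, t0, t1, t2, t3, z1, z2, z3, h.ernst_eq hM hx]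
  simp only [norm_sq_mul_I_ofReal, ernstZForm, gInv, Matrix.cons_val, sigmaVol, lapse,
    axialNorm_eq, norm_zero]
  rw [Delta] at *
  generalize √(x 1 * (x 1 - 2 * M)) = q at *
  field_simp
  rw [hq2]
  field_simp
  ring

/-- The radial boundary term. -/
noncomputable def bdryRadial (M : ℝ) (y : Pt → ℂ) (x : Pt) : ℝ :=
  (x 1 - 2 * M) / x 1 ^ 2 * ‖y x‖ ^ 2

theorem dPlus_dMinus_norm_of_axisymmetric {x : Pt} (y3 : pd 3 y x = 0) :
    ‖dPlus y x‖ ^ 2 + ‖dMinus y x‖ ^ 2 =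
      2 * (‖pd 2 y x‖ ^ 2 + (Real.cos (x 2) / Real.sin (x 2)) ^ 2 * ‖y x‖ ^ 2) := by
  rw [dPlus_dMinus_norm, y3, mul_zero, zero_add, norm_mul, Complex.norm_real, Real.norm_eq_abs,
    mul_pow, sq_abs, div_pow, mul_div_right_comm]

/-- Expanding |∂_r y - y/r|² yields a cross term Re(∂_r y ȳ) that is the main part of the radial
derivative; the zeroth-order terms account for the derivative of the coefficient (r - 2M)/r². -/
theorem ernstZForm_eq (hM : 0 < M) {x : Pt} (hx : x ∈ exterior M) (hy : DifferentiableAt ℝ y x)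
    (y3 : pd 3 y x = 0) :
    ernstZForm M y x = 2 * pasqForm M y x - Real.sin (x 2) * pd 1 (bdryRadial M y) x := by
  have hr : 0 < x 1 := r_pos hM (exterior_subset M hx)
  have hr' : 0 < x 1 - 2 * M := sub_pos.2 hx.1
  have hsin := sin_pos_of_mem hx
  have hc : HasDerivAt (fun r : ℝ => (r - 2 * M) / r ^ 2)
      ((1 * x 1 ^ 2 - (x 1 - 2 * M) * (2 * x 1)) / (x 1 ^ 2) ^ 2) (x 1) := by
    have h1 : HasDerivAt (fun r : ℝ => r ^ 2) (2 * x 1) (x 1) := by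
      simpa using hasDerivAt_pow 2 (x 1)
    exact ((hasDerivAt_id' (x 1)).sub_const (2 * M)).div h1 (by positivity)
  have hfun : bdryRadial M y = fun x => (x 1 - 2 * M) / x 1 ^ 2 *
      ((y x).re * (y x).re + (y x).im * (y x).im) := by
    funext x; rw [bdryRadial, Complex.sq_norm, Complex.normSq_apply]
  have dre : DifferentiableAt ℝ (fun x => (y x).re) x := Complex.reCLM.differentiableAt.comp x hy
  have dim : DifferentiableAt ℝ (fun x => (y x).im) x := Complex.imCLM.differentiableAt.comp x hy
  have p : pd 1 (bdryRadial M y) x =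
      (1 * x 1 ^ 2 - (x 1 - 2 * M) * (2 * x 1)) / (x 1 ^ 2) ^ 2 * ‖y x‖ ^ 2
      + (x 1 - 2 * M) / x 1 ^ 2 * (2 * (pd 1 y x * star (y x)).re) := by
    rw [hfun, pd_mul (differentiableAt_coord hc.differentiableAt)
      ((dre.fun_mul dre).fun_add (dim.fun_mul dim)), pd_coord hc, if_pos rfl,
      pd_add (dre.fun_mul dre) (dim.fun_mul dim), pd_mul dre dre, pd_mul dim dim, pd_re hy,
      pd_im hy, Complex.sq_norm, Complex.normSq_apply]
    simp only [Complex.mul_re, Complex.star_def, Complex.conj_re, Complex.conj_im]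
    ring
  have hsub : ‖pd 1 y x - (x 1 : ℂ)⁻¹ * y x‖ ^ 2 = ‖pd 1 y x‖ ^ 2
      - 2 * (x 1)⁻¹ * (pd 1 y x * star (y x)).re + ((x 1)⁻¹) ^ 2 * ‖y x‖ ^ 2 := by
    rw [← Complex.ofReal_inv]
    simp only [Complex.sq_norm, Complex.normSq_apply, Complex.sub_re, Complex.sub_im,
      Complex.ofReal_re, Complex.ofReal_im, Complex.mul_re, Complex.mul_im, Complex.star_def,
      Complex.conj_re, Complex.conj_im]
    ring
  rw [ernstZForm, pasqForm, p, out_in_norm M y x, hsub, dPlus_dMinus_norm_of_axisymmetric y3]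
  field_simp
  ring

theorem ernstZForm_nonneg (hM : 0 < M) {x : Pt} (hx : x ∈ exterior M) : 0 ≤ ernstZForm M y x := by
  have hr : 0 < x 1 := r_pos hM (exterior_subset M hx)
  have hr' : 0 < x 1 - 2 * M := sub_pos.2 hx.1
  have hsin := sin_pos_of_mem hx
  rw [ernstZForm]; positivity

/-- Dominates the second Ernst density so that its integral converges. The 6 is dictated by the
zeroth-order part: that part is bounded by 3|y|²/r², while `pasqForm` contains half of |y|²/r². -/
theorem ernstZForm_le (hM : 0 < M) {x : Pt} (hx : x ∈ exterior M) (y3 : pd 3 y x = 0) :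
    ernstZForm M y x ≤ 6 * pasqForm M y x := by
  have hr : 0 < x 1 := r_pos hM (exterior_subset M hx)
  have hr' : 0 < x 1 - 2 * M := sub_pos.2 hx.1
  have hsin := sin_pos_of_mem hx
  have hsub : ‖pd 1 y x - (x 1 : ℂ)⁻¹ * y x‖ ^ 2 ≤
      2 * (‖pd 1 y x‖ ^ 2 + ((x 1)⁻¹) ^ 2 * ‖y x‖ ^ 2) := by
    have p := parallelogram_law_with_norm ℝ (pd 1 y x) (((x 1)⁻¹ : ℝ) * y x)
    rw [norm_mul, Complex.norm_real, Real.norm_of_nonneg (inv_pos.2 hr).le] at p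
    push_cast at p
    nlinarith [sq_nonneg ‖pd 1 y x + (x 1 : ℂ)⁻¹ * y x‖]
  have hle : (x 1 - 2 * M) / x 1 ≤ 1 := by rw [div_le_one hr]; linarith
  rw [ernstZForm, pasqForm, out_in_norm M y x, dPlus_dMinus_norm_of_axisymmetric y3]
  rw [mul_left_comm]
  refine mul_le_mul_of_nonneg_left ?_ hsin.le
  have k1 : x 1 / (4 * (x 1 - 2 * M)) * (2 * (‖pd 0 y x‖ ^ 2 +
      ((x 1 - 2 * M) / x 1) ^ 2 * ‖pd 1 y x‖ ^ 2)) =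
      1 / 2 * (x 1 / (x 1 - 2 * M) * ‖pd 0 y x‖ ^ 2)
      + 1 / 2 * ((x 1 - 2 * M) / x 1 * ‖pd 1 y x‖ ^ 2) := by field_simp; ring
  have k2 : 1 / (4 * x 1 ^ 2) * (2 * (‖pd 2 y x‖ ^ 2 + (Real.cos (x 2) / Real.sin (x 2)) ^ 2 *
      ‖y x‖ ^ 2) + 2 * ‖y x‖ ^ 2) = 1 / 2 * (1 / x 1 ^ 2 * (‖pd 2 y x‖ ^ 2
        + (Real.cos (x 2) / Real.sin (x 2)) ^ 2 * ‖y x‖ ^ 2))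
      + 1 / 2 * (1 / x 1 ^ 2 * ‖y x‖ ^ 2) := by field_simp; ring
  have k3 : (x 1 - 2 * M) / x 1 * (‖pd 1 y x - (x 1 : ℂ)⁻¹ * y x‖ ^ 2 + 1 / x 1 ^ 2 * ‖y x‖ ^ 2) ≤
      2 * ((x 1 - 2 * M) / x 1 * ‖pd 1 y x‖ ^ 2) + 3 * (1 / x 1 ^ 2 * ‖y x‖ ^ 2) := by
    have h1 : 0 ≤ (x 1 - 2 * M) / x 1 := by positivity
    have h2 := mul_le_mul_of_nonneg_left hsub h1
    have h3 : (x 1 - 2 * M) / x 1 * (1 / x 1 ^ 2 * ‖y x‖ ^ 2) ≤ 1 * (1 / x 1 ^ 2 * ‖y x‖ ^ 2) :=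
      mul_le_mul_of_nonneg_right hle (by positivity)
    have h4 : ((x 1)⁻¹) ^ 2 = 1 / x 1 ^ 2 := by rw [inv_pow, one_div]
    rw [h4] at h2
    nlinarith
  have n1 : 0 ≤ x 1 / (x 1 - 2 * M) * ‖pd 0 y x‖ ^ 2 := by positivity
  have n2 : 0 ≤ (x 1 - 2 * M) / x 1 * ‖pd 1 y x‖ ^ 2 := by positivity
  have n3 : 0 ≤ 1 / x 1 ^ 2 * (‖pd 2 y x‖ ^ 2
        + (Real.cos (x 2) / Real.sin (x 2)) ^ 2 * ‖y x‖ ^ 2) := by positivity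
  rw [k1, k2]
  linarith

end Debye

end SchwarzschildEM

/-! ### Integration of the radial boundary term -/

namespace SchwarzschildEM

section Debye

variable {M : ℝ} {φ f y s : Pt → ℂ}

theorem differentiableAt_bdryRadial (hM : 0 < M) {x : Pt} (hx : x ∈ exterior M)
    (hy : DifferentiableAt ℝ y x) : DifferentiableAt ℝ (bdryRadial M y) x := by
  have hr : 0 < x 1 := r_pos hM (exterior_subset M hx)
  have hfun : bdryRadial M y = fun x => (x 1 - 2 * M) / x 1 ^ 2 *
      ((y x).re * (y x).re + (y x).im * (y x).im) := by
    funext x; rw [bdryRadial, Complex.sq_norm, Complex.normSq_apply]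
  have dre : DifferentiableAt ℝ (fun x => (y x).re) x := Complex.reCLM.differentiableAt.comp x hy
  have dim : DifferentiableAt ℝ (fun x => (y x).im) x := Complex.imCLM.differentiableAt.comp x hy
  have hc : DifferentiableAt ℝ (fun r : ℝ => (r - 2 * M) / r ^ 2) (x 1) :=
    DifferentiableAt.fun_div (by fun_prop) (by fun_prop) (by positivity)
  rw [hfun]
  exact (differentiableAt_coord hc).fun_mul ((dre.fun_mul dre).fun_add (dim.fun_mul dim))

theorem hasDerivAt_sigmaPt_radial {g : Pt → ℝ} {r : ℝ} {q : ℝ × ℝ}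
    (hg : DifferentiableAt ℝ g (sigmaPt (r, q))) :
    HasDerivAt (fun r => g (sigmaPt (r, q))) (pd 1 g (sigmaPt (r, q))) r := by
  have h : HasDerivAt (fun r => sigmaPt (r, q)) (Pi.single 1 1) r := by
    refine hasDerivAt_pi.2 fun μ => ?_
    fin_cases μ
    · exact hasDerivAt_const r (0 : ℝ)
    · exact hasDerivAt_id r
    · exact hasDerivAt_const r q.1
    · exact hasDerivAt_const r q.2
  exact hg.hasFDerivAt.comp_hasDerivAt r h

theorem IsDebye.continuousAt_ernstZForm (h : IsDebye M f y s) (hM : 0 < M) {x : Pt}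
    (hx : x ∈ exterior M) : ContinuousAt (ernstZForm M y) x := by
  have hr : x 1 ≠ 0 := (r_pos hM (exterior_subset M hx)).ne'
  have hr' : x 1 - 2 * M ≠ 0 := (sub_pos.2 hx.1).ne'
  have hsin : Real.sin (x 2) ≠ 0 := (sin_pos_of_mem hx).ne'
  have hy := (h.smooth_y x (exterior_subset M hx)).continuousAt
  have hy' := fun μ => (contDiffAt_pd (h.smooth_y x (exterior_subset M hx)) μ).continuousAt
  have c0 : ContinuousAt (fun x : Pt => x 1) x := (continuous_apply 1).continuousAt
  have cr : ContinuousAt (fun x : Pt => x 1 - 2 * M) x := c0.sub continuousAt_const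
  have csin : ContinuousAt (fun x : Pt => Real.sin (x 2)) x :=
    (Real.continuous_sin.comp (continuous_apply 2)).continuousAt
  have ccos : ContinuousAt (fun x : Pt => Real.cos (x 2)) x :=
    (Real.continuous_cos.comp (continuous_apply 2)).continuousAt
  have ci : ContinuousAt (fun x : Pt => (x 1 : ℂ)⁻¹) x :=
    (Complex.continuous_ofReal.continuousAt.comp c0).inv₀ (Complex.ofReal_ne_zero.2 hr)
  have c2 : ContinuousAt (fun x : Pt => 1 / x 1 ^ 2) x :=
    continuousAt_const.div (c0.pow 2) (pow_ne_zero 2 hr)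
  exact csin.mul ((((c0.div cr hr').mul ((hy' 0).norm.pow 2)).add ((cr.div c0 hr).mul
    ((((hy' 1).sub (ci.mul hy)).norm.pow 2).add (c2.mul (hy.norm.pow 2))))).add
    (c2.mul (((hy' 2).norm.pow 2).add (((ccos.div csin hsin).pow 2).mul (hy.norm.pow 2)))))

/-- Supplies the integrability of |y|²/r² that excludes boundary values at the horizon and at
infinity. -/
theorem sin_mul_norm_sq_le_pasqForm (hM : 0 < M) {x : Pt} (hx : x ∈ exterior M) :
    Real.sin (x 2) * ‖y x‖ ^ 2 / x 1 ^ 2 ≤ 2 * pasqForm M y x := by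
  have hr : 0 < x 1 := r_pos hM (exterior_subset M hx)
  have hr' : 0 < x 1 - 2 * M := sub_pos.2 hx.1
  have hsin := sin_pos_of_mem hx
  have e : 2 * pasqForm M y x = Real.sin (x 2) * ‖y x‖ ^ 2 / x 1 ^ 2 + 2 * (Real.sin (x 2) *
      (x 1 / (4 * (x 1 - 2 * M)) * (‖outDeriv M y x‖ ^ 2 + ‖inDeriv M y x‖ ^ 2)
      + 1 / (4 * x 1 ^ 2) * (‖dPlus y x‖ ^ 2 + ‖dMinus y x‖ ^ 2))) := by
    rw [pasqForm]; field_simp; ring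
  rw [e]
  exact le_add_of_nonneg_right (by positivity)

/-- The radial derivative is the difference of two integrable densities, so it is integrable and
Fubini applies; along almost every ray its integral is zero. -/
theorem IsDebyeOf.integral_ernstZForm (h : IsDebyeOf M φ f y s) (hM : 0 < M)
    (ha : IsAxisymmetric M φ)
    (hi : IntegrableOn (fun p => pasqForm M y (sigmaPt p)) (sigmaRegion M)) :
    IntegrableOn (fun p => ernstZForm M y (sigmaPt p)) (sigmaRegion M) ∧
    ∫ p in sigmaRegion M, ernstZForm M y (sigmaPt p) =
      2 * ∫ p in sigmaRegion M, pasqForm M y (sigmaPt p) := by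
  have mR := measurableSet_sigmaRegion M
  have y3 := fun {x} (hx : x ∈ exterior M) => (h.axisymmetric hM ha hx).1
  have hZ : IntegrableOn (fun p => ernstZForm M y (sigmaPt p)) (sigmaRegion M) := by
    refine (hi.const_mul 6).mono' ((continuousOn_sigma fun x hx =>
      h.toIsDebye.continuousAt_ernstZForm hM hx).aestronglyMeasurable mR)
      (ae_restrict_of_forall_mem mR fun p hp => ?_)
    have hx := sigmaPt_mem hp
    rw [Real.norm_of_nonneg (ernstZForm_nonneg hM hx)]
    exact ernstZForm_le hM hx (y3 hx)
  refine ⟨hZ, ?_⟩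
  have hu : IntegrableOn (fun p => Real.sin (sigmaPt p 2) * ‖y (sigmaPt p)‖ ^ 2 / sigmaPt p 1 ^ 2)
      (sigmaRegion M) := by
    refine (hi.const_mul 2).mono' ((continuousOn_sigma
      (F := fun x => Real.sin (x 2) * ‖y x‖ ^ 2 / x 1 ^ 2) fun x hx => ?_).aestronglyMeasurable mR)
      (ae_restrict_of_forall_mem mR fun p hp => ?_)
    · have hr : x 1 ≠ 0 := (r_pos hM (exterior_subset M hx)).ne'
      have hy := (h.smooth_y x (exterior_subset M hx)).continuousAt
      exact ((Real.continuous_sin.comp (continuous_apply 2)).continuousAt.mul (hy.norm.pow 2)).div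
        ((continuous_apply 1).continuousAt.pow 2) (pow_ne_zero 2 hr)
    · have hx := sigmaPt_mem hp
      have hsin := sin_pos_of_mem hx
      rw [Real.norm_of_nonneg (by positivity)]
      exact sin_mul_norm_sq_le_pasqForm hM hx
  set D : ℝ × ℝ × ℝ → ℝ := fun p => Real.sin (sigmaPt p 2) * pd 1 (bdryRadial M y) (sigmaPt p)
    with hD
  have eD : ∀ p ∈ sigmaRegion M,
      2 * pasqForm M y (sigmaPt p) - ernstZForm M y (sigmaPt p) = D p := fun p hp => by
    have hx := sigmaPt_mem hp
    rw [ernstZForm_eq hM hx (h.smooth_y _ (exterior_subset M hx)).diffAt (y3 hx), hD]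
    ring
  have hDi : IntegrableOn D (sigmaRegion M) :=
    IntegrableOn.congr_fun ((hi.const_mul 2).sub hZ) eD mR
  have hD0 : ∫ p in sigmaRegion M, D p = 0 := by
    rw [IntegrableOn, volume_sigmaRegion] at hDi hu
    -- The r-integral is done first, at fixed angles. For almost every direction both the derivative
    -- and |y|²/r² are integrable along the ray, as the one-dimensional lemma requires.
    rw [volume_sigmaRegion, integral_prod_symm _ hDi]
    refine integral_eq_zero_of_ae ?_
    filter_upwards [hDi.prod_left_ae, hu.prod_left_ae, ae_restrict_mem measurableSet_angleBox]
      with q h1 h2 hq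
    have hx : ∀ r ∈ Ioi (2 * M), sigmaPt (r, q) ∈ exterior M := fun r hr =>
      sigmaPt_mem (M := M) (p := (r, q)) ⟨hr, hq⟩
    refine integral_radial_deriv_eq_zero (a := 2 * M) (by linarith)
      (u := fun r => Real.sin (sigmaPt (r, q) 2) * ‖y (sigmaPt (r, q))‖ ^ 2)
      (fun r hr => mul_nonneg (sin_pos_of_mem (hx r hr)).le (sq_nonneg _)) (fun r hr => ?_) h1 h2
    have hd := (hasDerivAt_sigmaPt_radial (differentiableAt_bdryRadial hM (hx r hr)
      (h.smooth_y _ (exterior_subset M (hx r hr))).diffAt)).const_mul (Real.sin q.1)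
    refine hd.congr_of_eventuallyEq (Filter.Eventually.of_forall fun r => ?_)
    change (r - 2 * M) / r ^ 2 * (Real.sin q.1 * ‖y (sigmaPt (r, q))‖ ^ 2) =
      Real.sin q.1 * ((r - 2 * M) / r ^ 2 * ‖y (sigmaPt (r, q))‖ ^ 2)
    ring
  have := integral_sub (hi.const_mul 2) hZ
  rw [setIntegral_congr_fun mR eD, hD0, integral_const_mul] at this
  linarith

end Debye

/-! ### Energies of Hertz potentials -/

theorem sigma_congr {M : ℝ} {f g : Pt → ℝ} (h : ∀ x ∈ exterior M, f x * sigmaVol M x = g x) :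
    (SigmaIntegrable M f ↔ IntegrableOn (fun p => g (sigmaPt p)) (sigmaRegion M)) ∧
    sigmaIntegral M f = ∫ p in sigmaRegion M, g (sigmaPt p) :=
  ⟨integrableOn_congr_fun (fun _ hp => h _ (sigmaPt_mem hp)) (measurableSet_sigmaRegion M),
    setIntegral_congr_fun (measurableSet_sigmaRegion M) fun _ hp => h _ (sigmaPt_mem hp)⟩

/-- Both densities, multiplied by the volume element, become the forms in `y` and `s`, whose
integrals agree by the divergence argument. -/
theorem IsHertzPotential.energy {M : ℝ} (hM : 0 < M) {φ : Pt → ℂ} (hφ : IsHertzPotential M φ) :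
    (SigmaIntegrable M (canonicalDensity M (hertzA M φ)) ↔
        SigmaIntegrable M (pasqScalarDensity M (chi M φ))) ∧
    sigmaIntegral M (canonicalDensity M (hertzA M φ)) =
      sigmaIntegral M (pasqScalarDensity M (chi M φ)) := by
  obtain ⟨f, y, s, h⟩ := hφ.exists_isDebyeOf hM
  obtain ⟨i1, e1⟩ := sigma_congr fun x hx => h.canonicalDensity_eq hM hx
  obtain ⟨i2, e2⟩ := sigma_congr fun x hx => pasqScalarDensity_eq hM h.smooth_y h.chi_eq hx
  obtain ⟨i3, e3⟩ := h.toIsDebye.integral_canonForm hM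
  exact ⟨i1.trans (i3.trans i2.symm), e1.trans (e3.trans e2.symm)⟩

theorem IsHertzPotential.ernst_energy {M : ℝ} (hM : 0 < M) {φ : Pt → ℂ}
    (hφ : IsHertzPotential M φ) (ha : IsAxisymmetric M φ)
    (hi : SigmaIntegrable M (canonicalDensity M (hertzA M φ))) :
    (SigmaIntegrable M (ernstDensity M (ernst M φ)) ∧
      sigmaIntegral M (ernstDensity M (ernst M φ)) =
        2 * sigmaIntegral M (canonicalDensity M (hertzA M φ))) ∧
    (SigmaIntegrable M (ernstDensityZ M (ernst M φ)) ∧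
      sigmaIntegral M (ernstDensityZ M (ernst M φ)) =
        2 * sigmaIntegral M (canonicalDensity M (hertzA M φ))) := by
  obtain ⟨f, y, s, h⟩ := hφ.exists_isDebyeOf hM
  obtain ⟨i1, e1⟩ := sigma_congr fun x hx => h.canonicalDensity_eq hM hx
  obtain ⟨i2, e2⟩ := sigma_congr (g := fun x => 2 * canonForm M y s x)
    fun x hx => h.ernstDensity_eq hM ha hx
  obtain ⟨i3, e3⟩ := sigma_congr fun x hx => h.ernstDensityZ_eq hM ha hx
  obtain ⟨i4, e4⟩ := h.toIsDebye.integral_canonForm hM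
  obtain ⟨i5, e5⟩ := h.integral_ernstZForm hM ha (i4.1 (i1.1 hi))
  refine ⟨⟨i2.2 ((i1.1 hi).const_mul 2), ?_⟩, i3.2 i5, ?_⟩
  · rw [e2, e1, integral_const_mul]
  · rw [e3, e5, e1, e4]

end SchwarzschildEM

namespace SchwarzschildEM

/-! ### The rescaled Maxwell component as a Debye potential -/

section Maxwell

variable {M : ℝ} {A : Fin 4 → Pt → ℂ} {f y s : Pt → ℂ}

/-- The densitized inverse-metric factor of each component splits as a function of r times a
function of θ, so a single product rule covers all six components. -/
theorem pd_densitized_raise₂ {x : Pt} (hx : x ∈ exterior M) {F : Fin 4 → Fin 4 → Pt → ℂ}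
    {c d : ℝ → ℝ} {c' d' : ℝ} (hc : HasDerivAt c c' (x 1)) (hd : HasDerivAt d d' (x 2))
    {a b : Fin 4} (hF : DifferentiableAt ℝ (F a b) x)
    (hk : ∀ z ∈ exterior M, sqrtDetMetric z * (gInv M z a * gInv M z b) = c (z 1) * d (z 2))
    (μ : Fin 4) : pd μ (fun y => (sqrtDetMetric y : ℂ) * raise₂ M F a b y) x =
      (if μ = 1 then (c' : ℂ) * ((d (x 2) : ℂ) * F a b x) else 0)
      + (c (x 1) : ℂ) * ((if μ = 2 then (d' : ℂ) * F a b x else 0)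
        + (d (x 2) : ℂ) * pd μ (F a b) x) := by
  have hdF := (diff_cast_coord hd.differentiableAt).fun_mul hF
  rw [pd_congr_exterior (g := fun y => (c (y 1) : ℂ) * ((d (y 2) : ℂ) * F a b y))
    (fun z hz => ?_) hx, pd_coord_mul hc hdF, pd_coord_mul hd hF]
  have := congrArg (Complex.ofReal) (hk z hz)
  push_cast at this
  rw [raise₂_eq]
  linear_combination F a b z * this

/-- The components of the source-free Maxwell equation. -/
theorem IsMaxwell.components (hM : 0 < M) (hA : ∀ x ∈ exterior M, ∀ μ, ContDiffAt ℝ ∞ (A μ) x)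
    (h : IsMaxwell M (fieldStrength A)) {x : Pt} (hx : x ∈ exterior M) :
    ((x 1 : ℂ) - 2 * M) * Real.sin (x 2) * (2 * x 1 * fieldStrength A 0 1 x
        + x 1 ^ 2 * pd 1 (fieldStrength A 0 1) x)
      + x 1 * (Real.cos (x 2) * fieldStrength A 0 2 x
        + Real.sin (x 2) * pd 2 (fieldStrength A 0 2) x
        + (Real.sin (x 2) : ℂ)⁻¹ * pd 3 (fieldStrength A 0 3) x) = 0 ∧
    Real.sin (x 2) * x 1 ^ 3 * pd 0 (fieldStrength A 0 1) x
      + ((x 1 : ℂ) - 2 * M) * (Real.cos (x 2) * fieldStrength A 1 2 x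
        + Real.sin (x 2) * pd 2 (fieldStrength A 1 2) x
        + (Real.sin (x 2) : ℂ)⁻¹ * pd 3 (fieldStrength A 1 3) x) = 0 ∧
    x 1 ^ 3 * pd 0 (fieldStrength A 0 2) x
      - ((x 1 : ℂ) - 2 * M) * (2 * M * fieldStrength A 1 2 x
        + x 1 * ((x 1 : ℂ) - 2 * M) * pd 1 (fieldStrength A 1 2) x)
      + ((x 1 : ℂ) - 2 * M) * ((Real.sin (x 2) : ℂ)⁻¹) ^ 2 * pd 3 (fieldStrength A 2 3) x = 0 ∧
    x 1 ^ 3 * pd 0 (fieldStrength A 0 3) x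
      - ((x 1 : ℂ) - 2 * M) * (2 * M * fieldStrength A 1 3 x
        + x 1 * ((x 1 : ℂ) - 2 * M) * pd 1 (fieldStrength A 1 3) x)
      - ((x 1 : ℂ) - 2 * M) * (pd 2 (fieldStrength A 2 3) x
        - Real.cos (x 2) * (Real.sin (x 2) : ℂ)⁻¹ * fieldStrength A 2 3 x) = 0 := by
  have hr : 0 < x 1 := r_pos hM (exterior_subset M hx)
  have hr' : 0 < x 1 - 2 * M := sub_pos.2 hx.1
  have hsin := sin_pos_of_mem hx
  have e1 : (x 1 : ℂ) ≠ 0 := by exact_mod_cast hr.ne'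
  have e2 : ((x 1 : ℂ) - 2 * M) ≠ 0 := by exact_mod_cast hr'.ne'
  have e3 : (Real.sin (x 2) : ℂ) ≠ 0 := by exact_mod_cast hsin.ne'
  have dF : ∀ a b, DifferentiableAt ℝ (fieldStrength A a b) x := fun a b =>
    (contDiffAt_fieldStrength (hA x hx) a b).diffAt
  have d1 : HasDerivAt (fun θ : ℝ => Real.sin θ) (Real.cos (x 2)) (x 2) := Real.hasDerivAt_sin _
  have d2 : HasDerivAt (fun θ : ℝ => (Real.sin θ)⁻¹) (-Real.cos (x 2) / Real.sin (x 2) ^ 2) (x 2) :=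
    d1.inv hsin.ne'
  have c1 : HasDerivAt (fun r : ℝ => -r ^ 2) (-(2 * x 1)) (x 1) := by
    simpa using (hasDerivAt_pow 2 (x 1)).fun_neg
  have c2 : HasDerivAt (fun r : ℝ => -(r / (r - 2 * M)))
      (-((1 * (x 1 - 2 * M) - x 1 * 1) / (x 1 - 2 * M) ^ 2)) (x 1) :=
    ((hasDerivAt_id' (x 1)).div ((hasDerivAt_id' (x 1)).sub_const _) hr'.ne').neg
  have c3 : HasDerivAt (fun r : ℝ => (r - 2 * M) / r)
      ((1 * x 1 - (x 1 - 2 * M) * 1) / x 1 ^ 2) (x 1) :=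
    ((hasDerivAt_id' (x 1)).sub_const _).div (hasDerivAt_id' (x 1)) hr.ne'
  have c4 : HasDerivAt (fun r : ℝ => (r ^ 2)⁻¹) (-(2 * x 1) / (x 1 ^ 2) ^ 2) (x 1) := by
    have : HasDerivAt (fun r : ℝ => r ^ 2) (2 * x 1) (x 1) := by simpa using hasDerivAt_pow 2 (x 1)
    exact this.inv (by positivity)
  have k : ∀ z ∈ exterior M,
      (sqrtDetMetric z * (gInv M z 0 * gInv M z 1) = -z 1 ^ 2 * Real.sin (z 2)) ∧
      (sqrtDetMetric z * (gInv M z 0 * gInv M z 2) = -(z 1 / (z 1 - 2 * M)) * Real.sin (z 2)) ∧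
      (sqrtDetMetric z * (gInv M z 0 * gInv M z 3) = -(z 1 / (z 1 - 2 * M)) * (Real.sin (z 2))⁻¹) ∧
      (sqrtDetMetric z * (gInv M z 1 * gInv M z 2) = (z 1 - 2 * M) / z 1 * Real.sin (z 2)) ∧
      (sqrtDetMetric z * (gInv M z 1 * gInv M z 3) = (z 1 - 2 * M) / z 1 * (Real.sin (z 2))⁻¹) ∧
      (sqrtDetMetric z * (gInv M z 2 * gInv M z 3) = (z 1 ^ 2)⁻¹ * (Real.sin (z 2))⁻¹) := by
    intro z hz
    have hr : 0 < z 1 := r_pos hM (exterior_subset M hz)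
    have hr' : 0 < z 1 - 2 * M := sub_pos.2 hz.1
    have hsin := sin_pos_of_mem hz
    simp only [sqrtDetMetric, gInv, Delta, Matrix.cons_val]
    refine ⟨?_, ?_, ?_, ?_, ?_, ?_⟩ <;> field_simp
  have ks : ∀ {a b : Fin 4} {q : Pt → ℝ},
      (∀ z ∈ exterior M, sqrtDetMetric z * (gInv M z a * gInv M z b) = q z) →
      ∀ z ∈ exterior M, sqrtDetMetric z * (gInv M z b * gInv M z a) = q z := fun hq z hz => by
    rw [mul_comm (gInv M z _)]; exact hq z hz
  have k01 := fun z hz => (k z hz).1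
  have k02 := fun z hz => (k z hz).2.1
  have k03 := fun z hz => (k z hz).2.2.1
  have k12 := fun z hz => (k z hz).2.2.2.1
  have k13 := fun z hz => (k z hz).2.2.2.2.1
  have k23 := fun z hz => (k z hz).2.2.2.2.2
  have hz : ∀ μ, pd μ (fun y => (sqrtDetMetric y : ℂ) * raise₂ M (fieldStrength A) μ μ y) x = 0 :=
    fun μ => by simp only [raise₂_eq, fieldStrength_self, mul_zero, pd_const]
  have sw : ∀ a b, fieldStrength A a b = fun x => -fieldStrength A b a x := fun a b =>
    funext (fieldStrength_swap A b a)
  have hs : ((x 1 ^ 2 * Real.sin (x 2) : ℝ) : ℂ)⁻¹ ≠ 0 :=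
    inv_ne_zero (by exact_mod_cast (by positivity : (0 : ℝ) < x 1 ^ 2 * Real.sin (x 2)).ne')
  have eq : ∀ μ, ∑ ν, pd ν (fun y => (sqrtDetMetric y : ℂ) *
      raise₂ M (fieldStrength A) ν μ y) x = 0 := fun μ =>
    (mul_eq_zero.1 (h x hx μ)).resolve_left hs
  have E0 := eq 0
  have E1 := eq 1
  have E2 := eq 2
  have E3 := eq 3
  rw [Fin.sum_univ_four] at E0 E1 E2 E3
  rw [hz, pd_densitized_raise₂ hx c1 d1 (dF 1 0) (ks k01),
    pd_densitized_raise₂ hx c2 d1 (dF 2 0) (ks k02),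
    pd_densitized_raise₂ hx c2 d2 (dF 3 0) (ks k03), sw 1 0, sw 2 0, sw 3 0] at E0
  rw [hz, pd_densitized_raise₂ hx c1 d1 (dF 0 1) k01,
    pd_densitized_raise₂ hx c3 d1 (dF 2 1) (ks k12),
    pd_densitized_raise₂ hx c3 d2 (dF 3 1) (ks k13), sw 2 1, sw 3 1] at E1
  rw [hz, pd_densitized_raise₂ hx c2 d1 (dF 0 2) k02,
    pd_densitized_raise₂ hx c3 d1 (dF 1 2) k12,
    pd_densitized_raise₂ hx c4 d2 (dF 3 2) (ks k23), sw 3 2] at E2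
  rw [hz, pd_densitized_raise₂ hx c2 d2 (dF 0 3) k03,
    pd_densitized_raise₂ hx c3 d2 (dF 1 3) k13,
    pd_densitized_raise₂ hx c4 d2 (dF 2 3) k23] at E3
  simp only [pd_neg, Fin.reduceEq, if_true, if_false] at E0 E1 E2 E3
  push_cast at E0 E1 E2 E3 e3 ⊢
  refine ⟨?_, ?_, ?_, ?_⟩
  · field_simp at E0 ⊢
    linear_combination E0
  · field_simp at E1 ⊢
    linear_combination -E1
  · field_simp at E2 ⊢
    linear_combination -E2
  · field_simp at E3 ⊢
    linear_combination -E3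

/-- The scalar `r² F_{tr} - i F_{θϕ} / sin θ`. -/
noncomputable def middleScalar (A : Fin 4 → Pt → ℂ) (x : Pt) : ℂ :=
  ((x 1 ^ 2 : ℝ) : ℂ) * fieldStrength A 0 1 x
    - Complex.I * ((((Real.sin (x 2))⁻¹ : ℝ) : ℂ) * fieldStrength A 2 3 x)

/-- The scalar `-½ (α_θ - i α_ϕ / sin θ)` with `α = (∂_t - N² ∂_r) ⌟ F`. -/
noncomputable def extremeScalar (M : ℝ) (A : Fin 4 → Pt → ℂ) (x : Pt) : ℂ :=
  -(1 / 2) * ((fieldStrength A 0 2 x - (((x 1 - 2 * M) / x 1 : ℝ) : ℂ) * fieldStrength A 1 2 x)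
    - Complex.I * ((((Real.sin (x 2))⁻¹ : ℝ) : ℂ) * (fieldStrength A 0 3 x
      - (((x 1 - 2 * M) / x 1 : ℝ) : ℂ) * fieldStrength A 1 3 x)))

theorem hasDerivAt_inv_sin {x : Pt} (hx : x ∈ exterior M) : HasDerivAt (fun θ : ℝ => (Real.sin θ)⁻¹)
    (-Real.cos (x 2) / Real.sin (x 2) ^ 2) (x 2) :=
  (Real.hasDerivAt_sin _).inv (sin_pos_of_mem hx).ne'

theorem hasDerivAt_lapse_sq (hM : 0 < M) {x : Pt} (hx : x ∈ exterior M) :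
    HasDerivAt (fun r : ℝ => (r - 2 * M) / r) ((1 * x 1 - (x 1 - 2 * M) * 1) / x 1 ^ 2) (x 1) :=
  ((hasDerivAt_id' (x 1)).sub_const _).div (hasDerivAt_id' (x 1)) (r_pos hM (exterior_subset M hx)).ne'

theorem contDiffAt_middleScalar {x : Pt} (hx : x ∈ exterior M)
    (hA : ∀ μ, ContDiffAt ℝ ∞ (A μ) x) : ContDiffAt ℝ ∞ (middleScalar A) x := by
  have h1 := (contDiff_coord_ofReal (c := fun r : ℝ => r ^ 2) (by fun_prop) 1).contDiffAt (x := x)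
  have h2 : ContDiffAt ℝ ∞ (fun x : Pt => (((Real.sin (x 2))⁻¹ : ℝ) : ℂ)) x :=
    Complex.ofRealCLM.contDiff.contDiffAt.comp x (ContDiffAt.inv
      (Real.contDiff_sin.comp (contDiff_apply ℝ ℝ 2)).contDiffAt (sin_pos_of_mem hx).ne')
  exact (h1.mul (contDiffAt_fieldStrength hA 0 1)).sub
    (contDiffAt_const.mul (h2.mul (contDiffAt_fieldStrength hA 2 3)))

theorem pd_middleScalar {x : Pt} (hx : x ∈ exterior M) (hA : ∀ μ, ContDiffAt ℝ ∞ (A μ) x)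
    (μ : Fin 4) : pd μ (middleScalar A) x =
      (if μ = 1 then ((2 * x 1 : ℝ) : ℂ) * fieldStrength A 0 1 x else 0)
      + ((x 1 ^ 2 : ℝ) : ℂ) * pd μ (fieldStrength A 0 1) x
      - Complex.I * ((if μ = 2 then ((-Real.cos (x 2) / Real.sin (x 2) ^ 2 : ℝ) : ℂ)
          * fieldStrength A 2 3 x else 0)
        + (((Real.sin (x 2))⁻¹ : ℝ) : ℂ) * pd μ (fieldStrength A 2 3) x) := by
  have dF : ∀ a b, DifferentiableAt ℝ (fieldStrength A a b) x := fun a b =>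
    (contDiffAt_fieldStrength hA a b).diffAt
  have h1 : HasDerivAt (fun r : ℝ => r ^ 2) (2 * x 1) (x 1) := by simpa using hasDerivAt_pow 2 (x 1)
  have h2 := hasDerivAt_inv_sin hx
  have d1 := (diff_cast_coord h1.differentiableAt).fun_mul (dF 0 1)
  have d2 := (diff_cast_coord h2.differentiableAt).fun_mul (dF 2 3)
  refine (pd_sub d1 (d2.const_mul _) μ).trans ?_
  rw [pd_coord_mul h1 (dF 0 1), pd_const_mul _ d2, pd_coord_mul h2 (dF 2 3)]

theorem pd_extremeScalar (hM : 0 < M) {x : Pt} (hx : x ∈ exterior M)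
    (hA : ∀ μ, ContDiffAt ℝ ∞ (A μ) x) (μ : Fin 4) : pd μ (extremeScalar M A) x =
      -(1 / 2) * (pd μ (fieldStrength A 0 2) x
        - ((if μ = 1 then (((1 * x 1 - (x 1 - 2 * M) * 1) / x 1 ^ 2 : ℝ) : ℂ)
            * fieldStrength A 1 2 x else 0)
          + (((x 1 - 2 * M) / x 1 : ℝ) : ℂ) * pd μ (fieldStrength A 1 2) x)
        - Complex.I * ((if μ = 2 then ((-Real.cos (x 2) / Real.sin (x 2) ^ 2 : ℝ) : ℂ)
            * (fieldStrength A 0 3 x - (((x 1 - 2 * M) / x 1 : ℝ) : ℂ) * fieldStrength A 1 3 x)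
            else 0)
          + (((Real.sin (x 2))⁻¹ : ℝ) : ℂ) * (pd μ (fieldStrength A 0 3) x
            - ((if μ = 1 then (((1 * x 1 - (x 1 - 2 * M) * 1) / x 1 ^ 2 : ℝ) : ℂ)
                * fieldStrength A 1 3 x else 0)
              + (((x 1 - 2 * M) / x 1 : ℝ) : ℂ) * pd μ (fieldStrength A 1 3) x)))) := by
  have dF : ∀ a b, DifferentiableAt ℝ (fieldStrength A a b) x := fun a b =>
    (contDiffAt_fieldStrength hA a b).diffAt
  have h1 := hasDerivAt_lapse_sq hM hx
  have h2 := hasDerivAt_inv_sin hx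
  have c1 := diff_cast_coord (x := x) (ν := 1) h1.differentiableAt
  have d1 := (dF 0 2).fun_sub (c1.fun_mul (dF 1 2))
  have d2 := (dF 0 3).fun_sub (c1.fun_mul (dF 1 3))
  have d3 := (diff_cast_coord (x := x) h2.differentiableAt).fun_mul d2
  refine (pd_const_mul _ (d1.fun_sub (d3.const_mul _)) μ).trans ?_
  rw [pd_sub d1 (d3.const_mul _), pd_sub (dF 0 2) (c1.fun_mul (dF 1 2)),
    pd_coord_mul h1 (dF 1 2), pd_const_mul _ d3, pd_coord_mul h2 d2,
    pd_sub (dF 0 3) (c1.fun_mul (dF 1 3)), pd_coord_mul h1 (dF 1 3)]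

/-- With P = -2 r² φ̂₁ the middle scalar, these are the Newman–Penrose Maxwell equations relating
φ̂₁ and φ̂₂: each derivative of the extreme scalar equals a derivative of P. -/
theorem IsDebyeData.eq_of_maxwell (h : IsDebyeData M f y s) (hM : 0 < M)
    (hA : ∀ x ∈ exterior M, ∀ μ, ContDiffAt ℝ ∞ (A μ) x) (hF : IsMaxwell M (fieldStrength A))
    (hf : ∀ x ∈ exterior M, f x = extremeScalar M A x) {x : Pt} (hx : x ∈ exterior M) :
    s x = -(1 / 2) * (pd 0 (middleScalar A) x
      - (((x 1 - 2 * M) / x 1 : ℝ) : ℂ) * pd 1 (middleScalar A) x) ∧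
    y x = -(1 / 2) * (pd 2 (middleScalar A) x
      - Complex.I * ((((Real.sin (x 2))⁻¹ : ℝ) : ℂ) * pd 3 (middleScalar A) x)) := by
  have hr : 0 < x 1 := r_pos hM (exterior_subset M hx)
  have hr' : 0 < x 1 - 2 * M := sub_pos.2 hx.1
  have hsin := sin_pos_of_mem hx
  have e1 : (x 1 : ℂ) ≠ 0 := by exact_mod_cast hr.ne'
  have e2 : ((x 1 : ℂ) - 2 * M) ≠ 0 := by exact_mod_cast hr'.ne'
  have e3 : (Real.sin (x 2) : ℂ) ≠ 0 := by exact_mod_cast hsin.ne'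
  obtain ⟨m0, m1, m2, m3⟩ := hF.components hM hA hx
  have hsw : ∀ a b c : Fin 4, pd a (fieldStrength A b c) x = -pd a (fieldStrength A c b) x := by
    intro a b c
    rw [← pd_neg]
    exact congrArg (fun f => pd a f x) (funext fun y => fieldStrength_swap A c b y)
  have b023 := bianchi (hA x hx) 0 2 3
  have b123 := bianchi (hA x hx) 1 2 3
  have b012 := bianchi (hA x hx) 0 1 2
  have b013 := bianchi (hA x hx) 0 1 3
  rw [hsw 2 3 0] at b023
  rw [hsw 2 3 1] at b123
  rw [hsw 1 2 0] at b012
  rw [hsw 1 3 0] at b013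
  have hs := h.s_eq x (exterior_subset M hx)
  have hy := h.y_eq x (exterior_subset M hx)
  have pf : ∀ μ, pd μ f x = _ := fun μ =>
    (pd_congr_exterior hf hx μ).trans (pd_extremeScalar hM hx (hA x hx) μ)
  rw [pf, pf, hf x hx, extremeScalar] at hs
  rw [pf, pf] at hy
  have pm := pd_middleScalar hx (hA x hx)
  rw [pm, pm, pm, pm]
  have hI := Complex.I_sq
  simp only [Fin.reduceEq, if_true, if_false] at hs hy ⊢
  refine ⟨mul_left_cancel₀ e3 (hs.trans ?_), hy.trans ?_⟩
  · clear hs hy pf pm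
    push_cast at e3 m0 m1 ⊢
    -- The t and r components of the Maxwell equation give the real-type part, the Bianchi
    -- identities for (t, θ, ϕ) and (r, θ, ϕ) the part multiplied by i.
    linear_combination (norm := skip) (-1 / (2 * (x 1 : ℂ))) * m0 + 1 / (2 * (x 1 : ℂ)) * m1
      - Complex.I / 2 * b023 + ((x 1 : ℂ) - 2 * M) / x 1 * Complex.I / 2 * b123
      + 1 / 2 * (Complex.sin (x 2))⁻¹ * (pd 3 (fieldStrength A 0 3) x
        - ((x 1 : ℂ) - 2 * M) / x 1 * pd 3 (fieldStrength A 1 3) x) * hI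
    field_simp
    ring
  · clear hs hy pf pm
    push_cast at e3 m2 m3 ⊢
    -- Here the θ and ϕ components of the Maxwell equation combine with the Bianchi identities for
    -- (t, r, θ) and (t, r, ϕ).
    linear_combination (norm := skip) (-1 / (2 * ((x 1 : ℂ) - 2 * M))) * m2
      + 1 / 2 * (x 1 : ℂ) ^ 2 * b012
      + Complex.I * (Complex.sin (x 2))⁻¹ / (2 * ((x 1 : ℂ) - 2 * M)) * m3
      - Complex.I * (Complex.sin (x 2))⁻¹ / 2 * (x 1 : ℂ) ^ 2 * b013
      + 1 / 2 * (Complex.sin (x 2))⁻¹ ^ 2 * pd 3 (fieldStrength A 2 3) x * hI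
    field_simp
    ring

/-- As `s` is the ingoing derivative of the middle scalar and `y` its ð'-type derivative, the
Teukolsky equation says only that these two operators commute. -/
theorem IsDebyeData.isDebye_of_maxwell (h : IsDebyeData M f y s) (hM : 0 < M)
    (hA : ∀ x ∈ exterior M, ∀ μ, ContDiffAt ℝ ∞ (A μ) x) (hF : IsMaxwell M (fieldStrength A))
    (hf : ∀ x ∈ exterior M, f x = extremeScalar M A x) : IsDebye M f y s := by
  refine ⟨h, fun x hx => ?_⟩
  have e1 : (x 1 : ℂ) ≠ 0 := by exact_mod_cast (r_pos hM (exterior_subset M hx)).ne'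
  have e3 : (Real.sin (x 2) : ℂ) ≠ 0 := by exact_mod_cast (sin_pos_of_mem hx).ne'
  have hp := contDiffAt_middleScalar hx (hA x hx)
  have dp : ∀ μ, DifferentiableAt ℝ (pd μ (middleScalar A)) x := fun μ =>
    (contDiffAt_pd hp μ).diffAt
  have h1 := (hasDerivAt_lapse_sq hM hx).differentiableAt
  have h2 := (hasDerivAt_inv_sin hx).differentiableAt
  have ps : ∀ μ ≠ 1, pd μ s x = -(1 / 2) * (pd μ (pd 0 (middleScalar A)) x
      - (((x 1 - 2 * M) / x 1 : ℝ) : ℂ) * pd μ (pd 1 (middleScalar A)) x) := fun μ hμ => by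
    have d1 := (diff_cast_coord h1).fun_mul (dp 1)
    rw [pd_congr_exterior (fun z hz => (h.eq_of_maxwell hM hA hF hf hz).1) hx,
      pd_const_mul _ ((dp 0).fun_sub d1), pd_sub (dp 0) d1, pd_coord_mul_of_ne h1 (dp 1) hμ]
  have py : ∀ μ ≠ 2, pd μ y x = -(1 / 2) * (pd μ (pd 2 (middleScalar A)) x
      - Complex.I * ((((Real.sin (x 2))⁻¹ : ℝ) : ℂ) * pd μ (pd 3 (middleScalar A)) x)) :=
    fun μ hμ => by
    have d1 := (diff_cast_coord h2).fun_mul (dp 3)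
    rw [pd_congr_exterior (fun z hz => (h.eq_of_maxwell hM hA hF hf hz).2) hx,
      pd_const_mul _ ((dp 2).fun_sub (d1.const_mul _)), pd_sub (dp 2) (d1.const_mul _),
      pd_const_mul _ d1, pd_coord_mul_of_ne h2 (dp 3) hμ]
  rw [ps 2 (by decide), ps 3 (by decide), py 0 (by decide), py 1 (by decide), pd_comm hp 0 2,
    pd_comm hp 0 3, pd_comm hp 1 2, pd_comm hp 1 3]
  push_cast at e3 ⊢
  field_simp
  ring

end Maxwell

end SchwarzschildEM

namespace SchwarzschildEM

/-! ### Smoothness of the rescaled Maxwell component -/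

section Smooth

variable {M : ℝ}

theorem contDiffAt_cart_ofReal (k : Fin 4) (x : Pt) : ContDiffAt ℝ ∞ (fun y => (cart y k : ℂ)) x :=
  (Complex.ofRealCLM.contDiff.comp (contDiff_cart k)).contDiffAt

theorem IsSmoothOneForm.contDiffAt (hM : 0 < M) {W : Fin 4 → Pt → ℂ} (h : IsSmoothOneForm M W)
    {x : Pt} (hx : x ∈ exterior M) (μ : Fin 4) : ContDiffAt ℝ ∞ (W μ) x := by
  obtain ⟨w, hw, hW⟩ := h
  refine ContDiffAt.congr_of_eventuallyEq (ContDiffAt.sum fun ν _ => ?_)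
    (eventuallyEq_of_exterior (fun z hz => hW z hz μ) hx)
  exact ((hw ν).comp_cart hM x (exterior_subset M hx)).mul
    (contDiffAt_pd (contDiffAt_cart_ofReal ν x) μ)

/-- The field strength is compatible with the pull-back. -/
theorem fieldStrength_pullback (hM : 0 < M) {W : Fin 4 → Pt → ℂ} {w : Fin 4 → (Fin 4 → ℝ) → ℂ}
    (hw : ∀ ν, ContDiffOn ℝ ∞ (w ν) (cartRange M))
    (hW : ∀ x ∈ exterior M, ∀ μ, W μ x = ∑ ν, w ν (cart x) * pd μ (fun y => (cart y ν : ℂ)) x)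
    {x : Pt} (hx : x ∈ exterior M) (μ ν : Fin 4) : fieldStrength W μ ν x =
      ∑ j, ∑ k, fieldStrength w j k (cart x) * pd μ (fun y => (cart y j : ℂ)) x
        * pd ν (fun y => (cart y k : ℂ)) x := by
  have hx' := exterior_subset M hx
  have dC := fun k μ => (contDiffAt_pd (contDiffAt_cart_ofReal k x) μ).diffAt
  have dw := fun k => ((hw k).comp_cart hM x hx').diffAt
  have hcomp : ∀ k μ, pd μ (fun y => w k (cart y)) x =
      ∑ j, pd j (w k) (cart x) * pd μ (fun y => (cart y j : ℂ)) x := fun k μ => by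
    rw [pd_comp (diffAt_cart_field hM hw hx' k) fun ν => (contDiff_cart ν).contDiffAt.diffAt]
    refine Finset.sum_congr rfl fun j _ => ?_
    rw [pd_ofReal (contDiff_cart j).contDiffAt.diffAt, Complex.real_smul, mul_comm]
  have hpd : ∀ μ ν, pd μ (W ν) x = (∑ k, ∑ j, pd j (w k) (cart x)
      * pd μ (fun y => (cart y j : ℂ)) x * pd ν (fun y => (cart y k : ℂ)) x)
      + ∑ k, w k (cart x) * pd μ (pd ν (fun y => (cart y k : ℂ))) x := fun μ ν => by
    rw [pd_congr_exterior (fun z hz => hW z hz ν) hx,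
      pd_sum _ fun k _ => (dw k).fun_mul (dC k ν), ← Finset.sum_add_distrib]
    refine Finset.sum_congr rfl fun k _ => ?_
    rw [pd_mul (dw k) (dC k ν), hcomp, Finset.sum_mul]
  rw [fieldStrength, hpd, hpd]
  simp only [pd_comm (contDiffAt_cart_ofReal _ x) μ ν, fieldStrength, sub_mul,
    Finset.sum_sub_distrib]
  rw [add_sub_add_right_eq_sub, Finset.sum_comm]
  congr 1
  exact Finset.sum_congr rfl fun k _ => Finset.sum_congr rfl fun j _ => by ring

theorem pd_zero_cart (k : Fin 4) (x : Pt) :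
    pd 0 (fun y => cart y k) x = if k = 0 then 1 else 0 := by
  have h := hasDerivAt_line (contDiff_cart k).contDiffAt.diffAt (x := x) 0
  refine h.unique ?_
  fin_cases k <;> simp [cart]
  · simpa using (hasDerivAt_id (0 : ℝ)).const_add (x 0)
  all_goals exact hasDerivAt_const _ _

theorem pd_one_cart {x : Pt} (hx : x 1 ≠ 0) (k : Fin 4) :
    pd 1 (fun y => cart y k) x = if k = 0 then 0 else cart x k / x 1 := by
  have h := hasDerivAt_line (contDiff_cart k).contDiffAt.diffAt (x := x) 1
  refine h.unique ?_
  have h1 : HasDerivAt (fun τ : ℝ => x 1 + τ) 1 0 := (hasDerivAt_id (0 : ℝ)).const_add (x 1)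
  fin_cases k <;> simp [cart]
  · exact hasDerivAt_const _ _
  · exact ((h1.mul_const _).mul_const _).congr_deriv (by field_simp)
  · exact ((h1.mul_const _).mul_const _).congr_deriv (by field_simp)
  · exact (h1.mul_const _).congr_deriv (by field_simp)

/-- The Cartesian components of `n`. -/
noncomputable def nCart (M : ℝ) (k : Fin 4) (y : Fin 4 → ℝ) : ℝ :=
  let R := √(y 1 ^ 2 + y 2 ^ 2 + y 3 ^ 2)
  if k = 0 then R ^ 2 / √(R * (R - 2 * M)) / (√2 * R)
  else -(√(R * (R - 2 * M)) / (√2 * R)) * (y k / R)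

theorem contDiffOn_radius (hM : 0 < M) :
    ContDiffOn ℝ ∞ (fun y : Fin 4 → ℝ => √(y 1 ^ 2 + y 2 ^ 2 + y 3 ^ 2)) (cartRange M) := by
  refine ContDiffOn.sqrt (by fun_prop) fun y hy h0 => ?_
  have : 2 * M < √(y 1 ^ 2 + y 2 ^ 2 + y 3 ^ 2) := hy
  rw [h0, Real.sqrt_zero] at this
  linarith

theorem contDiffOn_nCart (hM : 0 < M) (k : Fin 4) : ContDiffOn ℝ ∞ (nCart M k) (cartRange M) := by
  have hR := contDiffOn_radius hM
  have h0 : ∀ y ∈ cartRange M, 0 < √(y 1 ^ 2 + y 2 ^ 2 + y 3 ^ 2) ∧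
      0 < √(y 1 ^ 2 + y 2 ^ 2 + y 3 ^ 2) - 2 * M := fun y hy => by
    have : 2 * M < √(y 1 ^ 2 + y 2 ^ 2 + y 3 ^ 2) := hy
    exact ⟨by linarith, by linarith⟩
  have hq := (hR.mul (hR.sub (contDiffOn_const (c := 2 * M)))).sqrt
    fun y hy => (mul_pos (h0 y hy).1 (h0 y hy).2).ne'
  have h2R := (contDiffOn_const (c := √2)).mul hR
  have h2 : ∀ y ∈ cartRange M, √2 * √(y 1 ^ 2 + y 2 ^ 2 + y 3 ^ 2) ≠ 0 := fun y hy =>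
    mul_ne_zero (by norm_num) (h0 y hy).1.ne'
  by_cases hk : k = 0
  · simp only [funext fun y => show nCart M k y = _ from if_pos hk]
    exact ((hR.pow 2).div hq fun y hy =>
      (Real.sqrt_pos.2 (mul_pos (h0 y hy).1 (h0 y hy).2)).ne').div h2R h2
  · simp only [funext fun y => show nCart M k y = _ from if_neg hk]
    exact (hq.div h2R h2).neg.mul ((contDiff_apply ℝ ℝ k).contDiffOn.div hR
      fun y hy => (h0 y hy).1.ne')

theorem sum_nUp_cart (hM : 0 < M) {x : Pt} (hx : x ∈ exterior M) (k : Fin 4) :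
    ∑ ν, (nUp M x ν : ℂ) * pd ν (fun y => (cart y k : ℂ)) x = (nCart M k (cart x) : ℂ) := by
  have hr : 0 < x 1 := r_pos hM (exterior_subset M hx)
  have h : ∀ ν, pd ν (fun y => (cart y k : ℂ)) x = ((pd ν (fun y => cart y k) x : ℝ) : ℂ) :=
    fun ν => pd_ofReal (contDiff_cart k).contDiffAt.diffAt ν
  simp only [h]
  norm_cast
  rw [Fin.sum_univ_four, pd_zero_cart, pd_one_cart hr.ne']
  simp only [nCart, sqrt_cart hr.le, nUp, Matrix.cons_val]
  split_ifs <;> simp [Delta]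

/-- The one-form required is W_a = r² F_{ab} n^b. The vector n is radial plus temporal, hence smooth
in Cartesian coordinates across the axis, and F pulls back as a two-form. -/
theorem IsSmoothOneForm.isSmoothSpinNegOne (hM : 0 < M) {W : Fin 4 → Pt → ℂ}
    (h : IsSmoothOneForm M W) {φ : Pt → ℂ} (hφ : ∀ x ∈ exterior M, φ x = (x 1 : ℂ) ^ 2 *
      ∑ μ, ∑ ν, fieldStrength W μ ν x * star (mUp x μ) * (nUp M x ν : ℂ)) :
    IsSmoothSpinNegOne M φ := by
  obtain ⟨w, hw, hW⟩ := h
  change ∀ ν, ContDiffOn ℝ ∞ (w ν) (cartRange M) at hw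
  refine ⟨fun μ x => (x 1 : ℂ) ^ 2 * ∑ ν, fieldStrength W μ ν x * (nUp M x ν : ℂ),
    ⟨fun j y => ((√(y 1 ^ 2 + y 2 ^ 2 + y 3 ^ 2) : ℝ) : ℂ) ^ 2 *
      ∑ k, fieldStrength w j k y * (nCart M k y : ℂ), fun j => ?_, fun x hx μ => ?_⟩,
    fun x hx => ?_⟩
  · have c : ∀ {g : (Fin 4 → ℝ) → ℝ}, ContDiffOn ℝ ∞ g (cartRange M) →
        ContDiffOn ℝ ∞ (fun y => (g y : ℂ)) (cartRange M) := fun hg =>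
      Complex.ofRealCLM.contDiff.comp_contDiffOn hg
    exact ((c (contDiffOn_radius hM)).pow 2).mul (ContDiffOn.sum fun k _ =>
      ((contDiffOn_pd_cart hw j k).sub (contDiffOn_pd_cart hw k j)).mul (c (contDiffOn_nCart hM k)))
  · have hr : 0 < x 1 := r_pos hM (exterior_subset M hx)
    simp only [sqrt_cart hr.le, ← sum_nUp_cart hM hx, fieldStrength_pullback hM hw hW hx,
      Finset.mul_sum, Finset.sum_mul]
    rw [Finset.sum_comm]
    refine Finset.sum_congr rfl fun j _ => ?_
    rw [Finset.sum_comm]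
    exact Finset.sum_congr rfl fun k _ => Finset.sum_congr rfl fun ν _ => by ring
  · rw [hφ x hx, Finset.mul_sum]
    refine Finset.sum_congr rfl fun μ _ => ?_
    simp only [Finset.mul_sum, Finset.sum_mul]
    exact Finset.sum_congr rfl fun ν _ => by ring

/-- Comparison with φ = (r²/√Δ) f identifies the rescaled potential `f` with `extremeScalar`. -/
theorem sq_mul_maxwell_eq (hM : 0 < M) (A : Fin 4 → Pt → ℂ) {x : Pt} (hx : x ∈ exterior M) :
    (x 1 : ℂ) ^ 2 * ∑ μ, ∑ ν, fieldStrength A μ ν x * star (mUp x μ) * (nUp M x ν : ℂ) =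
      ((x 1 ^ 2 / √(Delta M x) : ℝ) : ℂ) * extremeScalar M A x := by
  have hr : 0 < x 1 := r_pos hM (exterior_subset M hx)
  have hD := Delta_pos hM (exterior_subset M hx)
  have hq : 0 < √(Delta M x) := Real.sqrt_pos.2 hD
  have hq2 : √(Delta M x) ^ 2 = x 1 * (x 1 - 2 * M) := Real.sq_sqrt hD.le
  have h2 : √2 ^ 2 = (2 : ℝ) := by norm_num
  have e1 : (x 1 : ℂ) ≠ 0 := by exact_mod_cast hr.ne'
  have e3 : (Real.sin (x 2) : ℂ) ≠ 0 := by exact_mod_cast (sin_pos_of_mem hx).ne'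
  have e4 : (√2 : ℂ) ≠ 0 := by exact_mod_cast (by norm_num : √2 ≠ 0)
  have e5 : (√(Delta M x) : ℂ) ≠ 0 := by exact_mod_cast hq.ne'
  have e6 : (√(Delta M x) : ℂ) ^ 2 = x 1 * (x 1 - 2 * M) := by exact_mod_cast hq2
  have e7 : (√2 : ℂ) ^ 2 = 2 := by exact_mod_cast h2
  rw [extremeScalar]
  simp only [Fin.sum_univ_four, mUp, nUp, Matrix.cons_val, fieldStrength_swap A 0 2,
    fieldStrength_swap A 1 2, fieldStrength_swap A 0 3, fieldStrength_swap A 1 3]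
  simp only [star_zero, star_div₀, star_one, Complex.star_def, Complex.conj_I, Complex.conj_ofReal]
  push_cast at e3 ⊢
  field_simp
  simp only [e6, e7]
  ring

end Smooth

end SchwarzschildEM

namespace SchwarzschildEM

/-! ### Pasqualotto's covector field -/

section Pasqualotto

variable {M : ℝ} {φ f y s g : Pt → ℂ}

/-- The radial derivatives `a`, `b` of the tt and rr entries stay unspecified: they do not enter the
Christoffel symbols with upper index θ or ϕ, and covectors tangent to the spheres need no others. -/
theorem exists_pd_metric (hM : 0 < M) {x : Pt} (hx : x ∈ exterior M) :
    ∃ a b : ℝ, ∀ μ α β, pd μ (fun y => metric M y α β) x = if α = β then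
      ![if μ = 1 then a else 0, if μ = 1 then b else 0, if μ = 1 then -(2 * x 1) else 0,
        -((if μ = 1 then 2 * x 1 else 0) * Real.sin (x 2) ^ 2
          + x 1 ^ 2 * (if μ = 2 then 2 * Real.sin (x 2) * Real.cos (x 2) else 0))] α else 0 := by
  have hr : 0 < x 1 := r_pos hM (exterior_subset M hx)
  have hr' : 0 < x 1 - 2 * M := sub_pos.2 hx.1
  have h1 : HasDerivAt (fun r : ℝ => r ^ 2) (2 * x 1) (x 1) := by simpa using hasDerivAt_pow 2 (x 1)
  have h2 : HasDerivAt (fun θ : ℝ => Real.sin θ ^ 2) (2 * Real.sin (x 2) * Real.cos (x 2)) (x 2) := by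
    simpa using (Real.hasDerivAt_sin (x 2)).fun_pow 2
  have h3 : DifferentiableAt ℝ (fun r : ℝ => r * (r - 2 * M) / r ^ 2) (x 1) :=
    DifferentiableAt.fun_div (by fun_prop) (by fun_prop) (by positivity)
  have h4 : DifferentiableAt ℝ (fun r : ℝ => -(r ^ 2 / (r * (r - 2 * M)))) (x 1) :=
    (DifferentiableAt.fun_div (by fun_prop) (by fun_prop) (by positivity)).fun_neg
  refine ⟨deriv (fun r : ℝ => r * (r - 2 * M) / r ^ 2) (x 1),
    deriv (fun r : ℝ => -(r ^ 2 / (r * (r - 2 * M)))) (x 1), fun μ α β => ?_⟩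
  by_cases h : α = β
  · subst h
    rw [if_pos rfl]
    simp only [metric, Matrix.diagonal_apply_eq]
    fin_cases α
    · exact pd_coord h3.hasDerivAt μ
    · exact pd_coord h4.hasDerivAt μ
    · exact pd_coord h1.fun_neg μ
    · refine (pd_neg _ _ _).trans ?_
      rw [pd_mul (differentiableAt_coord h1.differentiableAt)
        (differentiableAt_coord h2.differentiableAt), pd_coord h1, pd_coord h2]
      rfl
  · rw [if_neg h]
    simp only [metric, Matrix.diagonal_apply_ne _ h, pd_const]

theorem christoffel_eq_diag (M : ℝ) (l μ ν : Fin 4) (x : Pt) : christoffel M l μ ν x =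
    1 / 2 * (gInv M x l * (pd μ (fun y => metric M y ν l) x
    + pd ν (fun y => metric M y μ l) x - pd l (fun y => metric M y μ ν) x)) := by
  rw [christoffel, Finset.sum_eq_single l]
  · rw [metricInv_apply, if_pos rfl]
  · intro b _ hb; rw [metricInv_apply, if_neg hb.symm, zero_mul]
  · simp

/-- The Christoffel symbols with an upper angular index. -/
theorem christoffel_angular (hM : 0 < M) {x : Pt} (hx : x ∈ exterior M) (μ ν : Fin 4) :
    christoffel M 2 μ ν x = (![![0, 0, 0, 0], ![0, 0, (x 1)⁻¹, 0],
      ![0, (x 1)⁻¹, 0, 0], ![0, 0, 0, -(Real.sin (x 2) * Real.cos (x 2))]] :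
        Fin 4 → Fin 4 → ℝ) μ ν ∧
    christoffel M 3 μ ν x = (![![0, 0, 0, 0], ![0, 0, 0, (x 1)⁻¹],
      ![0, 0, 0, Real.cos (x 2) / Real.sin (x 2)],
      ![0, (x 1)⁻¹, Real.cos (x 2) / Real.sin (x 2), 0]] : Fin 4 → Fin 4 → ℝ) μ ν := by
  have hr : 0 < x 1 := r_pos hM (exterior_subset M hx)
  have hsin := sin_pos_of_mem hx
  obtain ⟨a, b, h⟩ := exists_pd_metric hM hx
  simp only [christoffel_eq_diag, h, gInv, Matrix.cons_val]
  fin_cases μ <;> fin_cases ν <;> simp <;> field_simp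

/-- The covariant derivative of the covector field `√2 (m_a g + m̄_a ḡ)`, with components
`-2 r Re g` and `2 r sin θ Im g`. -/
theorem covDeriv_angular (hM : 0 < M) {X : Fin 4 → Pt → ℝ}
    (h0 : ∀ x ∈ exterior M, X 0 x = 0) (h1 : ∀ x ∈ exterior M, X 1 x = 0)
    (h2 : ∀ x ∈ exterior M, X 2 x = -2 * (x 1 * (g x).re))
    (h3 : ∀ x ∈ exterior M, X 3 x = 2 * (x 1 * (Real.sin (x 2) * (g x).im))) {x : Pt}
    (hx : x ∈ exterior M) (hg : DifferentiableAt ℝ g x) (k μ : Fin 4) :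
    covDeriv M X k μ x = (![![0, 0, -2 * (x 1 * (pd 0 g x).re),
        2 * (x 1 * (Real.sin (x 2) * (pd 0 g x).im))],
      ![0, 0, -2 * (x 1 * (pd 1 g x).re), 2 * (x 1 * (Real.sin (x 2) * (pd 1 g x).im))],
      ![0, 2 * (g x).re, -2 * (x 1 * (pd 2 g x).re),
        2 * (x 1 * (Real.sin (x 2) * (pd 2 g x).im))],
      ![0, -2 * (Real.sin (x 2) * (g x).im),
        -2 * (x 1 * ((pd 3 g x).re + Real.cos (x 2) * (g x).im)),
        2 * (x 1 * (Real.sin (x 2) * ((pd 3 g x).im - Real.cos (x 2) * (g x).re)))]] :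
      Fin 4 → Fin 4 → ℝ) k μ := by
  have hr : 0 < x 1 := r_pos hM (exterior_subset M hx)
  have hsin := sin_pos_of_mem hx
  have dre : DifferentiableAt ℝ (fun x => (g x).re) x := Complex.reCLM.differentiableAt.comp x hg
  have dim : DifferentiableAt ℝ (fun x => (g x).im) x := Complex.imCLM.differentiableAt.comp x hg
  have dr : DifferentiableAt ℝ (fun x : Pt => x 1) x := by fun_prop
  have pr := pd_coord (x := x) (ν := 1) (hasDerivAt_id' _)
  have ds := differentiableAt_coord (x := x) (ν := 2) Real.differentiable_sin.differentiableAt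
  have ps := pd_coord (x := x) (ν := 2) (Real.hasDerivAt_sin _)
  have p0 : ∀ k, pd k (X 0) x = 0 := fun k => (pd_congr_exterior h0 hx k).trans (pd_const _ _ _)
  have p1 : ∀ k, pd k (X 1) x = 0 := fun k => (pd_congr_exterior h1 hx k).trans (pd_const _ _ _)
  have p2 : ∀ k, pd k (X 2) x =
      -2 * ((if k = 1 then 1 else 0) * (g x).re + x 1 * (pd k g x).re) := fun k => by
    rw [pd_congr_exterior h2 hx, pd_mul (by fun_prop) (dr.fun_mul dre), pd_const, pd_mul dr dre, pr,
      pd_re hg]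
    ring
  have p3 : ∀ k, pd k (X 3) x = 2 * ((if k = 1 then 1 else 0) * (Real.sin (x 2) * (g x).im)
      + x 1 * ((if k = 2 then Real.cos (x 2) else 0) * (g x).im
        + Real.sin (x 2) * (pd k g x).im)) := fun k => by
    rw [pd_congr_exterior h3 hx, pd_mul (by fun_prop) (dr.fun_mul (ds.fun_mul dim)), pd_const,
      pd_mul dr (ds.fun_mul dim), pr, pd_mul ds dim, ps, pd_im hg]
    ring
  rw [covDeriv, Fin.sum_univ_four, h0 x hx, h1 x hx, h2 x hx, h3 x hx,
    (christoffel_angular hM hx k μ).1, (christoffel_angular hM hx k μ).2]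
  fin_cases k <;> fin_cases μ <;>
    simp only [Fin.zero_eta, Fin.mk_one, Fin.reduceFinMk, p0, p1, p2, p3, Matrix.cons_val,
      Fin.reduceEq, if_true, if_false] <;> field_simp <;> ring

end Pasqualotto

end SchwarzschildEM

namespace SchwarzschildEM

section Pasqualotto

variable {M : ℝ} {φ f y s : Pt → ℂ}

/-- The frame covector m is parallel along t and r, so D differentiates only the coefficient √Δ φ̂₂
= f, and the prefactor turns D f into `y`. -/
theorem IsDebyeOf.pasqVector_eq (h : IsDebyeOf M φ f y s) (hM : 0 < M) {A : Fin 4 → Pt → ℝ}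
    (hφ : ∀ x, φ x = (x 1 : ℂ) ^ 2 * maxwellPhi₂ M A x) {x : Pt} (hx : x ∈ exterior M)
    (μ : Fin 4) : pasqVector M A μ x = (![0, 0, -2 * (x 1 * (y x).re),
      2 * (x 1 * (Real.sin (x 2) * (y x).im))] : Fin 4 → ℝ) μ := by
  have hr : 0 < x 1 := r_pos hM (exterior_subset M hx)
  have hr' : 0 < x 1 - 2 * M := sub_pos.2 hx.1
  have hD := Delta_pos hM (exterior_subset M hx)
  have hq : 0 < √(Delta M x) := Real.sqrt_pos.2 hD
  have hq2 : √(Delta M x) ^ 2 = x 1 * (x 1 - 2 * M) := Real.sq_sqrt hD.le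
  have h2 : √2 ^ 2 = (2 : ℝ) := by norm_num
  set X : Fin 4 → Pt → ℝ := fun ν y => √(2 * Delta M y) *
    (mDown M y ν * maxwellPhi₂ M A y + star (mDown M y ν * maxwellPhi₂ M A y)).re with hX
  have hX' : ∀ ν, ∀ z ∈ exterior M, X ν z = 2 * √2 * (mDown M z ν * f z).re := fun ν z hz => by
    have hr : 0 < z 1 := r_pos hM (exterior_subset M hz)
    have hq : 0 < √(Delta M z) := Real.sqrt_pos.2 (Delta_pos hM (exterior_subset M hz))
    have e1 : (z 1 : ℂ) ≠ 0 := by exact_mod_cast hr.ne'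
    have e2 : (√(Delta M z) : ℂ) ≠ 0 := by exact_mod_cast hq.ne'
    have hp : (√(Delta M z) : ℂ) * maxwellPhi₂ M A z = f z := by
      have e := (hφ z).symm.trans (h.phi_eq z hz)
      push_cast at e
      field_simp at e
      linear_combination e
    rw [← hp, hX]
    simp only
    rw [mul_left_comm (mDown M z ν), Complex.re_ofReal_mul, Complex.add_re, Complex.star_def,
      Complex.conj_re, Real.sqrt_mul (by norm_num : (0 : ℝ) ≤ 2)]
    ring
  have c := covDeriv_angular (X := X) (g := f) hM
    (fun z hz => by rw [hX' 0 z hz, mDown_eq hM hz]; simp)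
    (fun z hz => by rw [hX' 1 z hz, mDown_eq hM hz]; simp)
    (fun z hz => by
      rw [hX' 2 z hz, mDown_eq hM hz]
      simp only [Matrix.cons_val, neg_mul, Complex.neg_re, Complex.re_ofReal_mul]
      field_simp)
    (fun z hz => by
      rw [hX' 3 z hz, mDown_eq hM hz]
      simp only [Matrix.cons_val, neg_mul, Complex.neg_re, mul_assoc, Complex.I_mul_re,
        Complex.im_ofReal_mul]
      field_simp)
    hx (h.smooth_f x (exterior_subset M hx)).diffAt
  have hy := h.y_eq x (exterior_subset M hx)
  have yre := congrArg Complex.re hy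
  have yim := congrArg Complex.im hy
  simp only [Complex.add_re, Complex.add_im, Complex.re_ofReal_mul, Complex.im_ofReal_mul]
    at yre yim
  change √2 * x 1 ^ 3 / √(Delta M x) * ∑ k, lUp M x k * covDeriv M X k μ x = _
  rw [Fin.sum_univ_four, c, c, c, c]
  have e2 : √2 ≠ 0 := by norm_num
  fin_cases μ <;>
    simp only [Fin.zero_eta, Fin.mk_one, Fin.reduceFinMk, Matrix.cons_val, lUp, mul_zero, zero_mul,
      add_zero]
  · rw [yre]
    generalize √(Delta M x) = q at *
    field_simp
    rw [hq2]
    ring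
  · rw [yim]
    generalize √(Delta M x) = q at *
    field_simp
    rw [hq2]
    ring

/-- The components of the vector have the shape treated by `covDeriv_angular`, this time with `g =
y`. The metric is negative on the spheres, which explains the signs in the vector density, and the
sphere derivative squared is the sum of |ð|² and |ð'|². -/
theorem IsDebyeOf.pasqVectorDensity_eq (h : IsDebyeOf M φ f y s) (hM : 0 < M)
    {A : Fin 4 → Pt → ℝ} (hφ : ∀ x, φ x = (x 1 : ℂ) ^ 2 * maxwellPhi₂ M A x) {x : Pt}
    (hx : x ∈ exterior M) :
    pasqVectorDensity M (pasqVector M A) x * sigmaVol M x = pasqForm M y x := by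
  have hr : 0 < x 1 := r_pos hM (exterior_subset M hx)
  have hr' : 0 < x 1 - 2 * M := sub_pos.2 hx.1
  have hD := Delta_pos hM (exterior_subset M hx)
  have hq : 0 < √(Delta M x) := Real.sqrt_pos.2 hD
  have hq2 : √(Delta M x) ^ 2 = x 1 * (x 1 - 2 * M) := Real.sq_sqrt hD.le
  have hsin := sin_pos_of_mem hx
  have h2 : √2 ^ 2 = (2 : ℝ) := by norm_num
  have hX := fun z (hz : z ∈ exterior M) => h.pasqVector_eq hM hφ hz
  have c := covDeriv_angular (X := pasqVector M A) (g := y) hM (fun z hz => hX z hz 0)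
    (fun z hz => hX z hz 1) (fun z hz => hX z hz 2) (fun z hz => hX z hz 3) hx
    (h.smooth_y x (exterior_subset M hx)).diffAt
  have hsq : ∀ X : Fin 4 → ℝ, covectorSq M x X = ∑ μ, gInv M x μ * X μ ^ 2 := fun X => by
    simp only [covectorSq, metricInv_apply, ite_mul, zero_mul, Finset.sum_ite_eq, Finset.mem_univ,
      if_true]
    exact Finset.sum_congr rfl fun μ _ => by ring
  have hn : ∀ z : ℂ, ‖z‖ ^ 2 = z.re ^ 2 + z.im ^ 2 := fun z => by
    rw [Complex.sq_norm, Complex.normSq_apply]; ring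
  have hsph : sphereDerivSq M (pasqVector M A) x =
      2 / x 1 ^ 2 * (‖dPlus y x‖ ^ 2 + ‖dMinus y x‖ ^ 2) := by
    rw [sphereDerivSq, dPlus_dMinus_norm, hn, hn]
    simp only [Finset.sum_pair (by decide : (2 : Fin 4) ≠ 3), metricInv_apply, c, gInv,
      Matrix.cons_val, Fin.reduceEq, if_true, if_false, Complex.add_re, Complex.add_im,
      Complex.I_mul_re, Complex.I_mul_im, Complex.re_ofReal_mul, Complex.im_ofReal_mul]
    field_simp
    ring
  rw [pasqVectorDensity, hsq, hsq, hsq, hsph, pasqForm, out_in_norm, hn (pd 0 y x), hn (pd 1 y x),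
    hn (y x)]
  simp only [Fin.sum_univ_four, c, hX x hx, gInv, lUp, nUp, Matrix.cons_val, sigmaVol, lapse]
  rw [Delta] at *
  generalize √(x 1 * (x 1 - 2 * M)) = q at *
  generalize √2 = a at *
  have ha : a ≠ 0 := by rintro rfl; norm_num at h2
  field_simp
  simp only [hq2, h2]
  ring

theorem IsDebyeOf.pasqVector_eq_chi (h : IsDebyeOf M φ f y s) (hM : 0 < M) {A : Fin 4 → Pt → ℝ}
    (hφ : ∀ x, φ x = (x 1 : ℂ) ^ 2 * maxwellPhi₂ M A x) {x : Pt} (hx : x ∈ exterior M)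
    (μ : Fin 4) : (pasqVector M A μ x : ℂ) =
      2 * (x 1 : ℂ) * (mDown M x μ * chi M φ x + star (mDown M x μ * chi M φ x)) := by
  have e1 : (x 1 : ℂ) ≠ 0 := by exact_mod_cast (r_pos hM (exterior_subset M hx)).ne'
  have e4 : (√2 : ℂ) ≠ 0 := by exact_mod_cast (by norm_num : √2 ≠ 0)
  have e7 : (√2 : ℂ) ^ 2 = 2 := by exact_mod_cast (by norm_num : √2 ^ 2 = (2 : ℝ))
  have hs : ∀ z : ℂ, z + star z = ((2 * z.re : ℝ) : ℂ) := fun z => by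
    rw [Complex.star_def, Complex.add_conj]
  rw [h.pasqVector_eq hM hφ hx, hs, mDown_eq hM hx, h.chi_eq x hx]
  fin_cases μ <;>
    simp only [Fin.zero_eta, Fin.mk_one, Fin.reduceFinMk, Matrix.cons_val, zero_mul, Complex.zero_re,
      mul_zero, Complex.ofReal_zero]
  · rw [show -((x 1 / √2 : ℝ) : ℂ) * (((√2 * x 1 : ℝ) : ℂ)⁻¹ * y x) = ((-(1 / 2) : ℝ) : ℂ) * y x by
      push_cast; field_simp; rw [e7]; ring, Complex.re_ofReal_mul]
    push_cast
    ring
  · rw [show -Complex.I * ((x 1 * Real.sin (x 2) / √2 : ℝ) : ℂ) * (((√2 * x 1 : ℝ) : ℂ)⁻¹ * y x) =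
      ((-(1 / 2) * Real.sin (x 2) : ℝ) : ℂ) * (Complex.I * y x) by
      push_cast; field_simp; rw [e7]; ring, Complex.re_ofReal_mul, Complex.I_mul_re]
    push_cast
    ring

end Pasqualotto

/-- Two expressions for `φ` with the same nonzero factor `r² / √Δ` show that `f` is the extreme
Maxwell scalar; the Maxwell equation then gives the Teukolsky equation. -/
theorem isHertzPotential_of_maxwell {M : ℝ} (hM : 0 < M) {A : Fin 4 → Pt → ℝ}
    (hA : IsSmoothOneForm M (fun μ x => (A μ x : ℂ)))
    (hF : IsMaxwell M (fieldStrength (fun μ x => (A μ x : ℂ)))) {φ : Pt → ℂ}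
    (hφ : ∀ x, φ x = (x 1 : ℂ) ^ 2 * maxwellPhi₂ M A x) : IsHertzPotential M φ := by
  have hspin : IsSmoothSpinNegOne M φ := hA.isSmoothSpinNegOne hM fun x _ => hφ x
  obtain ⟨f, y, s, h, h1, h2, h3⟩ := hspin.exists_isDebyeData hM
  refine ⟨hspin, fun x hx => (h.teukolsky_eq_zero_iff hM h2 h3 hx).2 ?_⟩
  refine (h.isDebye_of_maxwell hM (fun x hx => hA.contDiffAt hM hx) hF (fun x hx => ?_)).wave x hx
  have hr : 0 < x 1 := r_pos hM (exterior_subset M hx)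
  have hq : 0 < √(Delta M x) := Real.sqrt_pos.2 (Delta_pos hM (exterior_subset M hx))
  have h0 : ((x 1 ^ 2 / √(Delta M x) : ℝ) : ℂ) ≠ 0 := by
    exact_mod_cast (by positivity : 0 < x 1 ^ 2 / √(Delta M x)).ne'
  exact mul_left_cancel₀ h0 ((h1 x hx).symm.trans ((hφ x).trans (sq_mul_maxwell_eq hM _ hx)))

end SchwarzschildEM

/-! ### Assembly of the three statements -/

theorem mainTheorem6 (M : ℝ) (hM : 0 < M) :
    -- every smooth Hertz potential
    (∀ φ : Pt → ℂ, IsHertzPotential M φ →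
      IsMaxwell M (fieldStrength (hertzA M φ)) ∧
      IsSelfDual M (fieldStrength (hertzA M φ)) ∧
      (∀ x ∈ exterior M, hertzA M φ 3 x = -(1 / 2) * ernst M φ x) ∧
      (SigmaIntegrable M (canonicalDensity M (hertzA M φ)) ↔
        SigmaIntegrable M (pasqScalarDensity M (chi M φ))) ∧
      (SigmaIntegrable M (canonicalDensity M (hertzA M φ)) →
        canonicalEnergy M (hertzA M φ) =
            1 / (4 * Real.pi) * sigmaIntegral M (pasqScalarDensity M (chi M φ)) ∧
        -- Ernst-potential forms, for axisymmetric Hertz potentials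
        (IsAxisymmetric M φ →
          SigmaIntegrable M (ernstDensity M (ernst M φ)) ∧
          canonicalEnergy M (hertzA M φ) =
            1 / (8 * Real.pi) * sigmaIntegral M (ernstDensity M (ernst M φ)) ∧
          SigmaIntegrable M (ernstDensityZ M (ernst M φ)) ∧
          canonicalEnergy M (hertzA M φ) =
            1 / (8 * Real.pi) * sigmaIntegral M (ernstDensityZ M (ernst M φ))))) ∧
    -- every smooth real solution `Â` of the Maxwell equation, with `φ = r² φ̂₂`
    (∀ A : Fin 4 → Pt → ℝ, IsSmoothOneForm M (fun μ x => (A μ x : ℂ)) →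
      IsMaxwell M (fieldStrength (fun μ x => (A μ x : ℂ))) →
      ∀ φ : Pt → ℂ, (∀ x, φ x = (x 1 : ℂ) ^ 2 * maxwellPhi₂ M A x) →
        IsHertzPotential M φ ∧
        (∀ x ∈ exterior M, ∀ μ, (pasqVector M A μ x : ℂ) =
          2 * (x 1 : ℂ) * (mDown M x μ * chi M φ x + star (mDown M x μ * chi M φ x))) ∧
        (SigmaIntegrable M (canonicalDensity M (hertzA M φ)) ↔
          SigmaIntegrable M (pasqVectorDensity M (pasqVector M A))) ∧
        (SigmaIntegrable M (canonicalDensity M (hertzA M φ)) →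
          pasqEnergy M A = sigmaIntegral M (pasqScalarDensity M (chi M φ)) ∧
          canonicalEnergy M (hertzA M φ) = 1 / (4 * Real.pi) * pasqEnergy M A)) := by
  refine ⟨fun φ hφ => ?_, fun A hA hF φ hφ => ?_⟩
  · obtain ⟨i1, e1⟩ := hφ.energy hM
    obtain ⟨f, y, s, h⟩ := hφ.exists_isDebyeOf hM
    obtain ⟨m1, m2⟩ := h.isMaxwell_isSelfDual hM
    refine ⟨m1, m2, fun x hx => hertzA_three_eq_ernst hM hx, i1, fun hi => ⟨?_, fun ha => ?_⟩⟩
    · rw [canonicalEnergy, e1]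
    · obtain ⟨⟨j1, k1⟩, j2, k2⟩ := hφ.ernst_energy hM ha hi
      refine ⟨j1, ?_, j2, ?_⟩
      · rw [canonicalEnergy, k1]; ring
      · rw [canonicalEnergy, k2]; ring
  · have hH := isHertzPotential_of_maxwell hM hA hF hφ
    obtain ⟨i1, e1⟩ := hH.energy hM
    obtain ⟨f, y, s, h⟩ := hH.exists_isDebyeOf hM
    obtain ⟨i2, e2⟩ := sigma_congr fun x hx => pasqScalarDensity_eq hM h.smooth_y h.chi_eq hx
    obtain ⟨i3, e3⟩ := sigma_congr fun x hx => h.pasqVectorDensity_eq hM hφ hx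
    refine ⟨hH, fun x hx μ => h.pasqVector_eq_chi hM hφ hx μ, i1.trans (i2.trans i3.symm),
      fun _ => ⟨e3.trans e2.symm, ?_⟩⟩
    rw [canonicalEnergy, e1, e2, pasqEnergy, e3]
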